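/- Let $X$ be a smooth, proper, integral scheme over $\mathbb C$, let $L,A,B$ be line bundles (invertible sheaves) on $X$, and assume that $L$ is globally generated. (In particular this covers a smooth complex projective variety $X$ with $L$, $A$ very ample and $B = K_X+bA+P$, $b\ge \dim X+1$, $P$ globally generated.) Tensor products of line bundles are written additively, and $F(B)=F\otimes\mathcal O_X(B)$. **Carrying syzygies.** Let $Y$ be a scheme over $\mathbb C$, $N$ a line bundle on $Y$, $U\to H^0(Y,N)$ a linear map from a complex vector space, $M_U=\ker(U\otimes_{\mathbb C}\mathcal O_Y\to N)$, $\pi: U\twoheadrightarrow Q$ a quotient of finite dimension $w$, and $T\subseteq Y$ a closed subscheme. We say that $Q$ *carries weight $q$ syzygies for* a line bundle $C$ on $Y$ (with respect to $T$) if the composite $$\wedge^{w}M_U\to\wedge^{w}(Q\otimes_{\mathbb C}\mathcal O_Y)\cong\mathcal O_Y$$ factors through a map $\sigma:\wedge^{w}M_U\to I_{T/Y}$ such that the induced map $H^q(Y,\wedge^{w}M_U(C))\to H^q(Y,I_{T/Y}(C))$ is surjective. (The factorization is automatic if $U$ generates $N$ and $T$ is the scheme cut out by the sections in $\ker\pi$,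 and $\sigma$ does not depend on the trivialization of $\wedge^w(Q\otimes\mathcal O_Y)$ up to a unit.) **Setting.** Put $V=H^0(X,L)$. Let $\pi:V\twoheadrightarrow W$ be a finite-dimensional quotient and $Z\subseteq X$ a closed subscheme with $Z=X\cap\mathbb P(W)$ scheme-theoretically, i.e. the sections in $\ker\pi$ vanish on $Z$ and $\ker\pi\otimes_{\mathbb C}\mathcal O_X\to L\to L\otimes\mathcal O_Z$ is exact. Let $\Sigma_W$ be defined by the exact sequence $$0\to\Sigma_W\to W\otimes_{\mathbb C}\mathcal O_X\to L\otimes\mathcal O_Z\to0 .\qquad(*)$$ Let $\overline X\in|A|$ be a divisor such that $(*)$ remains exact after restriction to $\overline X$ (this holds for a general $\overline X$ if $A$ is very ample). Let $V'\subseteq V$ be the subspace of sections vanishing on $\overline X$, $W'=\pi(V')$, $\overline V=V/V'\subseteq H^0(\overline X,L|_{\overline X})$, $\overline W=W/W'$ with the induced quotient map $\overline V\twoheadrightarrow\overline W$, $\overline Z=Z\cap\overline X$ (scheme-theoretically), $\overline A=A|_{\overline X}$, $\overline B=B|_{\overline X}$. **Lemma.** Let $q\ge1$. If $\overline W$ carries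 weight $q-1$ syzygies for $\overline B+\overline A$ on $\overline X$ (with respect to $\overline V$ and $\overline Z$), and if $$H^q(X,I_{Z/X}(B+A))=0,$$ then $W$ carries weight $q$ syzygies for $B$ on $X$ (with respect to $V$ and $Z$). -/

import Mathlib

open CategoryTheory Limits AlgebraicGeometry

namespace SyzygyWeight
noncomputable section

section ExteriorPower

variable {C : Type} [Category.{0} C] {R : Cᵒᵖ ⥤ CommRingCat.{0}}

/-- The restriction maps `⋀ⁿ M(U) ⟶ ⋀ⁿ M(V)`, `m₁ ∧ ⋯ ∧ mₙ ↦ m₁|V ∧ ⋯ ∧ mₙ|V`. -/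
def presheafExteriorPowerMap (n : ℕ)
    (M : PresheafOfModules.{0} (R ⋙ forget₂ CommRingCat RingCat)) {U V : Cᵒᵖ} (f : U ⟶ V) :
    ModuleCat.exteriorPower (R := R.obj U) (M.obj U) n ⟶
      (ModuleCat.restrictScalars (R.map f).hom).obj
        (ModuleCat.exteriorPower (R := R.obj V) (M.obj V) n) :=
  ModuleCat.exteriorPower.desc (R := R.obj U) (M := M.obj U)
    (N := (ModuleCat.restrictScalars (R.map f).hom).obj
        (ModuleCat.exteriorPower (R := R.obj V) (M.obj V) n))
    { toFun := fun m ↦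
        exteriorPower.ιMulti (R.obj V) n (M := M.obj V) (fun k ↦ M.restrictₛₗ f (m k))
      map_update_add' := by
        intro _ m k x y
        have h (z : M.obj U) : (fun j ↦ M.restrictₛₗ f (Function.update m k z j)) =
            Function.update (fun j ↦ M.restrictₛₗ f (m j)) k (M.restrictₛₗ f z) := by
          ext j
          by_cases hj : j = k
          · subst hj; simp
          · simp [hj]
        rw [h, h, h, map_add]
        exact AlternatingMap.map_update_add
          (_root_.exteriorPower.ιMulti (R.obj V) n (M := M.obj V)) _ k _ _
      map_update_smul' := by
        intro _ m k c x
        have h (z : M.obj U) : (fun j ↦ M.restrictₛₗ f (Function.update m k z j)) =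
            Function.update (fun j ↦ M.restrictₛₗ f (m j)) k (M.restrictₛₗ f z) := by
          ext j
          by_cases hj : j = k
          · subst hj; simp
          · simp [hj]
        rw [h, h]
        refine (congrArg (fun z ↦ exteriorPower.ιMulti (R.obj V) n (M := M.obj V)
          (Function.update (fun j ↦ M.restrictₛₗ f (m j)) k z))
            ((M.restrictₛₗ f).map_smulₛₗ c x)).trans ?_
        exact AlternatingMap.map_update_smul (R := R.obj V)
          (exteriorPower.ιMulti (R.obj V) n (M := M.obj V)) _ k ((R.map f).hom c) _
      map_eq_zero_of_eq' := by
        intro m k l h hkl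
        refine AlternatingMap.map_eq_zero_of_eq
          (exteriorPower.ιMulti (R.obj V) n (M := M.obj V)) _ ?_ hkl
        rw [h] }

lemma presheafExteriorPowerMap_mk (n : ℕ)
    (M : PresheafOfModules.{0} (R ⋙ forget₂ CommRingCat RingCat)) {U V : Cᵒᵖ} (f : U ⟶ V)
    (m : Fin n → M.obj U) :
    (presheafExteriorPowerMap n M f).hom (exteriorPower.ιMulti (R.obj U) n (M := M.obj U) m) =
      exteriorPower.ιMulti (R.obj V) n (M := M.obj V) (fun k ↦ M.restrictₛₗ f (m k)) :=
  exteriorPower.alternatingMapLinearEquiv_apply_ιMulti _ _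

/-- The exterior power presheaf `U ↦ ⋀ⁿ M(U)` of a presheaf of modules. -/
def presheafExteriorPower (n : ℕ) :
    PresheafOfModules.{0} (R ⋙ forget₂ CommRingCat RingCat) ⥤
      PresheafOfModules.{0} (R ⋙ forget₂ CommRingCat RingCat) where
  obj M :=
    { obj := fun U ↦ ModuleCat.exteriorPower (R := R.obj U) (M.obj U) n
      map := fun f ↦ presheafExteriorPowerMap n M f
      map_id := by
        intro U
        refine ModuleCat.exteriorPower.hom_ext (R := R.obj U) (ModuleCat.AlternatingMap.ext ?_)
        intro m
        refine (presheafExteriorPowerMap_mk n M (𝟙 U) m).trans ?_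
        have : (fun k ↦ M.restrictₛₗ (𝟙 U) (m k)) = m := by
          ext k
          exact congrArg (fun g ↦ g.hom (m k)) (M.map_id U)
        rw [this]; rfl
      map_comp := by
        intro U V W f g
        refine ModuleCat.exteriorPower.hom_ext (R := R.obj U) (ModuleCat.AlternatingMap.ext ?_)
        intro m
        refine (presheafExteriorPowerMap_mk n M (f ≫ g) m).trans ?_
        refine Eq.trans ?_ (congrArg (presheafExteriorPowerMap n M g).hom
          (presheafExteriorPowerMap_mk n M f m)).symm
        refine Eq.trans ?_ (presheafExteriorPowerMap_mk n M g _).symm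
        congr 1
        ext k
        exact M.map_comp_apply f g (m k) }
  map {M N} φ :=
    { app := fun U ↦ ModuleCat.exteriorPower.map (R := R.obj U) (φ.app U) n
      naturality := by
        intro U V f
        refine ModuleCat.exteriorPower.hom_ext (R := R.obj U) (ModuleCat.AlternatingMap.ext ?_)
        intro m
        refine (congrArg (ModuleCat.exteriorPower.map (R := R.obj V) (φ.app V) n).hom
          (presheafExteriorPowerMap_mk n M f m)).trans ?_
        refine (ModuleCat.exteriorPower.map_mk (R := R.obj V) (φ.app V) _).trans ?_
        refine Eq.trans ?_ (congrArg (presheafExteriorPowerMap n N f).hom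
          (ModuleCat.exteriorPower.map_mk (R := R.obj U) (φ.app U) m)).symm
        refine Eq.trans ?_ (presheafExteriorPowerMap_mk n N f _).symm
        refine congrArg (exteriorPower.ιMulti (R.obj V) n (M := N.obj V)) ?_
        ext k
        exact PresheafOfModules.naturality_apply φ f (m k) }
  map_id M := by
    ext U : 1
    exact (ModuleCat.exteriorPower.functor (R.obj U) n).map_id (M.obj U)
  map_comp φ ψ := by
    ext U : 1
    exact (ModuleCat.exteriorPower.functor (R.obj U) n).map_comp (φ.app U) (ψ.app U)

end ExteriorPower

/-! ### Sheaves of modules on a scheme -/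

/-- The sheaf of modules associated with a presheaf of modules. -/
def associatedSheaf (X : Scheme.{0}) : X.PresheafOfModules ⥤ X.Modules :=
  PresheafOfModules.sheafification (R := X.ringCatSheaf) (𝟙 X.ringCatSheaf.obj)

/-- The exterior power `⋀ⁿ M`: the sheaf associated with `U ↦ ⋀ⁿ M(U)`. -/
def extPower (X : Scheme.{0}) (n : ℕ) : X.Modules ⥤ X.Modules :=
  Scheme.Modules.toPresheafOfModules X ⋙ presheafExteriorPower (R := X.presheaf) n ⋙
    associatedSheaf X

/-- The functor `M ↦ M ⊗ B`: the sheaf associated with `U ↦ M(U) ⊗ B(U)`. If `B` is the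
invertible sheaf of a divisor, this is `M ↦ M(B)`. -/
def twist {X : Scheme.{0}} (B : X.Modules) : X.Modules ⥤ X.Modules :=
  Scheme.Modules.toPresheafOfModules X ⋙
    MonoidalCategory.tensorRight
      (C := PresheafOfModules.{0} (X.presheaf ⋙ forget₂ CommRingCat RingCat))
      ((Scheme.Modules.toPresheafOfModules X).obj B) ⋙
    associatedSheaf X

/-- Sheaf cohomology `M ↦ H^q(X, M)`. -/
def cohomology (X : Scheme.{0}) (q : ℕ) : X.Modules ⥤ AddCommGrpCat.{0} :=
  SheafOfModules.toSheaf X.ringCatSheaf ⋙ Sheaf.functorH _ q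

/-- The structure sheaf `𝒪_X` as a module over itself. -/
abbrev structureModule (X : Scheme.{0}) : X.Modules := SheafOfModules.unit X.ringCatSheaf

/-- Invertible sheaves (line bundles): modules that are locally isomorphic to `𝒪_X`. -/
def IsInvertible {X : Scheme.{0}} (M : X.Modules) : Prop :=
  ∀ x : X, ∃ U : X.Opens, x ∈ U ∧
    Nonempty (M.restrict U.ι ≅ structureModule (U : Scheme.{0}))

/-- The map `𝒪_X ⟶ i_* 𝒪_Y` of a morphism `i : Y ⟶ X`. -/
def structureMap {X Y : Scheme.{0}} (i : Y ⟶ X) :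
    structureModule X ⟶ (Scheme.Modules.pushforward i).obj (structureModule Y) :=
  SheafOfModules.unitToPushforwardObjUnit i.toRingCatSheafHom

/-- The ideal sheaf `I_{Z/X}` of a closed subscheme `j : Z ⟶ X`, as a module on `X`. -/
def idealModule {X Z : Scheme.{0}} (j : Z ⟶ X) : X.Modules := kernel (structureMap j)

/-- The inclusion `I_{Z/X} ⟶ 𝒪_X`. -/
def idealModuleι {X Z : Scheme.{0}} (j : Z ⟶ X) : idealModule j ⟶ structureModule X :=
  kernel.ι (structureMap j)

/-- `M|_Z` regarded as a module on `X`, i.e. `j_* j^* M`. For a closed subscheme `j : Z ⟶ X`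
this is `M ⊗ 𝒪_Z`. -/
abbrev restrictTo {X Z : Scheme.{0}} (j : Z ⟶ X) (M : X.Modules) : X.Modules :=
  (Scheme.Modules.pushforward j).obj ((Scheme.Modules.pullback j).obj M)

/-- The restriction map `M ⟶ M|_Z`. -/
def restrictionMap {X Z : Scheme.{0}} (j : Z ⟶ X) (M : X.Modules) : M ⟶ restrictTo j M :=
  (Scheme.Modules.pullbackPushforwardAdjunction j).unit.app M

/-- The closed subscheme `i : D ⟶ X` is a divisor in the linear system `|A|`: it is the zero
scheme of a section `s` of `A` that is a non-zero-divisor. Equivalently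
`0 ⟶ 𝒪_X ⟶ A ⟶ A|_D ⟶ 0` is exact, where the first map is `s`. -/
def IsDivisorOf {X D : Scheme.{0}} (i : D ⟶ X) (A : X.Modules) : Prop :=
  ∃ (s : structureModule X ⟶ A) (w : s ≫ restrictionMap i A = 0),
    (ShortComplex.mk s (restrictionMap i A) w).ShortExact

/-! ### Trivial bundles and global sections over `ℂ` -/

/-- The trivial bundle `V ↦ V ⊗_ℂ 𝒪_X`: the pullback to `X` of the sheaf `Ṽ` on `Spec ℂ`. -/
def trivialBundle {X : Scheme.{0}} (f : X ⟶ Spec (CommRingCat.of ℂ)) :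
    ModuleCat.{0} ℂ ⥤ X.Modules :=
  tilde.functor (CommRingCat.of ℂ) ⋙ Scheme.Modules.pullback f

/-- The functor of global sections `M ↦ H⁰(X, M)`, with values in complex vector spaces. -/
def globalSections {X : Scheme.{0}} (f : X ⟶ Spec (CommRingCat.of ℂ)) :
    X.Modules ⥤ ModuleCat.{0} ℂ :=
  Scheme.Modules.pushforward f ⋙ moduleSpecΓFunctor (R := CommRingCat.of ℂ)

/-- Maps `V ⊗_ℂ 𝒪_X ⟶ M` are the same as linear maps `V ⟶ H⁰(X, M)`. -/
def trivialBundleAdjunction {X : Scheme.{0}} (f : X ⟶ Spec (CommRingCat.of ℂ)) :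
    trivialBundle f ⊣ globalSections f :=
  (tilde.adjunction (R := CommRingCat.of ℂ)).comp
    (Scheme.Modules.pullbackPushforwardAdjunction f)

/-- The evaluation map `V ⊗_ℂ 𝒪_X ⟶ M` of a linear map `φ : V ⟶ H⁰(X, M)`. -/
def evalMap {X : Scheme.{0}} (f : X ⟶ Spec (CommRingCat.of ℂ)) {M : X.Modules}
    {V : ModuleCat.{0} ℂ} (φ : V ⟶ (globalSections f).obj M) : (trivialBundle f).obj V ⟶ M :=
  ((trivialBundleAdjunction f).homEquiv V M).symm φ

lemma evalMap_comp {X : Scheme.{0}} (f : X ⟶ Spec (CommRingCat.of ℂ)) {M N : X.Modules}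
    {V : ModuleCat.{0} ℂ} (φ : V ⟶ (globalSections f).obj M) (g : M ⟶ N) :
    evalMap f φ ≫ g = evalMap f (φ ≫ (globalSections f).map g) :=
  ((trivialBundleAdjunction f).homEquiv_naturality_right_symm φ g).symm

lemma evalMap_comp_eq_zero {X : Scheme.{0}} (f : X ⟶ Spec (CommRingCat.of ℂ))
    {M N : X.Modules} {V : ModuleCat.{0} ℂ} (φ : V ⟶ (globalSections f).obj M) (g : M ⟶ N)
    (h : φ ≫ (globalSections f).map g = 0) : evalMap f φ ≫ g = 0 := by
  rw [evalMap_comp, h, evalMap, Adjunction.homEquiv_counit]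
  have : (trivialBundle f).IsLeftAdjoint := (trivialBundleAdjunction f).isLeftAdjoint
  have := preservesBinaryBiproducts_of_preservesBinaryCoproducts (trivialBundle f)
  have := Functor.additive_of_preservesBinaryBiproducts (trivialBundle f)
  rw [Functor.map_zero, zero_comp]

/-- `L` is generated by its global sections. -/
def IsGloballyGenerated {X : Scheme.{0}} (f : X ⟶ Spec (CommRingCat.of ℂ)) (L : X.Modules) :
    Prop :=
  Epi (evalMap f (𝟙 ((globalSections f).obj L)))

/-! ### Syzygy bundles and the weight of the syzygies carried by a quotient

Below, `φ : V ⟶ H⁰(X, L)` is a vector space of sections of `L` and `π : V ⟶ W` is a quotient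
of `V`. -/

section Weight

variable {X : Scheme.{0}} (f : X ⟶ Spec (CommRingCat.of ℂ)) {L : X.Modules}
  {V W : ModuleCat.{0} ℂ} (φ : V ⟶ (globalSections f).obj L) (π : V ⟶ W)

/-- The kernel `M_V` of the evaluation map `V ⊗_ℂ 𝒪_X ⟶ L`. -/
def kernelBundle : X.Modules := kernel (evalMap f φ)

/-- The composite `M_V ⟶ V ⊗_ℂ 𝒪_X ⟶ W ⊗_ℂ 𝒪_X`. -/
def kernelBundleMap : kernelBundle f φ ⟶ (trivialBundle f).obj W :=
  kernel.ι (evalMap f φ) ≫ (trivialBundle f).map π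

/-- Let `w = dim W`, and let `j : Z ⟶ X` be a closed subscheme. The map `σ : ⋀ʷ M_V ⟶ I_{Z/X}`
is the one through which `⋀ʷ M_V ⟶ ⋀ʷ (W ⊗_ℂ 𝒪_X) ≅ 𝒪_X` factors; the factorization exists
if `V` generates `L` and `Z` is cut out by the sections in `ker π`. It is unique once the trivialization `t` of
`⋀ʷ (W ⊗_ℂ 𝒪_X)` is chosen, and another choice of `t` changes it by a unit of `𝒪_X`.
`W` carries weight `q` syzygies for `B` if `H^q(X, ⋀ʷ M_V ⊗ B) ⟶ H^q(X, I_{Z/X} ⊗ B)`,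
the map induced by `σ`, is surjective. -/
def CarriesWeight [Module.Finite ℂ W] {Z : Scheme.{0}} (j : Z ⟶ X) (B : X.Modules) (q : ℕ) :
    Prop :=
  ∃ (t : (extPower X (Module.finrank ℂ W)).obj ((trivialBundle f).obj W) ≅ structureModule X)
    (σ : (extPower X (Module.finrank ℂ W)).obj (kernelBundle f φ) ⟶ idealModule j),
    σ ≫ idealModuleι j =
      (extPower X (Module.finrank ℂ W)).map (kernelBundleMap f φ π) ≫ t.hom ∧
    Function.Surjective ((cohomology X q).map ((twist B).map σ))

/-- `Z = X ∩ ℙ(W)` scheme-theoretically: the sections in `ker π` vanish on `Z`, and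
they generate the subsheaf `I_{Z/X} L` of `L`, i.e. `(ker π) ⊗_ℂ 𝒪_X ⟶ L ⟶ L|_Z` is exact. -/
structure IsLinearSection {Z : Scheme.{0}} (j : Z ⟶ X) : Prop where
  vanish : (kernel.ι π ≫ φ) ≫ (globalSections f).map (restrictionMap j L) = 0
  exact : (ShortComplex.mk (evalMap f (kernel.ι π ≫ φ)) (restrictionMap j L)
    (evalMap_comp_eq_zero f _ _ vanish)).Exact

section Sigma

variable {f φ π} [Epi π] {Z : Scheme.{0}} {j : Z ⟶ X} (h : IsLinearSection f φ π j)

/-- The map `W ⟶ H⁰(X, L|_Z)` induced by `V ⟶ H⁰(X, L) ⟶ H⁰(X, L|_Z)`. -/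
def quotientSections : W ⟶ (globalSections f).obj (restrictTo j L) :=
  (Abelian.epiIsCokernelOfKernel (KernelFork.ofι (kernel.ι π) (kernel.condition π))
    (kernelIsKernel π)).desc
    (CokernelCofork.ofπ (φ ≫ (globalSections f).map (restrictionMap j L))
      ((Category.assoc _ _ _).symm.trans h.vanish))

lemma comp_quotientSections :
    π ≫ quotientSections h = φ ≫ (globalSections f).map (restrictionMap j L) :=
  (Abelian.epiIsCokernelOfKernel (KernelFork.ofι (kernel.ι π) (kernel.condition π))
    (kernelIsKernel π)).fac _ WalkingParallelPair.one

/-- The sequence `0 ⟶ Σ_W ⟶ W ⊗_ℂ 𝒪_X ⟶ L ⊗ 𝒪_Z ⟶ 0`, where `Σ_W` is the kernel of the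
second map. -/
def sigmaSequence : ShortComplex X.Modules :=
  ShortComplex.mk (kernel.ι (evalMap f (quotientSections h))) (evalMap f (quotientSections h))
    (kernel.condition _)

end Sigma

end Weight

/-! ### Restriction to a divisor -/

/-- The injection `V / ker g ⟶ N` induced by a linear map `g : V ⟶ N`. -/
def quotientKerDesc {V N : ModuleCat.{0} ℂ} (g : V ⟶ N) :
    ModuleCat.of ℂ (V ⧸ LinearMap.ker g.hom) ⟶ N :=
  ModuleCat.ofHom ((LinearMap.ker g.hom).liftQ g.hom le_rfl)

section Bar

variable {X D : Scheme.{0}} (f : X ⟶ Spec (CommRingCat.of ℂ)) {L : X.Modules}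
  {V W : ModuleCat.{0} ℂ} (φ : V ⟶ (globalSections f).obj L) (π : V ⟶ W) (i : D ⟶ X)

/-- The restriction of sections `H⁰(X, L) ⟶ H⁰(D, L|_D)`. -/
def restrictSections (L : X.Modules) :
    (globalSections f).obj L ⟶
      (globalSections (i ≫ f)).obj ((Scheme.Modules.pullback i).obj L) :=
  (globalSections f).map (restrictionMap i L) ≫
    (moduleSpecΓFunctor (R := CommRingCat.of ℂ)).map
      ((Scheme.Modules.pushforwardComp i f).hom.app ((Scheme.Modules.pullback i).obj L))

/-- `V' ⊆ V`: the sections in `V` that vanish on `D`. -/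
def subSections : Submodule ℂ V := LinearMap.ker (φ ≫ restrictSections f i L).hom

/-- `W' = π(V')`. -/
def subQuotient : Submodule ℂ W := (subSections f φ i).map π.hom

/-- `V̄ = V / V'`. -/
abbrev barV : ModuleCat.{0} ℂ := ModuleCat.of ℂ (V ⧸ subSections f φ i)

/-- `W̄ = W / W'`. -/
abbrev barW : ModuleCat.{0} ℂ := ModuleCat.of ℂ (W ⧸ subQuotient f φ π i)

/-- The inclusion of `V̄` in `H⁰(D, L|_D)`. -/
def barφ : barV f φ i ⟶ (globalSections (i ≫ f)).obj ((Scheme.Modules.pullback i).obj L) :=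
  quotientKerDesc (φ ≫ restrictSections f i L)

/-- The quotient map `V̄ ⟶ W̄` induced by `π`. -/
def barπ : barV f φ i ⟶ barW f φ π i :=
  ModuleCat.ofHom ((subSections f φ i).mapQ (subQuotient f φ π i) π.hom
    (Submodule.le_comap_map _ _))

end Bar

end

end SyzygyWeight

/-! Write w = dim W, and let D be the divisor. The determinant map `⋀ʷ M_V ⟶ I_Z` fits into a map of
short exact sequences, whose first arrows are multiplication by the section of A that defines D: 0 →
⋀ʷM_V(B) → ⋀ʷM_V(B+A) → i_*(⋀ʷM_V|_D)(B+A) → 0, 0 → I_Z(B) → I_Z(B+A) → i_*(I_{Z∩D/D})(B+A) → 0.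
Since H^q(I_Z(B+A)) = 0, every class in H^q(I_Z(B)) comes from H^{q-1}(I_{Z∩D/D}(B+A)) by the
connecting map. By naturality it is enough that the determinant map on D is onto in degree q-1
(`ext_surjective_of_shortExact`, `cohomology_surjective_of_divisor`).

That surjectivity follows from the hypothesis on W̄. The restriction of M_V to D is the kernel
bundle of V → H⁰(D, L|_D). It contains the constant sections V' and, after splitting V → V̄, a copy
of M_V̄. Wedging with lifts to V' of a basis of W' maps ⋀ M_V̄ to ⋀ʷ M_V|_D and turns the
determinant of W into that of W̄ (`exists_wedge`). So the map known to be surjective factors through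
the required one.

The first sequence is exact because M_V has local frames that restrict to frames on D
(`IsFrame.extPower`, `exists_isCut_extPush`); frames of arbitrary, possibly infinite, size are
allowed. The second is exact because the equation of D is a non-zero-divisor on Z, which is what
exactness of (∗) on D provides (`locally_cm_eq_zero_of_mul`), and because the ideal of Z ∩ D is the
sum of the ideals of Z and D (`exists_add_of_cm_pullback_eq_zero`).

Cohomology is Ext out of the constant sheaf ℤ. Passing from D to X uses that i_* is exact and
preserves injectives, so that H^p(D, G) → H^p(X, i_*G) is onto (`pushSh_surjective`). -/

namespace SyzygyWeight
-- Sheaves of modules and sheafification in terms of sections.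
noncomputable section

/-! ### Sections of presheaves of modules -/

section Sections

variable {X : Scheme.{0}} {P Q K : X.PresheafOfModules} {U V W : X.Opens}

/-- Sections over `U` of a presheaf of modules, as a plain module over `Γ(X, U)`. -/
def Sec (P : X.PresheafOfModules) (U : X.Opens) : Type := P.obj (.op U)

instance : AddCommGroup (Sec P U) := inferInstanceAs (AddCommGroup (P.obj (.op U)))

instance : Module Γ(X, U) (Sec P U) := (P.obj (.op U)).isModule

/-- Restriction of functions. -/
def rres (h : V ≤ U) : Γ(X, U) →+* Γ(X, V) := (X.presheaf.map (homOfLE h).op).hom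

/-- Restriction of sections. -/
def res (h : V ≤ U) : Sec P U →+ Sec P V :=
  AddMonoidHom.mk' (fun s ↦ P.map (homOfLE h).op s) (fun _ _ ↦ map_add (P.map (homOfLE h).op).hom _ _)

lemma res_smul (h : V ≤ U) (a : Γ(X, U)) (s : Sec P U) :
    res h (a • s) = rres h a • res h s :=
  P.map_smul (homOfLE h).op a s

@[simp] lemma res_res (h : V ≤ U) (h' : W ≤ V) (s : Sec P U) :
    res h' (res h s) = res (h'.trans h) s :=
  (P.map_comp_apply (homOfLE h).op (homOfLE h').op s).symm

@[simp] lemma res_self (h : U ≤ U) (s : Sec P U) : res h s = s :=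
  congrArg (fun g ↦ g.hom s) (P.map_id (.op U))

@[simp] lemma rres_rres (h : V ≤ U) (h' : W ≤ V) (a : Γ(X, U)) :
    rres h' (rres h a) = rres (h'.trans h) a :=
  congrArg (fun g ↦ g.hom a) (X.presheaf.map_comp (homOfLE h).op (homOfLE h').op).symm

@[simp] lemma rres_self (h : U ≤ U) (a : Γ(X, U)) : rres h a = a :=
  congrArg (fun g ↦ g.hom a) (X.presheaf.map_id (.op U))

/-- The action of a morphism on sections. -/
def ap (φ : P ⟶ Q) (U : X.Opens) : Sec P U →ₗ[Γ(X, U)] Sec Q U where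
  toFun s := φ.app (.op U) s
  map_add' := map_add (φ.app (.op U)).hom
  map_smul' a s := (φ.app (.op U)).hom.map_smul a s

lemma ap_res (φ : P ⟶ Q) (h : V ≤ U) (s : Sec P U) : ap φ V (res h s) = res h (ap φ U s) :=
  PresheafOfModules.naturality_apply φ (homOfLE h).op s

lemma hom_ext_ap {φ ψ : P ⟶ Q} (h : ∀ U (s : Sec P U), ap φ U s = ap ψ U s) : φ = ψ := by
  refine PresheafOfModules.hom_ext fun U ↦ ?_
  ext s
  exact h U.unop s

/-- A morphism of presheaves of modules from a natural family of linear maps. -/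
def mkHom (f : ∀ U, Sec P U →ₗ[Γ(X, U)] Sec Q U)
    (hf : ∀ {U V : X.Opens} (h : V ≤ U) (s : Sec P U), f V (res h s) = res h (f U s)) :
    P ⟶ Q where
  app U := ModuleCat.ofHom (X := P.obj U) (Y := Q.obj U) (f U.unop)
  naturality {U V} g := by
    ext s
    exact hf (leOfHom g.unop) s

/-- A presheaf of abelian groups from a family of groups and restriction maps. -/
def mkAbPre (S : X.Opens → Type) [∀ U, AddCommGroup (S U)]
    (r : ∀ {U V : X.Opens}, V ≤ U → S U →+ S V)
    (h1 : ∀ {U : X.Opens} (s : S U), r le_rfl s = s)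
    (h2 : ∀ {U V W : X.Opens} (h : V ≤ U) (h' : W ≤ V) (s : S U),
      r (h'.trans h) s = r h' (r h s)) : (TopologicalSpace.Opens X)ᵒᵖ ⥤ Ab where
  obj U := AddCommGrpCat.of (S U.unop)
  map f := AddCommGrpCat.ofHom (r (leOfHom f.unop))
  map_id U := by ext s; exact h1 s
  map_comp f g := by ext s; exact h2 (leOfHom f.unop) (leOfHom g.unop) s

instance (S : X.Opens → Type) [∀ U, AddCommGroup (S U)] [∀ U, Module Γ(X, U) (S U)]
    (r : ∀ {U V : X.Opens}, V ≤ U → S U →+ S V)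
    (h1 : ∀ {U : X.Opens} (s : S U), r le_rfl s = s)
    (h2 : ∀ {U V W : X.Opens} (h : V ≤ U) (h' : W ≤ V) (s : S U),
      r (h'.trans h) s = r h' (r h s)) (U : (TopologicalSpace.Opens X)ᵒᵖ) :
    Module (X.ringCatSheaf.obj.obj U) ((mkAbPre S r h1 h2).obj U) :=
  inferInstanceAs (Module Γ(X, U.unop) (S U.unop))

/-- A presheaf of modules from a family of modules and restriction maps. -/
def mkPre (S : X.Opens → Type) [∀ U, AddCommGroup (S U)] [∀ U, Module Γ(X, U) (S U)]
    (r : ∀ {U V : X.Opens}, V ≤ U → S U →+ S V)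
    (h1 : ∀ {U : X.Opens} (s : S U), r le_rfl s = s)
    (h2 : ∀ {U V W : X.Opens} (h : V ≤ U) (h' : W ≤ V) (s : S U),
      r (h'.trans h) s = r h' (r h s))
    (hs : ∀ {U V : X.Opens} (h : V ≤ U) (a : Γ(X, U)) (s : S U),
      r h (a • s) = rres h a • r h s) : X.PresheafOfModules :=
  PresheafOfModules.ofPresheaf (mkAbPre S r h1 h2) (fun {_ _} f a s ↦ hs (leOfHom f.unop) a s)

end Sections

section Sheaves

variable {X : Scheme.{0}} {M N K : X.Modules} {U V W : X.Opens}

/-- The presheaf of modules underlying a sheaf of modules. -/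
def pm (M : X.Modules) : X.PresheafOfModules := (Scheme.Modules.toPresheafOfModules X).obj M

/-- The underlying morphism of presheaves of modules. -/
def pmMap (φ : M ⟶ N) : pm M ⟶ pm N := (Scheme.Modules.toPresheafOfModules X).map φ

/-- The property `p` holds on a neighbourhood of every point of `U`. -/
def Locally (U : X.Opens) (p : ∀ V : X.Opens, V ≤ U → Prop) : Prop :=
  ∀ x ∈ U, ∃ (V : X.Opens) (h : V ≤ U), x ∈ V ∧ p V h

lemma sec_ext (s t : Sec (pm M) U) (h : Locally U fun _ h ↦ res h s = res h t) : s = t := by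
  choose V hV hx he using h
  refine TopCat.Sheaf.eq_of_locally_eq' (⟨(pm M).presheaf, M.isSheaf⟩ : TopCat.Sheaf Ab X)
    (fun x : U ↦ V x.1 x.2) U (fun x ↦ homOfLE (hV x.1 x.2)) ?_ s t ?_
  · intro x hxU
    exact TopologicalSpace.Opens.mem_iSup.2 ⟨⟨x, hxU⟩, hx x hxU⟩
  · intro x
    exact he x.1 x.2

lemma sec_eq_zero (s : Sec (pm M) U) (h : Locally U fun _ h ↦ res h s = 0) : s = 0 :=
  sec_ext s 0 (by simpa using h)

lemma sec_glue {ι : Type} (O : ι → X.Opens) (hO : ∀ i, O i ≤ U) (hc : ∀ x ∈ U, ∃ i, x ∈ O i)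
    (s : ∀ i, Sec (pm M) (O i))
    (hs : ∀ i k, res (inf_le_left : O i ⊓ O k ≤ O i) (s i) =
      res (inf_le_right : O i ⊓ O k ≤ O k) (s k)) :
    ∃ t : Sec (pm M) U, ∀ i, res (hO i) t = s i := by
  obtain ⟨t, ht, -⟩ := TopCat.Sheaf.existsUnique_gluing'
    (⟨(pm M).presheaf, M.isSheaf⟩ : TopCat.Sheaf Ab X) O U (fun i ↦ homOfLE (hO i))
    (fun x hx ↦ TopologicalSpace.Opens.mem_iSup.2 (hc x hx)) (fun i ↦ s i) (fun i k ↦ hs i k)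
  exact ⟨t, ht⟩

/-- The action of a morphism of sheaves on sections. -/
abbrev sap (φ : M ⟶ N) (U : X.Opens) : Sec (pm M) U →ₗ[Γ(X, U)] Sec (pm N) U := ap (pmMap φ) U

@[simp] lemma sap_comp (φ : M ⟶ N) (ψ : N ⟶ K) (s : Sec (pm M) U) :
    sap (φ ≫ ψ) U s = sap ψ U (sap φ U s) := rfl

@[simp] lemma sap_id (s : Sec (pm M) U) : sap (𝟙 M) U s = s := rfl

@[simp] lemma sap_zero (s : Sec (pm M) U) : sap (0 : M ⟶ N) U s = 0 := rfl

lemma shom_ext {φ ψ : M ⟶ N} (h : ∀ U (s : Sec (pm M) U), sap φ U s = sap ψ U s) : φ = ψ :=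
  (Scheme.Modules.toPresheafOfModules X).map_injective (hom_ext_ap (P := pm M) (Q := pm N) h)

/-- A morphism of sheaves of modules from a natural family of linear maps. -/
def mkSHom (f : ∀ U, Sec (pm M) U →ₗ[Γ(X, U)] Sec (pm N) U)
    (hf : ∀ {U V : X.Opens} (h : V ≤ U) (s : Sec (pm M) U), f V (res h s) = res h (f U s)) :
    M ⟶ N :=
  Scheme.Modules.fullyFaithfulToPresheafOfModules.preimage (mkHom (P := pm M) (Q := pm N) f hf)

end Sheaves

/-! ### Sheafification -/

section Sheafification

variable {X : Scheme.{0}} {P Q : X.PresheafOfModules} {M N : X.Modules} {U V W : X.Opens}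

/-- The adjunction between sheafification and the forgetful functor. -/
def shAdj (X : Scheme.{0}) : associatedSheaf X ⊣ Scheme.Modules.toPresheafOfModules X ⋙
      PresheafOfModules.restrictScalars (𝟙 X.ringCatSheaf.obj) :=
  PresheafOfModules.sheafificationAdjunction (R := X.ringCatSheaf) (𝟙 X.ringCatSheaf.obj)

/-- The canonical map from the sections of a presheaf to those of the associated sheaf. -/
def η (P : X.PresheafOfModules) (U : X.Opens) :
    Sec P U →ₗ[Γ(X, U)] Sec (pm ((associatedSheaf X).obj P)) U where
  toFun s := ((shAdj X).unit.app P).app (.op U) s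
  map_add' := map_add (((shAdj X).unit.app P).app (.op U)).hom
  map_smul' a s := (((shAdj X).unit.app P).app (.op U)).hom.map_smul a s

lemma η_res (h : V ≤ U) (s : Sec P U) : η P V (res h s) = res h (η P U s) :=
  PresheafOfModules.naturality_apply ((shAdj X).unit.app P) (homOfLE h).op s

/-- With `η_surjective_locally`, this is all that is used about the sheaf associated with a
presheaf, besides its universal property. -/
lemma η_injective_locally (s : Sec P U) (h : η P U s = 0) :
    Locally U fun _ h ↦ res h s = 0 := by
  intro x hx
  have := Presheaf.equalizerSieve_mem (Opens.grothendieckTopology X)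
    (CategoryTheory.toSheafify (Opens.grothendieckTopology X) P.presheaf) (X := .op U) s 0
    (h.trans (map_zero (η P U)).symm)
  obtain ⟨V, f, hf, hxV⟩ := this x hx
  refine ⟨V, leOfHom f, hxV, ?_⟩
  exact (show res (leOfHom f) s = res (leOfHom f) 0 from hf).trans (map_zero _)

lemma η_surjective_locally (s : Sec (pm ((associatedSheaf X).obj P)) U) :
    Locally U fun V h ↦ ∃ t : Sec P V, η P V t = res h s := by
  intro x hx
  have := Presheaf.imageSieve_mem (Opens.grothendieckTopology X)
    (CategoryTheory.toSheafify (Opens.grothendieckTopology X) P.presheaf) (U := .op U) s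
  obtain ⟨V, f, ⟨t, ht⟩, hxV⟩ := this x hx
  exact ⟨V, leOfHom f, hxV, t, ht⟩

@[simp] lemma sap_associatedSheaf_map (φ : P ⟶ Q) (s : Sec P U) :
    sap ((associatedSheaf X).map φ) U (η P U s) = η Q U (ap φ U s) :=
  congrArg (fun g ↦ (g.app (.op U)).hom s) ((shAdj X).unit.naturality φ).symm

lemma associatedSheaf_hom_ext {φ ψ : (associatedSheaf X).obj P ⟶ N}
    (h : ∀ U (s : Sec P U), sap φ U (η P U s) = sap ψ U (η P U s)) : φ = ψ := by
  refine shom_ext fun U s ↦ sec_ext _ _ fun x hx ↦ ?_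
  obtain ⟨V, hV, hxV, t, ht⟩ := η_surjective_locally s x hx
  refine ⟨V, hV, hxV, ?_⟩
  change res hV (sap φ U s) = res hV (sap ψ U s)
  rw [← ap_res, ← ap_res, ← ht, h]

/-- The morphism from the associated sheaf induced by a morphism of presheaves to a sheaf. -/
def shDesc (f : ∀ U, Sec P U →ₗ[Γ(X, U)] Sec (pm N) U)
    (hf : ∀ {U V : X.Opens} (h : V ≤ U) (s : Sec P U), f V (res h s) = res h (f U s)) :
    (associatedSheaf X).obj P ⟶ N :=
  ((shAdj X).homEquiv P N).symm
    (mkHom (Q := (PresheafOfModules.restrictScalars (𝟙 X.ringCatSheaf.obj)).obj (pm N)) f hf)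

@[simp] lemma sap_shDesc (f : ∀ U, Sec P U →ₗ[Γ(X, U)] Sec (pm N) U)
    (hf : ∀ {U V : X.Opens} (h : V ≤ U) (s : Sec P U), f V (res h s) = res h (f U s))
    (s : Sec P U) : sap (shDesc f hf) U (η P U s) = f U s := by
  have := (shAdj X).homEquiv_unit (X := P) (Y := N) (f := shDesc f hf)
  replace this := this.symm.trans (((shAdj X).homEquiv P N).apply_symm_apply _)
  exact congrArg (fun g ↦ (g.app (.op U)).hom s) this

/-- The quotient of a presheaf of modules by a natural family of submodules. -/
def quotPre (P : X.PresheafOfModules) (S : ∀ U, Submodule Γ(X, U) (Sec P U))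
    (hS : ∀ {U V : X.Opens} (h : V ≤ U) (s : Sec P U), s ∈ S U → res h s ∈ S V) :
    X.PresheafOfModules :=
  mkPre (fun U ↦ Sec P U ⧸ S U)
    (fun {U V} h ↦ QuotientAddGroup.map (S U).toAddSubgroup (S V).toAddSubgroup (res h)
      (fun s hs ↦ hS h s hs))
    (by
      rintro U ⟨s⟩
      exact congrArg (Submodule.Quotient.mk (p := S U)) (res_self le_rfl s))
    (by
      rintro U V W h h' ⟨s⟩
      exact congrArg (Submodule.Quotient.mk (p := S W)) (res_res h h' s).symm)
    (by
      rintro U V h a ⟨s⟩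
      exact congrArg (Submodule.Quotient.mk (p := S V)) (res_smul h a s))

/-- If every morphism out of `M` that kills a natural family of submodules is zero, then every
section lies locally in that family. -/
lemma locally_mem_of_hom_eq_zero (S : ∀ U, Submodule Γ(X, U) (Sec (pm M) U))
    (hS : ∀ {U V : X.Opens} (h : V ≤ U) (s : Sec (pm M) U), s ∈ S U → res h s ∈ S V)
    (H : ∀ (N : X.Modules) (φ : M ⟶ N), (∀ U, ∀ s ∈ S U, sap φ U s = 0) → φ = 0)
    (s : Sec (pm M) U) : Locally U fun V h ↦ res h s ∈ S V := by
  -- The test morphism is the projection to the sheafified quotient by `S`. It kills `S`, so it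
  -- vanishes by assumption, and a section that dies in the sheafification lies locally in `S`.
  let π : (pm M) ⟶ quotPre (pm M) S hS :=
    mkHom (Q := quotPre (pm M) S hS) (fun U ↦ (S U).mkQ) (fun _ _ ↦ rfl)
  let φ : M ⟶ (associatedSheaf X).obj (quotPre (pm M) S hS) :=
    mkSHom (fun U ↦ (η _ U).comp (ap π U)) (fun h s ↦ by
      simp only [LinearMap.comp_apply]
      rw [ap_res, η_res])
  have h0 : φ = 0 := H _ φ fun U s hs ↦ by
    change η _ U (ap π U s) = 0
    have : ap π U s = 0 := (Submodule.Quotient.mk_eq_zero (S U)).2 hs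
    rw [this, map_zero]
  intro x hx
  have h1 : η _ U (ap π U s) = 0 := by
    change sap φ U s = 0
    rw [h0, sap_zero]
  obtain ⟨V, hV, hxV, h⟩ := η_injective_locally _ h1 x hx
  rw [← ap_res] at h
  exact ⟨V, hV, hxV, (Submodule.Quotient.mk_eq_zero (S V)).1 h⟩

/-- The family of submodules is the sectionwise image of `φ`: a morphism that kills it is zero
because `φ` is epi. -/
lemma locally_surjective_of_epi (φ : M ⟶ N) [Epi φ] (s : Sec (pm N) U) :
    Locally U fun V h ↦ ∃ t : Sec (pm M) V, sap φ V t = res h s := by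
  refine locally_mem_of_hom_eq_zero (fun U ↦ LinearMap.range (sap φ U)) ?_ ?_ s
  · rintro U V h _ ⟨t, rfl⟩
    exact ⟨res h t, ap_res _ _ _⟩
  · intro K ψ h
    rw [← cancel_epi φ]
    refine shom_ext fun U s ↦ ?_
    simpa using h U _ ⟨s, rfl⟩

end Sheafification

end
end SyzygyWeight

/-! ### Left exactness of sections, and sections of direct and inverse images. -/

namespace SyzygyWeight
noncomputable section

/-! ### Exactness on sections -/

section Exactness

variable {X : Scheme.{0}} {M N : X.Modules} {U : X.Opens}

/-- The functor of sections over `U`. -/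
def secFunctor (U : X.Opens) : X.Modules ⥤ Ab :=
  Scheme.Modules.toPresheaf X ⋙ (evaluation _ _).obj (.op U)

instance : (secFunctor U).Additive where
  map_add := rfl

instance : PreservesFiniteLimits (secFunctor U) :=
  have : PreservesFiniteLimits ((evaluation (TopologicalSpace.Opens X)ᵒᵖ Ab).obj (.op U)) :=
    ⟨fun _ _ _ ↦ inferInstance⟩
  comp_preservesFiniteLimits (Scheme.Modules.toPresheaf X) ((evaluation _ Ab).obj (.op U))

lemma sap_injective (φ : M ⟶ N) [Mono φ] : Function.Injective (sap φ U) :=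
  (AddCommGrpCat.mono_iff_injective ((secFunctor U).map φ)).1 inferInstance

lemma exists_of_exact (S : ShortComplex X.Modules) (hS : S.Exact) [Mono S.f]
    (s : Sec (pm S.X₂) U) (hs : sap S.g U s = 0) : ∃ t : Sec (pm S.X₁) U, sap S.f U t = s :=
  (ShortComplex.ab_exact_iff _).1 (hS.map_of_mono_of_preservesKernel (secFunctor U)
    inferInstance inferInstance) s hs

lemma exists_of_kernel (φ : M ⟶ N) (s : Sec (pm M) U) (hs : sap φ U s = 0) :
    ∃ t : Sec (pm (kernel φ)) U, sap (kernel.ι φ) U t = s :=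
  exists_of_exact (ShortComplex.mk _ _ (kernel.condition φ)) (ShortComplex.exact_kernel φ) s hs

lemma sap_kernel_condition (φ : M ⟶ N) (s : Sec (pm (kernel φ)) U) :
    sap φ U (sap (kernel.ι φ) U s) = 0 := by
  rw [← sap_comp, kernel.condition, sap_zero]

end Exactness

/-! ### The structure sheaf -/

section Structure

variable {X : Scheme.{0}} {U V : X.Opens}

/-- Functions as sections of the structure module. -/
def ofR : Γ(X, U) ≃ₗ[Γ(X, U)] Sec (pm (structureModule X)) U where
  toFun a := a
  invFun a := a
  map_add' _ _ := rfl
  map_smul' _ _ := rfl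
  left_inv _ := rfl
  right_inv _ := rfl

@[simp] lemma res_ofR (h : V ≤ U) (a : Γ(X, U)) : res h (ofR a) = ofR (rres h a) := rfl

lemma ofR_symm_res (h : V ≤ U) (a : Sec (pm (structureModule X)) U) :
    ofR.symm (res h a) = rres h (ofR.symm a) := rfl

lemma ofR_eq_smul (a : Γ(X, U)) : ofR a = a • ofR (1 : Γ(X, U)) := by
  rw [← map_smul, smul_eq_mul, mul_one]

lemma rres_ext (a b : Γ(X, U)) (h : Locally U fun _ h ↦ rres h a = rres h b) : a = b :=
  ofR.injective (sec_ext (M := structureModule X) _ _ fun x hx ↦ by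
    obtain ⟨V, hV, hxV, h⟩ := h x hx
    exact ⟨V, hV, hxV, congrArg ofR h⟩)

end Structure

/-! ### Direct and inverse images -/

section Pushforward

variable {X Y : Scheme.{0}} (i : Y ⟶ X) {M M' : X.Modules} {N N' : Y.Modules} {U V : X.Opens}

lemma preimage_le {i : Y ⟶ X} (h : V ≤ U) : i ⁻¹ᵁ V ≤ i ⁻¹ᵁ U := fun _ hx ↦ h hx

/-- The map on functions. -/
abbrev cm (U : X.Opens) : Γ(X, U) →+* Γ(Y, i ⁻¹ᵁ U) := (i.app U).hom

lemma cm_rres (h : V ≤ U) (a : Γ(X, U)) : cm i V (rres h a) = rres (preimage_le h) (cm i U a) :=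
  congrArg (fun g ↦ g.hom a) (i.naturality (homOfLE h).op)

/-- Sections of a direct image. -/
def pf (U : X.Opens) :
    Sec (pm ((Scheme.Modules.pushforward i).obj N)) U ≃+ Sec (pm N) (i ⁻¹ᵁ U) where
  toFun s := s
  invFun s := s
  map_add' _ _ := rfl
  left_inv _ := rfl
  right_inv _ := rfl

lemma pf_smul (a : Γ(X, U)) (s : Sec (pm ((Scheme.Modules.pushforward i).obj N)) U) :
    pf i U (a • s) = cm i U a • pf i U s := rfl

lemma pf_res (h : V ≤ U) (s : Sec (pm ((Scheme.Modules.pushforward i).obj N)) U) :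
    pf i V (res h s) = res (preimage_le h) (pf i U s) := rfl

variable {i}

/-- The map on sections given by a morphism to a direct image. -/
def apf (r : M ⟶ (Scheme.Modules.pushforward i).obj N) (U : X.Opens) :
    Sec (pm M) U →+ Sec (pm N) (i ⁻¹ᵁ U) :=
  (pf i U).toAddMonoidHom.comp (sap r U).toAddMonoidHom

lemma apf_smul (r : M ⟶ (Scheme.Modules.pushforward i).obj N) (a : Γ(X, U)) (s : Sec (pm M) U) :
    apf r U (a • s) = cm i U a • apf r U s :=
  congrArg (pf i U) (map_smul (sap r U) a s)

lemma apf_res (r : M ⟶ (Scheme.Modules.pushforward i).obj N) (h : V ≤ U) (s : Sec (pm M) U) :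
    apf r V (res h s) = res (preimage_le h) (apf r U s) :=
  congrArg (pf i V) (ap_res (pmMap r) h s)

lemma apf_comp (r : M ⟶ (Scheme.Modules.pushforward i).obj N) (φ : N ⟶ N') (s : Sec (pm M) U) :
    apf (r ≫ (Scheme.Modules.pushforward i).map φ) U s = sap φ _ (apf r U s) := rfl

lemma comp_apf (φ : M ⟶ M') (r : M' ⟶ (Scheme.Modules.pushforward i).obj N) (s : Sec (pm M) U) :
    apf (φ ≫ r) U s = apf r U (sap φ U s) := rfl

lemma apf_ext {r r' : M ⟶ (Scheme.Modules.pushforward i).obj N}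
    (h : ∀ U (s : Sec (pm M) U), apf r U s = apf r' U s) : r = r' :=
  shom_ext fun U s ↦ (pf i U).injective (h U s)

variable (i) in
/-- A morphism to a direct image from a natural family of semilinear maps. -/
def mkPf (f : ∀ U, Sec (pm M) U →+ Sec (pm N) (i ⁻¹ᵁ U))
    (hs : ∀ U (a : Γ(X, U)) (s : Sec (pm M) U), f U (a • s) = cm i U a • f U s)
    (hf : ∀ {U V : X.Opens} (h : V ≤ U) (s : Sec (pm M) U),
      f V (res h s) = res (preimage_le h) (f U s)) :
    M ⟶ (Scheme.Modules.pushforward i).obj N :=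
  mkSHom (fun U ↦
    { toFun := fun s ↦ (pf i U).symm (f U s)
      map_add' := fun s t ↦ congrArg (pf i U).symm (map_add (f U) s t)
      map_smul' := fun a s ↦ congrArg (pf i U).symm (hs U a s) })
    (fun h s ↦ congrArg (pf i _).symm (hf h s))

variable (i M)

/-- Pulling back sections. -/
def pu (U : X.Opens) : Sec (pm M) U →+ Sec (pm ((Scheme.Modules.pullback i).obj M)) (i ⁻¹ᵁ U) :=
  apf (restrictionMap i M) U

variable {M}

lemma pu_smul (a : Γ(X, U)) (s : Sec (pm M) U) : pu i M U (a • s) = cm i U a • pu i M U s :=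
  apf_smul _ _ _

lemma pu_res (h : V ≤ U) (s : Sec (pm M) U) :
    pu i M V (res h s) = res (preimage_le h) (pu i M U s) :=
  apf_res _ _ _

lemma sap_pullback_map (φ : M ⟶ M') (s : Sec (pm M) U) :
    sap ((Scheme.Modules.pullback i).map φ) _ (pu i M U s) = pu i M' U (sap φ U s) := by
  have h : restrictionMap i M ≫ (Scheme.Modules.pushforward i).map
      ((Scheme.Modules.pullback i).map φ) = φ ≫ restrictionMap i M' :=
    ((Scheme.Modules.pullbackPushforwardAdjunction i).unit.naturality φ).symm
  have h' := congrArg (fun g ↦ apf g U s) h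
  simp only [comp_apf] at h'
  exact h'

variable {i}

/-- The morphism from an inverse image adjoint to a morphism to a direct image. -/
def pbDesc (r : M ⟶ (Scheme.Modules.pushforward i).obj N) :
    (Scheme.Modules.pullback i).obj M ⟶ N :=
  ((Scheme.Modules.pullbackPushforwardAdjunction i).homEquiv M N).symm r

@[simp] lemma sap_pbDesc (r : M ⟶ (Scheme.Modules.pushforward i).obj N) (s : Sec (pm M) U) :
    sap (pbDesc r) _ (pu i M U s) = apf r U s := by
  have := (Scheme.Modules.pullbackPushforwardAdjunction i).homEquiv_unit (f := pbDesc r)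
  replace this := this.symm.trans (((Scheme.Modules.pullbackPushforwardAdjunction i).homEquiv
    M N).apply_symm_apply _)
  exact congrArg (fun g ↦ apf g U s) this

/-- By adjunction, a morphism out of an inverse image is determined by its values on pulled-back
sections; no description of the other sections is needed. -/
lemma pullback_hom_ext {φ ψ : (Scheme.Modules.pullback i).obj M ⟶ N}
    (h : ∀ U (s : Sec (pm M) U), sap φ _ (pu i M U s) = sap ψ _ (pu i M U s)) : φ = ψ := by
  apply ((Scheme.Modules.pullbackPushforwardAdjunction i).homEquiv M N).injective
  rw [Adjunction.homEquiv_unit, Adjunction.homEquiv_unit]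
  exact apf_ext h

/-- A natural family of semilinear maps from a sheaf on `X` to a presheaf `P` on `Y` is compatible
with a morphism from the inverse image to the sheaf associated with `P`. -/
lemma exists_pullback_hom {P : Y.PresheafOfModules} (f : ∀ U, Sec (pm M) U →+ Sec P (i ⁻¹ᵁ U))
    (hs : ∀ U (a : Γ(X, U)) (s : Sec (pm M) U), f U (a • s) = cm i U a • f U s)
    (hf : ∀ {U V : X.Opens} (h : V ≤ U) (s : Sec (pm M) U),
      f V (res h s) = res (preimage_le h) (f U s)) :
    ∃ φ : (Scheme.Modules.pullback i).obj M ⟶ (associatedSheaf Y).obj P,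
      ∀ U (s : Sec (pm M) U), sap φ _ (pu i M U s) = η P _ (f U s) := by
  refine ⟨pbDesc (mkPf i (fun U ↦ (η P (i ⁻¹ᵁ U)).toAddMonoidHom.comp (f U)) ?_ ?_), ?_⟩
  · intro U a s
    change η P _ (f U (a • s)) = _ • η P _ (f U s)
    rw [hs, map_smul]
  · intro U V h s
    change η P _ (f V (res h s)) = res _ (η P _ (f U s))
    rw [hf, η_res]
  · intro U s
    rw [sap_pbDesc]
    rfl

/-- If a natural family of semilinear maps vanishes locally nowhere, then the pullback of sections
detects it. -/
lemma locally_eq_zero_of_pu_eq_zero {P : Y.PresheafOfModules}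
    (f : ∀ U, Sec (pm M) U →+ Sec P (i ⁻¹ᵁ U))
    (hs : ∀ U (a : Γ(X, U)) (s : Sec (pm M) U), f U (a • s) = cm i U a • f U s)
    (hf : ∀ {U V : X.Opens} (h : V ≤ U) (s : Sec (pm M) U),
      f V (res h s) = res (preimage_le h) (f U s)) (s : Sec (pm M) U) (h : pu i M U s = 0) :
    Locally (i ⁻¹ᵁ U) fun _ h ↦ res h (f U s) = 0 := by
  obtain ⟨φ, hφ⟩ := exists_pullback_hom f hs hf
  refine η_injective_locally _ ?_
  rw [← hφ, h, map_zero]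

end Pushforward

end
end SyzygyWeight

/-! ### Exterior powers and tensor products by generators, and their maps to direct images. -/

namespace SyzygyWeight
noncomputable section

open scoped TensorProduct

/-! ### Exterior powers -/

section ExtPower

variable {X : Scheme.{0}} {M N : X.Modules} {U V : X.Opens} {n : ℕ}

/-- The exterior power of a presheaf of modules. -/
def pExt (n : ℕ) (P : X.PresheafOfModules) : X.PresheafOfModules :=
  (presheafExteriorPower (R := X.presheaf) n).obj P

/-- The sections of the exterior power presheaf. -/
def extEquiv (P : X.PresheafOfModules) : (⋀[Γ(X, U)]^n (Sec P U)) ≃ₗ[Γ(X, U)] Sec (pExt n P) U where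
  toFun s := s
  invFun s := s
  map_add' _ _ := rfl
  map_smul' _ _ := rfl
  left_inv _ := rfl
  right_inv _ := rfl

lemma res_extEquiv_ιMulti {P : X.PresheafOfModules} (h : V ≤ U) (m : Fin n → Sec P U) :
    res h (extEquiv P (exteriorPower.ιMulti _ n m)) =
      extEquiv P (exteriorPower.ιMulti _ n fun k ↦ res h (m k)) :=
  presheafExteriorPowerMap_mk (R := X.presheaf) n P (homOfLE h).op m

/-- The wedge product of `n` sections of a sheaf, as a section of the exterior power. -/
def om (n : ℕ) (M : X.Modules) (U : X.Opens) :
    (Sec (pm M) U) [⋀^Fin n]→ₗ[Γ(X, U)] Sec (pm ((extPower X n).obj M)) U :=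
  ((η (pExt n (pm M)) U).comp (extEquiv (pm M)).toLinearMap).compAlternatingMap
    (exteriorPower.ιMulti _ n)

lemma om_apply (m : Fin n → Sec (pm M) U) :
    om n M U m = η (pExt n (pm M)) U (extEquiv (pm M) (exteriorPower.ιMulti _ n m)) := rfl

lemma res_om (h : V ≤ U) (m : Fin n → Sec (pm M) U) :
    res h (om n M U m) = om n M V fun k ↦ res h (m k) := by
  rw [om_apply, om_apply, ← res_extEquiv_ιMulti]
  exact (η_res _ _).symm

lemma sap_extPower_map (φ : M ⟶ N) (m : Fin n → Sec (pm M) U) :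
    sap ((extPower X n).map φ) U (om n M U m) = om n N U fun k ↦ sap φ U (m k) := by
  rw [om_apply, om_apply]
  refine (sap_associatedSheaf_map ((presheafExteriorPower (R := X.presheaf) n).map (pmMap φ))
    (extEquiv (pm M) (exteriorPower.ιMulti _ n m))).trans ?_
  congr 1
  exact exteriorPower.map_apply_ιMulti _ _

lemma ιMulti_span (R E : Type) [CommRing R] [AddCommGroup E] [Module R E] :
    Submodule.span R (Set.range (exteriorPower.ιMulti R n (M := E))) = ⊤ :=
  exteriorPower.ιMulti_span R n E

lemma pExt_hom_ext {P Q : X.PresheafOfModules} {f g : Sec (pExt n P) U →ₗ[Γ(X, U)] Sec Q U}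
    (h : ∀ m, f (extEquiv P (exteriorPower.ιMulti _ n m)) =
      g (extEquiv P (exteriorPower.ιMulti _ n m))) : f = g := by
  have : f.comp (extEquiv P).toLinearMap = g.comp (extEquiv P).toLinearMap :=
    LinearMap.ext_on_range (ιMulti_span _ _) h
  ext s
  exact LinearMap.congr_fun this ((extEquiv P).symm s)

lemma extPower_hom_ext {φ ψ : (extPower X n).obj M ⟶ N}
    (h : ∀ U (m : Fin n → Sec (pm M) U), sap φ U (om n M U m) = sap ψ U (om n M U m)) :
    φ = ψ := by
  refine associatedSheaf_hom_ext (P := pExt n (pm M)) fun U s ↦ ?_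
  have : (sap φ U).comp (η (pExt n (pm M)) U) = (sap ψ U).comp (η (pExt n (pm M)) U) :=
    pExt_hom_ext (h U)
  exact LinearMap.congr_fun this s

lemma extDesc_natural (f : ∀ U, (Sec (pm M) U) [⋀^Fin n]→ₗ[Γ(X, U)] Sec (pm N) U)
    (hf : ∀ {U V : X.Opens} (h : V ≤ U) (m : Fin n → Sec (pm M) U),
      f V (fun k ↦ res h (m k)) = res h (f U m)) {U V : X.Opens} (h : V ≤ U)
    (s : Sec (pExt n (pm M)) U) :
    ((exteriorPower.alternatingMapLinearEquiv (f V)).comp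
      (extEquiv (pm M)).symm.toLinearMap) (res h s) =
    res h (((exteriorPower.alternatingMapLinearEquiv (f U)).comp
      (extEquiv (pm M)).symm.toLinearMap) s) := by
  obtain ⟨s, rfl⟩ := (extEquiv (pm M)).surjective s
  have hs : s ∈ Submodule.span Γ(X, U) (Set.range (exteriorPower.ιMulti Γ(X, U) n)) := by
    rw [ιMulti_span]
    trivial
  induction hs using Submodule.span_induction with
  | mem s hs =>
    obtain ⟨m, rfl⟩ := hs
    rw [res_extEquiv_ιMulti]
    simp only [LinearMap.comp_apply, LinearEquiv.coe_coe, LinearEquiv.symm_apply_apply,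
      exteriorPower.alternatingMapLinearEquiv_apply_ιMulti]
    exact hf h m
  | zero => simp only [map_zero]
  | add s t _ _ hs ht => simp only [map_add, hs, ht]
  | smul a s _ hs => simp only [map_smul, res_smul, hs]

/-- A morphism out of an exterior power from a natural family of alternating maps. -/
def extDesc (f : ∀ U, (Sec (pm M) U) [⋀^Fin n]→ₗ[Γ(X, U)] Sec (pm N) U)
    (hf : ∀ {U V : X.Opens} (h : V ≤ U) (m : Fin n → Sec (pm M) U),
      f V (fun k ↦ res h (m k)) = res h (f U m)) : (extPower X n).obj M ⟶ N :=
  shDesc (P := pExt n (pm M)) (fun U ↦ (exteriorPower.alternatingMapLinearEquiv (f U)).comp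
      (extEquiv (pm M)).symm.toLinearMap) (extDesc_natural f hf)

@[simp] lemma sap_extDesc (f : ∀ U, (Sec (pm M) U) [⋀^Fin n]→ₗ[Γ(X, U)] Sec (pm N) U)
    (hf : ∀ {U V : X.Opens} (h : V ≤ U) (m : Fin n → Sec (pm M) U),
      f V (fun k ↦ res h (m k)) = res h (f U m)) (m : Fin n → Sec (pm M) U) :
    sap (extDesc f hf) U (om n M U m) = f U m := by
  rw [om_apply]
  refine (sap_shDesc (P := pExt n (pm M)) _ (extDesc_natural f hf) _).trans ?_
  simp [exteriorPower.alternatingMapLinearEquiv_apply_ιMulti]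

end ExtPower

/-! ### Twists -/

section Twist

variable {X : Scheme.{0}} {B C M N : X.Modules} {U V : X.Opens}

/-- The tensor product of presheaves of modules. -/
def pTw (P Q : X.PresheafOfModules) : X.PresheafOfModules :=
  PresheafOfModules.Monoidal.tensorObj (R := X.presheaf) P Q

/-- The sections of the tensor product presheaf. -/
def twEquiv (P Q : X.PresheafOfModules) :
    (Sec P U ⊗[Γ(X, U)] Sec Q U) ≃ₗ[Γ(X, U)] Sec (pTw P Q) U where
  toFun s := s
  invFun s := s
  map_add' _ _ := rfl
  map_smul' _ _ := rfl
  left_inv _ := rfl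
  right_inv _ := rfl

lemma res_twEquiv_tmul {P Q : X.PresheafOfModules} (h : V ≤ U) (s : Sec P U) (t : Sec Q U) :
    res h (twEquiv P Q (s ⊗ₜ t)) = twEquiv P Q (res h s ⊗ₜ res h t) :=
  PresheafOfModules.Monoidal.tensorObj_map_tmul (R := X.presheaf) (homOfLE h).op s t

/-- The tensor product of two sections. -/
def tw (M B : X.Modules) (U : X.Opens) :
    Sec (pm M) U →ₗ[Γ(X, U)] Sec (pm B) U →ₗ[Γ(X, U)] Sec (pm ((twist B).obj M)) U :=
  (TensorProduct.mk Γ(X, U) _ _).compr₂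
    ((η (pTw (pm M) (pm B)) U).comp (twEquiv (pm M) (pm B)).toLinearMap)

lemma tw_apply (m : Sec (pm M) U) (b : Sec (pm B) U) :
    tw M B U m b = η (pTw (pm M) (pm B)) U (twEquiv (pm M) (pm B) (m ⊗ₜ b)) := rfl

lemma res_tw (h : V ≤ U) (m : Sec (pm M) U) (b : Sec (pm B) U) :
    res h (tw M B U m b) = tw M B V (res h m) (res h b) := by
  rw [tw_apply, tw_apply, ← res_twEquiv_tmul]
  exact (η_res _ _).symm

lemma sap_twist_map (φ : M ⟶ N) (m : Sec (pm M) U) (b : Sec (pm B) U) :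
    sap ((twist B).map φ) U (tw M B U m b) = tw N B U (sap φ U m) b := by
  rw [tw_apply, tw_apply]
  refine (sap_associatedSheaf_map (P := pTw (pm M) (pm B)) (Q := pTw (pm N) (pm B))
    (PresheafOfModules.Monoidal.tensorHom (R := X.presheaf) (pmMap φ) (𝟙 _))
    (twEquiv (pm M) (pm B) (m ⊗ₜ b))).trans ?_
  congr 1

lemma pTw_hom_ext {P Q K : X.PresheafOfModules} {f g : Sec (pTw P Q) U →ₗ[Γ(X, U)] Sec K U}
    (h : ∀ m b, f (twEquiv P Q (m ⊗ₜ b)) = g (twEquiv P Q (m ⊗ₜ b))) : f = g := by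
  have : f.comp (twEquiv P Q).toLinearMap = g.comp (twEquiv P Q).toLinearMap :=
    TensorProduct.ext' h
  ext s
  exact LinearMap.congr_fun this ((twEquiv P Q).symm s)

lemma twist_hom_ext {φ ψ : (twist B).obj M ⟶ N}
    (h : ∀ U (m : Sec (pm M) U) (b : Sec (pm B) U),
      sap φ U (tw M B U m b) = sap ψ U (tw M B U m b)) : φ = ψ := by
  refine associatedSheaf_hom_ext (P := pTw (pm M) (pm B)) fun U s ↦ ?_
  have : (sap φ U).comp (η (pTw (pm M) (pm B)) U) = (sap ψ U).comp (η (pTw (pm M) (pm B)) U) :=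
    pTw_hom_ext (h U)
  exact LinearMap.congr_fun this s

lemma twDesc_natural (f : ∀ U, Sec (pm M) U →ₗ[Γ(X, U)] Sec (pm B) U →ₗ[Γ(X, U)] Sec (pm N) U)
    (hf : ∀ {U V : X.Opens} (h : V ≤ U) (m : Sec (pm M) U) (b : Sec (pm B) U),
      f V (res h m) (res h b) = res h (f U m b)) {U V : X.Opens} (h : V ≤ U)
    (s : Sec (pTw (pm M) (pm B)) U) :
    ((TensorProduct.lift (f V)).comp (twEquiv (pm M) (pm B)).symm.toLinearMap) (res h s) =
    res h (((TensorProduct.lift (f U)).comp (twEquiv (pm M) (pm B)).symm.toLinearMap) s) := by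
  obtain ⟨s, rfl⟩ := (twEquiv (pm M) (pm B)).surjective s
  induction s using TensorProduct.induction_on with
  | zero => simp only [map_zero]
  | add s t hs ht => simp only [map_add, hs, ht]
  | tmul m b =>
    rw [res_twEquiv_tmul]
    simp only [LinearMap.comp_apply, LinearEquiv.coe_coe, LinearEquiv.symm_apply_apply,
      TensorProduct.lift.tmul]
    exact hf h m b

/-- A morphism out of a twist from a natural family of bilinear maps. -/
def twDesc (f : ∀ U, Sec (pm M) U →ₗ[Γ(X, U)] Sec (pm B) U →ₗ[Γ(X, U)] Sec (pm N) U)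
    (hf : ∀ {U V : X.Opens} (h : V ≤ U) (m : Sec (pm M) U) (b : Sec (pm B) U),
      f V (res h m) (res h b) = res h (f U m b)) : (twist B).obj M ⟶ N :=
  shDesc (P := pTw (pm M) (pm B)) (fun U ↦ (TensorProduct.lift (f U)).comp
      (twEquiv (pm M) (pm B)).symm.toLinearMap) (twDesc_natural f hf)

@[simp] lemma sap_twDesc (f : ∀ U, Sec (pm M) U →ₗ[Γ(X, U)] Sec (pm B) U →ₗ[Γ(X, U)] Sec (pm N) U)
    (hf : ∀ {U V : X.Opens} (h : V ≤ U) (m : Sec (pm M) U) (b : Sec (pm B) U),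
      f V (res h m) (res h b) = res h (f U m b)) (m : Sec (pm M) U) (b : Sec (pm B) U) :
    sap (twDesc f hf) U (tw M B U m b) = f U m b := by
  rw [tw_apply]
  refine (sap_shDesc (P := pTw (pm M) (pm B)) _ (twDesc_natural f hf) _).trans ?_
  simp

lemma twistMap_natural (β : B ⟶ C) {U V : X.Opens} (h : V ≤ U) (m : Sec (pm M) U)
    (b : Sec (pm B) U) : ((tw M C V).compl₂ (sap β V)) (res h m) (res h b) =
      res h (((tw M C U).compl₂ (sap β U)) m b) := by
  simp only [LinearMap.compl₂_apply]
  rw [ap_res, res_tw]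

/-- The morphism `M ⊗ B ⟶ M ⊗ C` induced by a morphism `B ⟶ C`. -/
def twistMap (M : X.Modules) (β : B ⟶ C) : (twist B).obj M ⟶ (twist C).obj M :=
  twDesc (fun U ↦ (tw M C U).compl₂ (sap β U)) (twistMap_natural β)

@[simp] lemma sap_twistMap (β : B ⟶ C) (m : Sec (pm M) U) (b : Sec (pm B) U) :
    sap (twistMap M β) U (tw M B U m b) = tw M C U m (sap β U b) :=
  sap_twDesc _ (twistMap_natural β) _ _

end Twist

/-! ### Compatibility with direct images -/

section Pushforward

variable {X Y : Scheme.{0}} {i : Y ⟶ X} {M B : X.Modules} {N C : Y.Modules} {U V : X.Opens} {n : ℕ}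

/-- The wedge product of the images of sections under a map `M ⟶ i_* N`. -/
def omPush (n : ℕ) (r : M ⟶ (Scheme.Modules.pushforward i).obj N) (U : X.Opens) :
    (Sec (pm M) U) [⋀^Fin n]→ₗ[Γ(X, U)]
      Sec (pm ((Scheme.Modules.pushforward i).obj ((extPower Y n).obj N))) U :=
  { toFun := fun m ↦ (pf i U).symm (om n N _ fun k ↦ apf r U (m k))
    map_update_add' := by
      intro _ m k x y
      have h (z : Sec (pm M) U) : (fun j ↦ apf r U (Function.update m k z j)) =
          Function.update (fun j ↦ apf r U (m j)) k (apf r U z) := by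
        ext j
        by_cases hj : j = k
        · subst hj; simp
        · simp [hj]
      rw [h, h, h, map_add, AlternatingMap.map_update_add, map_add]
    map_update_smul' := by
      intro _ m k a x
      have h (z : Sec (pm M) U) : (fun j ↦ apf r U (Function.update m k z j)) =
          Function.update (fun j ↦ apf r U (m j)) k (apf r U z) := by
        ext j
        by_cases hj : j = k
        · subst hj; simp
        · simp [hj]
      rw [h, h, apf_smul, AlternatingMap.map_update_smul]
      rfl
    map_eq_zero_of_eq' := by
      intro m k l h hkl
      rw [AlternatingMap.map_eq_zero_of_eq (om n N _) (fun k ↦ apf r U (m k))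
        (congrArg (apf r U) h) hkl, map_zero] }

lemma omPush_natural (r : M ⟶ (Scheme.Modules.pushforward i).obj N) {U V : X.Opens} (h : V ≤ U)
    (m : Fin n → Sec (pm M) U) :
    omPush n r V (fun k ↦ res h (m k)) = res h (omPush n r U m) := by
  apply (pf i _).injective
  rw [pf_res]
  change om n N _ _ = res _ (om n N _ _)
  rw [res_om]
  simp only [apf_res]

/-- The map `⋀ⁿ M ⟶ i_* ⋀ⁿ N` induced by a map `M ⟶ i_* N`. -/
def extPush (n : ℕ) (r : M ⟶ (Scheme.Modules.pushforward i).obj N) :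
    (extPower X n).obj M ⟶ (Scheme.Modules.pushforward i).obj ((extPower Y n).obj N) :=
  extDesc (omPush n r) (omPush_natural r)

@[simp] lemma apf_extPush (r : M ⟶ (Scheme.Modules.pushforward i).obj N)
    (m : Fin n → Sec (pm M) U) :
    apf (extPush n r) U (om n M U m) = om n N _ fun k ↦ apf r U (m k) :=
  congrArg (pf i U) (sap_extDesc _ (omPush_natural r) _)

/-- The tensor product of the images of sections under maps `M ⟶ i_* N` and `B ⟶ i_* C`. -/
def tensorPush (r : M ⟶ (Scheme.Modules.pushforward i).obj N)
    (ρ : B ⟶ (Scheme.Modules.pushforward i).obj C) (U : X.Opens) :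
    Sec (pm M) U →ₗ[Γ(X, U)] Sec (pm B) U →ₗ[Γ(X, U)]
      Sec (pm ((Scheme.Modules.pushforward i).obj ((twist C).obj N))) U :=
  LinearMap.mk₂ _ (fun m b ↦ (pf i U).symm (tw N C _ (apf r U m) (apf ρ U b)))
    (fun _ _ _ ↦ by simp only [map_add, LinearMap.add_apply])
    (fun a m b ↦ by
      simp only [apf_smul, map_smul, LinearMap.smul_apply]
      rfl)
    (fun _ _ _ ↦ by simp only [map_add])
    (fun a m b ↦ by
      simp only [apf_smul, map_smul]
      rfl)

lemma tensorPush_natural (r : M ⟶ (Scheme.Modules.pushforward i).obj N)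
    (ρ : B ⟶ (Scheme.Modules.pushforward i).obj C) {U V : X.Opens} (h : V ≤ U)
    (m : Sec (pm M) U) (b : Sec (pm B) U) :
    tensorPush r ρ V (res h m) (res h b) = res h (tensorPush r ρ U m b) := by
  apply (pf i _).injective
  rw [pf_res]
  change tw N C _ _ _ = res _ (tw N C _ _ _)
  rw [res_tw, apf_res, apf_res]

/-- The map `M ⊗ B ⟶ i_* (N ⊗ C)` induced by maps `M ⟶ i_* N` and `B ⟶ i_* C`. -/
def twPush (r : M ⟶ (Scheme.Modules.pushforward i).obj N)
    (ρ : B ⟶ (Scheme.Modules.pushforward i).obj C) :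
    (twist B).obj M ⟶ (Scheme.Modules.pushforward i).obj ((twist C).obj N) :=
  twDesc (tensorPush r ρ) (tensorPush_natural r ρ)

@[simp] lemma apf_twPush (r : M ⟶ (Scheme.Modules.pushforward i).obj N)
    (ρ : B ⟶ (Scheme.Modules.pushforward i).obj C) (m : Sec (pm M) U) (b : Sec (pm B) U) :
    apf (twPush r ρ) U (tw M B U m b) = tw N C _ (apf r U m) (apf ρ U b) :=
  congrArg (pf i U) (sap_twDesc _ (tensorPush_natural r ρ) _ _)

end Pushforward

end
end SyzygyWeight

/-! ### Invertible sheaves through local generators. -/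

namespace SyzygyWeight
noncomputable section

open scoped TensorProduct

section Locality

variable {X : Scheme.{0}} {M N : X.Modules} {U V W : X.Opens}

/-- A natural family of injective maps of sections that is locally surjective is surjective. -/
lemma exists_of_locally (g : ∀ V, V ≤ U → Sec (pm M) V →+ Sec (pm N) V)
    (hg : ∀ {V W} (h : V ≤ U) (h' : W ≤ V) (s : Sec (pm M) V),
      g W (h'.trans h) (res h' s) = res h' (g V h s))
    (inj : ∀ V (h : V ≤ U) s, g V h s = 0 → s = 0) (t : Sec (pm N) U)
    (ht : Locally U fun V h ↦ ∃ s, g V h s = res h t) : ∃ s, g U le_rfl s = t := by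
  choose V hV hx s hs using ht
  obtain ⟨s', hs'⟩ := sec_glue (fun x : U ↦ V x.1 x.2) (fun x ↦ hV x.1 x.2)
    -- Local preimages agree on overlaps because their difference has image zero and `g` is
    -- injective there.
    (fun x hxU ↦ ⟨⟨x, hxU⟩, hx x hxU⟩) (fun x ↦ s x.1 x.2) (fun x y ↦ by
      rw [← sub_eq_zero]
      refine inj _ (inf_le_left.trans (hV x.1 x.2)) _ ?_
      rw [map_sub, hg (hV x.1 x.2) inf_le_left, hg (hV y.1 y.2) inf_le_right, hs, hs, res_res,
        res_res, sub_self])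
  refine ⟨s', sec_ext _ _ fun x hxU ↦ ⟨V x hxU, hV x hxU, hx x hxU, ?_⟩⟩
  change res _ _ = res _ _
  rw [← hg le_rfl (hV x hxU), hs' ⟨x, hxU⟩]
  exact hs x hxU

/-- Multiplication of a section by functions. -/
def smulHom (b : Sec (pm M) U) : Γ(X, U) →+ Sec (pm M) U :=
  (LinearMap.toSpanSingleton Γ(X, U) _ b).toAddMonoidHom

/-- The section `b` of `M` over `U` generates `M|_U` freely. -/
def IsGen (b : Sec (pm M) U) : Prop :=
  ∀ V (h : V ≤ U), Function.Bijective fun a : Γ(X, V) ↦ a • res h b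

lemma IsGen.res {b : Sec (pm M) U} (hb : IsGen b) (h : V ≤ U) : IsGen (res h b) := by
  intro W h'
  simpa using hb W (h'.trans h)

lemma IsGen.eq_zero {b : Sec (pm M) U} (hb : IsGen b) {a : Γ(X, U)} (h : a • b = 0) : a = 0 := by
  apply (hb U le_rfl).1
  simpa using h

lemma IsGen.eq_zero_of_le {b : Sec (pm M) U} (hb : IsGen b) (hV : V ≤ U) {a : Γ(X, V)}
    (h : a • SyzygyWeight.res hV b = 0) : a = 0 := (hb.res hV).eq_zero h

lemma IsGen.exists_smul {b : Sec (pm M) U} (hb : IsGen b) (h : V ≤ U) (s : Sec (pm M) V) :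
    ∃ a : Γ(X, V), a • SyzygyWeight.res h b = s :=
  (hb V h).2 s

lemma isGen_of_locally (b : Sec (pm M) U)
    (inj : ∀ V (h : V ≤ U) (a : Γ(X, V)), a • res h b = 0 → a = 0)
    (surj : ∀ V (h : V ≤ U) (s : Sec (pm M) V),
      Locally V fun W h' ↦ ∃ a : Γ(X, W), a • res (h'.trans h) b = res h' s) : IsGen b := by
  intro V h
  refine ⟨fun a a' haa' ↦ ?_, fun s ↦ ?_⟩
  · rw [← sub_eq_zero]
    exact inj V h _ (by rw [sub_smul, sub_eq_zero]; exact haa')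
  · obtain ⟨a, ha⟩ := exists_of_locally (M := structureModule X) (N := M) (U := V)
      (fun W h' ↦ (smulHom (res (h'.trans h) b)).comp ofR.symm.toAddEquiv.toAddMonoidHom)
      (fun {W W'} h' h'' a ↦ by
        change ofR.symm (res h'' a) • res _ b = res h'' (ofR.symm a • res _ b)
        rw [res_smul, res_res, ofR_symm_res])
      (fun W h' a ha ↦ ofR.symm.map_eq_zero_iff.1 (inj W (h'.trans h) _ ha)) s (fun x hx ↦ by
        obtain ⟨W, hW, hxW, a, ha⟩ := surj V h s x hx
        exact ⟨W, hW, hxW, ofR a, ha⟩)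
    exact ⟨ofR.symm a, ha⟩

/-- Sections of the restriction to an open subscheme. -/
def rsE (U : X.Opens) (V : (U : Scheme.{0}).Opens) :
    Sec (pm (M.restrict U.ι)) V ≃+ Sec (pm M) (U.ι ''ᵁ V) where
  toFun s := s
  invFun s := s
  map_add' _ _ := rfl
  left_inv _ := rfl
  right_inv _ := rfl

lemma rsE_smul (V : (U : Scheme.{0}).Opens) (a : Γ(X, U.ι ''ᵁ V))
    (s : Sec (pm (M.restrict U.ι)) V) :
    a • rsE U V s = rsE U V ((U.ι.appIso V).hom a • s) := by
  have h : rsE U V ((U.ι.appIso V).hom a • s) =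
    (U.ι.appIso V).inv ((U.ι.appIso V).hom a) • rsE U V s := rfl
  rw [h]
  exact congrArg (· • rsE U V s)
    (congrArg (fun g ↦ g.hom a) (U.ι.appIso V).hom_inv_id).symm

lemma rsE_res {V W : (U : Scheme.{0}).Opens} (h : W ≤ V) (s : Sec (pm (M.restrict U.ι)) V) :
    rsE U W (res h s) = res (Scheme.Hom.image_mono _ h) (rsE U V s) := rfl

lemma exists_isGen (hM : IsInvertible M) (x : X) :
    ∃ (U : X.Opens) (_ : x ∈ U) (b : Sec (pm M) U), IsGen b := by
  obtain ⟨U, hxU, ⟨e⟩⟩ := hM x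
  -- The generator is the image of 1 under the local trivialization. The open set is `U`, written as
  -- the image of the whole subscheme so that sections can be transported.
  refine ⟨U.ι ''ᵁ ⊤, by simpa using hxU, rsE U ⊤ (sap e.inv ⊤ (ofR 1)), ?_⟩
  intro V h
  obtain ⟨V, rfl⟩ : ∃ V', V = U.ι ''ᵁ V' := ⟨U.ι ⁻¹ᵁ V, by
    rw [Scheme.Hom.image_preimage_eq_opensRange_inf]
    simp only [Scheme.Opens.opensRange_ι]
    refine (inf_eq_right.2 (h.trans ?_)).symm
    simp⟩
  have key : (fun a : Γ(X, U.ι ''ᵁ V) ↦ a • res h (rsE U ⊤ (sap e.inv ⊤ (ofR 1)))) =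
      fun a ↦ rsE U V (sap e.inv V (ofR ((U.ι.appIso V).hom a))) := by
    funext a
    have : res h (rsE U ⊤ (sap e.inv ⊤ (ofR 1))) = rsE U V (sap e.inv V (ofR 1)) := by
      refine (rsE_res le_top _).symm.trans ?_
      rw [← ap_res, res_ofR, map_one]
    rw [this, rsE_smul, ofR_eq_smul ((U.ι.appIso V).hom a)]
    exact congrArg (rsE U V) (map_smul (sap e.inv V) _ _).symm
  rw [key]
  refine (rsE U V).bijective.comp (Function.Bijective.comp ?_ (ofR.bijective.comp ?_))
  · refine Function.bijective_iff_has_inverse.2 ⟨sap e.hom V, fun s ↦ ?_, fun s ↦ ?_⟩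
    · rw [← sap_comp, e.inv_hom_id, sap_id]
    · rw [← sap_comp, e.hom_inv_id, sap_id]
  · exact (U.ι.appIso V).commRingCatIsoToRingEquiv.bijective

end Locality

/-! ### Tensor products with a generator -/

section Twist

variable {X : Scheme.{0}} {M B : X.Modules} {U V W : X.Opens}

lemma tmul_gen_bijective {b : Sec (pm B) U} (hb : IsGen b) (h : V ≤ U) :
    Function.Bijective fun m : Sec (pm M) V ↦ (m ⊗ₜ[Γ(X, V)] res h b) := by
  let e : Γ(X, V) ≃ₗ[Γ(X, V)] Sec (pm B) V := LinearEquiv.ofBijective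
    (LinearMap.toSpanSingleton _ _ (res h b)) (hb V h)
  have : (fun m : Sec (pm M) V ↦ (m ⊗ₜ[Γ(X, V)] res h b)) =
      ((TensorProduct.rid Γ(X, V) (Sec (pm M) V)).symm ≪≫ₗ
        TensorProduct.congr (LinearEquiv.refl _ _) e) := by
    funext m
    have : e 1 = res h b := one_smul _ _
    simp [this]
  rw [this]
  exact LinearEquiv.bijective _

/-- Where `B` has a generator, the tensor product presheaf is already isomorphic to `M` by m ↦ m ⊗
b, so sheafifying changes nothing. With `tw_gen_surjective` this turns questions about M ⊗ B into
questions about `M`. -/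
lemma tw_gen_injective {b : Sec (pm B) U} (hb : IsGen b) (h : V ≤ U) {m : Sec (pm M) V}
    (hm : tw M B V m (res h b) = 0) : m = 0 := by
  refine sec_eq_zero m fun x hx ↦ ?_
  obtain ⟨W, hW, hxW, h0⟩ := η_injective_locally _ hm x hx
  refine ⟨W, hW, hxW, ?_⟩
  replace h0 : res hW (twEquiv (pm M) (pm B) (m ⊗ₜ res h b)) = 0 := h0
  rw [res_twEquiv_tmul, map_eq_zero_iff _ (LinearEquiv.injective _)] at h0
  apply (tmul_gen_bijective (M := M) hb (hW.trans h)).1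
  simpa using h0

lemma tw_gen_surjective {b : Sec (pm B) U} (hb : IsGen b) (h : V ≤ U)
    (s : Sec (pm ((twist B).obj M)) V) : ∃ m : Sec (pm M) V, tw M B V m (res h b) = s := by
  obtain ⟨m, hm⟩ := exists_of_locally (M := M) (N := (twist B).obj M) (U := V)
    (fun W h' ↦ ((tw M B W).flip (res (h'.trans h) b)).toAddMonoidHom)
    (fun {W W'} h' h'' m ↦ by
      change tw M B W' (res h'' m) (res _ b) = res h'' (tw M B W m (res _ b))
      rw [res_tw, res_res])
    (fun W h' m hm ↦ tw_gen_injective hb (h'.trans h) hm) s (fun x hx ↦ by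
      obtain ⟨W, hW, hxW, t, ht⟩ := η_surjective_locally (P := pTw (pm M) (pm B)) s x hx
      obtain ⟨t, rfl⟩ := (twEquiv (pm M) (pm B)).surjective t
      obtain ⟨m, rfl⟩ := (tmul_gen_bijective (M := M) hb (hW.trans h)).2 t
      exact ⟨W, hW, hxW, m, ht⟩)
  exact ⟨m, hm⟩

lemma IsGen.tw {A : X.Modules} {b : Sec (pm B) U} {a : Sec (pm A) U} (hb : IsGen b)
    (ha : IsGen a) : IsGen (tw B A U b a) := by
  intro V h
  have : (fun f : Γ(X, V) ↦ f • SyzygyWeight.res h (SyzygyWeight.tw B A U b a)) =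
      fun f ↦ SyzygyWeight.tw B A V (f • SyzygyWeight.res h b) (SyzygyWeight.res h a) := by
    funext f
    rw [res_tw, map_smul, LinearMap.smul_apply]
  rw [this]
  refine Function.Bijective.comp (f := fun f : Γ(X, V) ↦ f • SyzygyWeight.res h b)
    (g := fun m ↦ SyzygyWeight.tw B A V m (SyzygyWeight.res h a)) ⟨fun m m' hm ↦ ?_, fun s ↦ ?_⟩ (hb V h)
  · rw [← sub_eq_zero]
    refine tw_gen_injective ha h ?_
    rw [map_sub, LinearMap.sub_apply, sub_eq_zero]
    exact hm
  · exact tw_gen_surjective ha h s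

end Twist

/-! ### Inverse images of generators -/

section Pullback

variable {X Y : Scheme.{0}} {i : Y ⟶ X} {M : X.Modules} {U : X.Opens}

/-- The sections of the pullback are locally in any natural family of submodules containing the
pullbacks of sections. -/
lemma locally_mem_of_pu_mem
    (S : ∀ V, Submodule Γ(Y, V) (Sec (pm ((Scheme.Modules.pullback i).obj M)) V))
    (hS : ∀ {V W : Y.Opens} (h : W ≤ V) s, s ∈ S V → res h s ∈ S W)
    (H : ∀ U (s : Sec (pm M) U), pu i M U s ∈ S (i ⁻¹ᵁ U)) {V : Y.Opens}
    (s : Sec (pm ((Scheme.Modules.pullback i).obj M)) V) :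
    Locally V fun W h ↦ res h s ∈ S W := by
  refine locally_mem_of_hom_eq_zero S hS (fun N φ h ↦ pullback_hom_ext fun U s ↦ ?_) s
  rw [h _ _ (H U s), sap_zero]

/-- The coefficient of a section with respect to a generator. -/
def coeff {b : Sec (pm M) U} (hb : IsGen b) (V : X.Opens) : Sec (pm M) V →+ Γ(X, V ⊓ U) :=
  (LinearEquiv.ofBijective (LinearMap.toSpanSingleton Γ(X, V ⊓ U) _ (res inf_le_right b))
    (hb _ inf_le_right)).symm.toLinearMap.toAddMonoidHom.comp (res inf_le_left)

lemma coeff_spec {b : Sec (pm M) U} (hb : IsGen b) (V : X.Opens) (s : Sec (pm M) V) :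
    coeff hb V s • res inf_le_right b = res inf_le_left s :=
  (LinearEquiv.ofBijective (LinearMap.toSpanSingleton Γ(X, V ⊓ U) _ (res inf_le_right b))
    (hb _ inf_le_right)).apply_symm_apply _

lemma coeff_unique {b : Sec (pm M) U} (hb : IsGen b) {V : X.Opens} {s : Sec (pm M) V}
    {a : Γ(X, V ⊓ U)} (h : a • res inf_le_right b = res inf_le_left s) : coeff hb V s = a :=
  (hb _ inf_le_right).1 ((coeff_spec hb V s).trans h.symm)

/-- The functions on `V ∩ U`, as a module over the functions on `V`. -/
def InfSec (U V : Y.Opens) : Type := Γ(Y, V ⊓ U)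

instance (U V : Y.Opens) : AddCommGroup (InfSec U V) := inferInstanceAs (AddCommGroup Γ(Y, V ⊓ U))

instance (U V : Y.Opens) : Module Γ(Y, V) (InfSec U V) :=
  inferInstanceAs (Module Γ(Y, V) ((ModuleCat.restrictScalars
    (rres (U := V) (V := V ⊓ U) inf_le_left)).obj (ModuleCat.of _ Γ(Y, V ⊓ U))))

/-- The presheaf `V ↦ Γ(Y, V ∩ U)`. -/
def infPre (U : Y.Opens) : Y.PresheafOfModules :=
  mkPre (InfSec U) (fun {V W} h ↦ (rres (U := V ⊓ U) (V := W ⊓ U)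
      (inf_le_inf_right U h)).toAddMonoidHom)
    (fun {V} s ↦ rres_self (U := V ⊓ U) _ s)
    (fun {V W W'} h h' s ↦ (rres_rres (U := V ⊓ U) (V := W ⊓ U) (W := W' ⊓ U) _ _ s).symm)
    (fun {V W} h a s ↦ by
      change rres _ (rres (V := V ⊓ U) inf_le_left a * (show Γ(Y, V ⊓ U) from s)) =
        rres (V := W ⊓ U) inf_le_left (rres h a) * rres (U := V ⊓ U) _ s
      rw [map_mul, rres_rres, rres_rres])

/-- The sections of `infPre`. -/
def infE (U V : Y.Opens) : Γ(Y, V ⊓ U) ≃+ Sec (infPre U) V where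
  toFun s := s
  invFun s := s
  map_add' _ _ := rfl
  left_inv _ := rfl
  right_inv _ := rfl

lemma infE_smul (U V : Y.Opens) (a : Γ(Y, V)) (s : Γ(Y, V ⊓ U)) :
    a • infE U V s = infE U V (rres inf_le_left a * s) := rfl

lemma infE_res (U : Y.Opens) {V W : Y.Opens} (h : W ≤ V) (s : Γ(Y, V ⊓ U)) :
    res h (infE U V s) = infE U W (rres (inf_le_inf_right U h) s) := rfl

/-- Freeness is detected by the morphism that sends a pulled-back section to the pullback of its
coefficient with respect to `b`; it sends the pullback of `b` to 1. Generation needs to be checked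
only on pulled-back sections, where the coefficient is again the pullback of one on the base. -/
lemma IsGen.pu {b : Sec (pm M) U} (hb : IsGen b) : IsGen (pu i M U b) := by
  refine isGen_of_locally _ (fun V h a ha ↦ ?_) (fun V h s ↦ ?_)
  -- Coefficients exist only inside `U`, whereas a morphism needs data on every open set; hence the
  -- target V ↦ Γ(V ∩ i⁻¹U).
  · obtain ⟨φ, hφ⟩ := exists_pullback_hom (i := i) (M := M) (P := infPre (i ⁻¹ᵁ U))
      (fun V ↦ (infE (i ⁻¹ᵁ U) (i ⁻¹ᵁ V)).toAddMonoidHom.comp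
        ((cm i (V ⊓ U)).toAddMonoidHom.comp (coeff hb V)))
      (fun V a s ↦ by
        have : coeff hb V (a • s) = rres inf_le_left a * coeff hb V s := by
          apply coeff_unique
          rw [mul_smul, coeff_spec, res_smul]
        change infE (i ⁻¹ᵁ U) (i ⁻¹ᵁ V) (cm i _ (coeff hb V (a • s))) = _ • infE (i ⁻¹ᵁ U) (i ⁻¹ᵁ V) (cm i _ (coeff hb V s))
        rw [this, map_mul, cm_rres]
        rfl)
      (fun {V W} h s ↦ by
        have : coeff hb W (SyzygyWeight.res h s) = rres (inf_le_inf_right U h) (coeff hb V s) := by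
          apply coeff_unique
          have h1 := congrArg (SyzygyWeight.res (inf_le_inf_right U h)) (coeff_spec hb V s)
          rw [res_smul, res_res, res_res] at h1
          rw [res_res]
          exact h1
        change infE (i ⁻¹ᵁ U) (i ⁻¹ᵁ W) (cm i _ (coeff hb W _)) = SyzygyWeight.res _ (infE (i ⁻¹ᵁ U) (i ⁻¹ᵁ V) (cm i _ (coeff hb V s)))
        rw [this, cm_rres]
        rfl)
    have hφb : sap φ _ (SyzygyWeight.pu i M U b) = η _ _ (infE (i ⁻¹ᵁ U) (i ⁻¹ᵁ U) 1) := by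
      rw [hφ]
      change η _ _ (infE (i ⁻¹ᵁ U) (i ⁻¹ᵁ U) (cm i _ (coeff hb U b))) = _
      have : coeff hb U b = 1 := coeff_unique hb (by rw [one_smul])
      rw [this, map_one]
      rfl
    have h0 := congrArg (sap φ V) ha
    rw [map_smul, ap_res, hφb, ← η_res, ← map_smul, map_zero, infE_res, infE_smul, map_one,
      mul_one] at h0
    refine rres_ext _ _ fun x hx ↦ ?_
    obtain ⟨W, hW, hxW, h1⟩ := η_injective_locally _ h0 x hx
    refine ⟨W, hW, hxW, ?_⟩
    rw [infE_res, AddEquiv.map_eq_zero_iff] at h1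
    have h2 := congrArg (rres (le_inf le_rfl (hW.trans h) : W ≤ W ⊓ i ⁻¹ᵁ U)) h1
    rw [rres_rres, rres_rres, map_zero] at h2
    exact h2.trans (map_zero _).symm
  · have key := locally_mem_of_pu_mem (i := i) (M := M) (fun V ↦
      { carrier := {s | ∃ a : Γ(Y, V ⊓ i ⁻¹ᵁ U),
          a • SyzygyWeight.res inf_le_right (SyzygyWeight.pu i M U b) =
            SyzygyWeight.res inf_le_left s}
        add_mem' := by
          rintro s t ⟨a, ha⟩ ⟨a', ha'⟩
          exact ⟨a + a', by rw [add_smul, ha, ha', map_add]⟩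
        zero_mem' := ⟨0, by rw [zero_smul, map_zero]⟩
        smul_mem' := by
          rintro c s ⟨a, ha⟩
          exact ⟨rres inf_le_left c * a, by rw [mul_smul, ha, res_smul]⟩ })
      (by
        rintro V W h s ⟨a, ha⟩
        refine ⟨rres (inf_le_inf_right _ h) a, ?_⟩
        have h1 := congrArg (SyzygyWeight.res (inf_le_inf_right (i ⁻¹ᵁ U) h)) ha
        rw [res_smul, res_res, res_res] at h1
        rw [res_res]
        exact h1)
      (fun V s ↦ ⟨cm i _ (coeff hb V s), by
        have h1 := congrArg (SyzygyWeight.pu i M _) (coeff_spec hb V s)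
        rw [pu_smul, pu_res, pu_res] at h1
        exact h1⟩) s
    intro x hx
    obtain ⟨W, hW, hxW, a, ha⟩ := key x hx
    refine ⟨W, hW, hxW, rres (le_inf le_rfl (hW.trans h)) a, ?_⟩
    have h1 := congrArg (SyzygyWeight.res (le_inf le_rfl (hW.trans h))) ha
    rw [res_smul, res_res, res_res, res_res] at h1
    exact h1

end Pullback

end
end SyzygyWeight

/-! ### Trivial bundles, their constant sections and coordinate functionals. -/

namespace SyzygyWeight
noncomputable section

section TrivialBundle

variable {X : Scheme.{0}} (f : X ⟶ Spec (CommRingCat.of ℂ)) {M N : X.Modules} {U V : X.Opens}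
  {E F : ModuleCat.{0} ℂ}

lemma le_preimage_top {Y : Scheme.{0}} (f : X ⟶ Y) (U : X.Opens) : U ≤ f ⁻¹ᵁ ⊤ := fun _ _ ↦ trivial

/-- Constants as functions. -/
def cstR (U : X.Opens) : ℂ →+* Γ(X, U) :=
  (rres (le_preimage_top f U)).comp ((cm f ⊤).comp (Scheme.ΓSpecIso (CommRingCat.of ℂ)).inv.hom)

lemma rres_cstR (h : V ≤ U) (c : ℂ) : rres h (cstR f U c) = cstR f V c :=
  rres_rres _ _ _

/-- Global sections as sections over the preimage of the base. -/
def gsE (M : X.Modules) : (globalSections f).obj M ≃+ Sec (pm M) (f ⁻¹ᵁ ⊤) where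
  toFun s := s
  invFun s := s
  map_add' _ _ := rfl
  left_inv _ := rfl
  right_inv _ := rfl

lemma gsE_smul (c : ℂ) (s : (globalSections f).obj M) :
    gsE f M (c • s) = cstR f (f ⁻¹ᵁ ⊤) c • gsE f M s := by
  have h : gsE f M (c • s) = cm f ⊤ (rres le_rfl
      ((Scheme.ΓSpecIso (CommRingCat.of ℂ)).inv.hom c)) • gsE f M s := rfl
  rw [h, rres_self]
  exact congrArg (· • gsE f M s) (rres_self le_rfl _).symm

/-- The restriction of a global section to `U`. -/
def gs (M : X.Modules) (U : X.Opens) : (globalSections f).obj M →+ Sec (pm M) U :=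
  (res (le_preimage_top f U)).comp (gsE f M).toAddMonoidHom

lemma gs_apply (s : (globalSections f).obj M) :
    gs f M U s = res (le_preimage_top f U) (gsE f M s) := rfl

lemma gs_smul (c : ℂ) (s : (globalSections f).obj M) :
    gs f M U (c • s) = cstR f U c • gs f M U s := by
  rw [gs_apply, gsE_smul, res_smul, rres_cstR]
  rfl

lemma res_gs (h : V ≤ U) (s : (globalSections f).obj M) : res h (gs f M U s) = gs f M V s :=
  res_res _ _ _

lemma gs_injective : Function.Injective (gs f M ⊤) := by
  intro s t h
  apply (gsE f M).injective
  have := congrArg (res (show f ⁻¹ᵁ ⊤ ≤ ⊤ from le_top)) h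
  rwa [gs_apply, gs_apply, res_res, res_res, res_self, res_self] at this

lemma sap_gs (φ : M ⟶ N) (s : (globalSections f).obj M) :
    sap φ U (gs f M U s) = gs f N U ((globalSections f).map φ s) :=
  ap_res _ _ _

/-- Constant sections of a trivial bundle. -/
def cst (U : X.Opens) : E →+ Sec (pm ((trivialBundle f).obj E)) U :=
  (gs f _ U).comp ((trivialBundleAdjunction f).unit.app E).hom.toAddMonoidHom

lemma cst_smul (c : ℂ) (v : E) : cst f U (c • v) = cstR f U c • cst f U v := by
  refine (congrArg (gs f _ U) (map_smul ((trivialBundleAdjunction f).unit.app E).hom c v)).trans ?_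
  exact gs_smul f c _

@[simp] lemma res_cst (h : V ≤ U) (v : E) : res h (cst f U v) = cst f V v :=
  res_gs f h _

@[simp] lemma sap_trivialBundle_map (g : E ⟶ F) (v : E) :
    sap ((trivialBundle f).map g) U (cst f U v) = cst f U (g v) := by
  refine (sap_gs f _ _).trans (congrArg (gs f _ U) ?_)
  exact congrArg (fun g ↦ g.hom v) ((trivialBundleAdjunction f).unit.naturality g).symm

@[simp] lemma sap_evalMap (φ : E ⟶ (globalSections f).obj M) (v : E) :
    sap (evalMap f φ) U (cst f U v) = gs f M U (φ v) := by
  refine (sap_gs f _ _).trans (congrArg (gs f _ U) ?_)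
  have := (trivialBundleAdjunction f).homEquiv_unit (X := E) (Y := M) (f := evalMap f φ)
  replace this := this.symm.trans (((trivialBundleAdjunction f).homEquiv E M).apply_symm_apply _)
  exact congrArg (fun g ↦ g.hom v) this

/-- This is the adjunction between trivial bundles and global sections. It replaces any sectionwise
description of the bundle, which would not be V ⊗ Γ(U) in infinite rank. -/
lemma trivialBundle_hom_ext {φ ψ : (trivialBundle f).obj E ⟶ M}
    (h : ∀ v, sap φ ⊤ (cst f ⊤ v) = sap ψ ⊤ (cst f ⊤ v)) : φ = ψ := by
  apply ((trivialBundleAdjunction f).homEquiv E M).injective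
  rw [Adjunction.homEquiv_unit, Adjunction.homEquiv_unit]
  ext v
  apply gs_injective
  exact ((sap_gs f _ _).symm.trans (h v)).trans (sap_gs f _ _)

/-- Sections of a trivial bundle are locally linear combinations of constant sections. -/
lemma locally_mem_span_cst {ι : Type} (b : Module.Basis ι ℂ E)
    (s : Sec (pm ((trivialBundle f).obj E)) U) :
    Locally U fun V h ↦ res h s ∈ Submodule.span Γ(X, V) (Set.range fun a ↦ cst f V (b a)) := by
  refine locally_mem_of_hom_eq_zero
    (fun V ↦ Submodule.span Γ(X, V) (Set.range fun a ↦ cst f V (b a))) ?_ ?_ s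
  · intro U V h s hs
    induction hs using Submodule.span_induction with
    | mem s hs =>
      obtain ⟨a, rfl⟩ := hs
      exact Submodule.subset_span ⟨a, (res_cst f h _).symm⟩
    | zero => rw [map_zero]; exact zero_mem _
    | add s t _ _ hs ht => rw [map_add]; exact add_mem hs ht
    | smul c s _ hs => rw [res_smul]; exact Submodule.smul_mem _ _ hs
  · intro N φ h
    refine trivialBundle_hom_ext f fun v ↦ ?_
    rw [sap_zero]
    refine h ⊤ _ ?_
    have hv : v ∈ Submodule.span ℂ (Set.range b) := by rw [b.span_eq]; trivial
    induction hv using Submodule.span_induction with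
    | mem s hs =>
      obtain ⟨a, rfl⟩ := hs
      exact Submodule.subset_span ⟨a, rfl⟩
    | zero => rw [map_zero]; exact zero_mem _
    | add s t _ _ hs ht => rw [map_add]; exact add_mem hs ht
    | smul c s _ hs => rw [cst_smul]; exact Submodule.smul_mem _ _ hs

/-- A linear functional as a linear map to the constant functions. -/
def funSectionsLin (l : E →ₗ[ℂ] ℂ) : E →ₗ[ℂ] (globalSections f).obj (structureModule X) where
  toFun v := (gsE f _).symm (ofR (cstR f (f ⁻¹ᵁ ⊤) (l v)))
  map_add' v w := by
    rw [map_add, map_add, map_add, map_add]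
  map_smul' c v := by
    apply (gsE f _).injective
    refine Eq.trans ?_ (gsE_smul f c _).symm
    rw [AddEquiv.apply_symm_apply, AddEquiv.apply_symm_apply, map_smul, smul_eq_mul, map_mul,
      ← map_smul, smul_eq_mul]

/-- A linear functional as a map to the constant functions. -/
def funSections (l : E →ₗ[ℂ] ℂ) : E ⟶ (globalSections f).obj (structureModule X) :=
  ModuleCat.ofHom (Y := (globalSections f).obj (structureModule X)) (funSectionsLin f l)

lemma gs_funSections (l : E →ₗ[ℂ] ℂ) (v : E) :
    gs f _ U (funSections f l v) = ofR (cstR f U (l v)) := by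
  rw [← rres_cstR f (le_preimage_top f U), ← res_ofR]
  rfl

/-- The linear functional on a trivial bundle extending a linear functional on the fibre. -/
def trivFun (l : E →ₗ[ℂ] ℂ) (U : X.Opens) :
    Sec (pm ((trivialBundle f).obj E)) U →ₗ[Γ(X, U)] Γ(X, U) :=
  ofR.symm.toLinearMap.comp (sap (evalMap f (funSections f l)) U)

@[simp] lemma trivFun_cst (l : E →ₗ[ℂ] ℂ) (v : E) : trivFun f l U (cst f U v) = cstR f U (l v) := by
  have : sap (evalMap f (funSections f l)) U (cst f U v) = ofR (cstR f U (l v)) := by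
    rw [sap_evalMap, gs_funSections]
  exact congrArg ofR.symm this

lemma rres_trivFun (l : E →ₗ[ℂ] ℂ) (h : V ≤ U) (s : Sec (pm ((trivialBundle f).obj E)) U) :
    rres h (trivFun f l U s) = trivFun f l V (res h s) := by
  change _ = ofR.symm (sap _ V (res h s))
  rw [ap_res]
  rfl

lemma trivFun_map (g : E ⟶ F) (l : F →ₗ[ℂ] ℂ) (s : Sec (pm ((trivialBundle f).obj E)) U) :
    trivFun f l U (sap ((trivialBundle f).map g) U s) = trivFun f (l ∘ₗ g.hom) U s := by
  have : (trivialBundle f).map g ≫ evalMap f (funSections f l) =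
      evalMap f (funSections f (l ∘ₗ g.hom)) := by
    refine trivialBundle_hom_ext f fun v ↦ ?_
    rw [sap_comp, sap_trivialBundle_map, sap_evalMap, sap_evalMap, gs_funSections, gs_funSections]
    rfl
  exact congrArg (fun φ ↦ ofR.symm (sap φ U s)) this

/-- A section of a trivial bundle of finite rank is the linear combination of the constant sections
given by its coordinates. -/
lemma sum_trivFun_smul_cst {ι : Type} [Fintype ι] (b : Module.Basis ι ℂ E)
    (s : Sec (pm ((trivialBundle f).obj E)) U) :
    ∑ a, trivFun f (b.coord a) U s • cst f U (b a) = s := by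
  classical
  refine sec_ext _ _ fun x hx ↦ ?_
  obtain ⟨V, hV, hxV, hs⟩ := locally_mem_span_cst f b s x hx
  refine ⟨V, hV, hxV, ?_⟩
  beta_reduce
  simp only [map_sum, res_smul, rres_trivFun, res_cst]
  generalize res hV s = t at hs
  induction hs using Submodule.span_induction with
  | mem s hs =>
    obtain ⟨a, rfl⟩ := hs
    simp only [trivFun_cst, Module.Basis.coord_apply, Module.Basis.repr_self, Finsupp.single_apply]
    simp [apply_ite (cstR f V), ite_smul]
  | zero => simp
  | add s t _ _ hs ht => simp only [map_add, add_smul, Finset.sum_add_distrib, hs, ht]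
  | smul c s _ hs => simp only [map_smul, smul_assoc, ← Finset.smul_sum, hs]

/-- The sections of a trivial bundle of finite rank have a basis of constant sections. -/
def cstBasis {ι : Type} [Fintype ι] (b : Module.Basis ι ℂ E) (U : X.Opens) :
    Module.Basis ι Γ(X, U) (Sec (pm ((trivialBundle f).obj E)) U) :=
  Module.Basis.ofEquivFun
    { toFun := fun s a ↦ trivFun f (b.coord a) U s
      invFun := fun c ↦ ∑ a, c a • cst f U (b a)
      map_add' := fun s t ↦ by ext; simp
      map_smul' := fun c s ↦ by ext; simp
      left_inv := fun s ↦ sum_trivFun_smul_cst f b s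
      right_inv := fun c ↦ by
        classical
        ext a
        simp [Finsupp.single_apply, apply_ite (cstR f U)] }

@[simp] lemma cstBasis_apply {ι : Type} [Fintype ι] (b : Module.Basis ι ℂ E) (a : ι) :
    cstBasis f b U a = cst f U (b a) := by
  classical
  refine (congrFun (Module.Basis.coe_ofEquivFun _) a).trans ?_
  change ∑ k, (Pi.single a 1 : ι → Γ(X, U)) k • cst f U (b k) = _
  simp [Pi.single_apply, ite_smul]

end TrivialBundle

end
end SyzygyWeight

/-! ### Local frames of kernel bundles and of their exterior powers. -/

namespace SyzygyWeight
noncomputable section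

/-! ### Local frames -/

section Frames

variable {X : Scheme.{0}} {M : X.Modules} {U V W : X.Opens} {ι : Type}

/-- Every section of `M` over an open subset of `U` is locally a linear combination of the `e a`. -/
def LocallySpans (e : ι → Sec (pm M) U) : Prop :=
  ∀ V (h : V ≤ U) (s : Sec (pm M) V), Locally V fun W h' ↦
    res h' s ∈ Submodule.span Γ(X, W) (Set.range fun a ↦ res (h'.trans h) (e a))

/-- The family `e` has dual functionals over all open subsets of `U`. -/
def HasDuals (e : ι → Sec (pm M) U) : Prop :=
  ∀ V (h : V ≤ U), ∃ l : ι → Module.Dual Γ(X, V) (Sec (pm M) V),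
    (∀ a, l a (res h (e a)) = 1) ∧ ∀ ⦃a b⦄, a ≠ b → l a (res h (e b)) = 0

/-- The family `e` is a basis of `M|_U`. -/
structure IsFrame (e : ι → Sec (pm M) U) : Prop where
  indep : ∀ V (h : V ≤ U), LinearIndependent Γ(X, V) fun a ↦ res h (e a)
  spans : LocallySpans e

lemma span_res_mem {e : ι → Sec (pm M) U} {s : Sec (pm M) U} (h : V ≤ U)
    (hs : s ∈ Submodule.span Γ(X, U) (Set.range e)) :
    res h s ∈ Submodule.span Γ(X, V) (Set.range fun a ↦ res h (e a)) := by
  induction hs using Submodule.span_induction with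
  | mem s hs =>
    obtain ⟨a, rfl⟩ := hs
    exact Submodule.subset_span ⟨a, rfl⟩
  | zero => rw [map_zero]; exact zero_mem _
  | add s t _ _ hs ht => rw [map_add]; exact add_mem hs ht
  | smul c s _ hs => rw [res_smul]; exact Submodule.smul_mem _ _ hs

/-- Finitely many local properties hold simultaneously. -/
lemma Locally.forall_fin {n : ℕ} {p : Fin n → ∀ V : X.Opens, V ≤ U → Prop}
    (hp : ∀ k, Locally U (p k))
    (mono : ∀ k V W (h : V ≤ U) (h' : W ≤ V), p k V h → p k W (h'.trans h)) :
    Locally U fun V h ↦ ∀ k, p k V h := by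
  intro x hx
  choose V hV hxV h using fun k ↦ hp k x hx
  -- Intersecting with `U` matters when n = 0: the empty infimum is all of X.
  let W : X.Opens := (Finset.univ.inf V) ⊓ U
  have hW : W ≤ U := inf_le_right
  have hWV (k) : W ≤ V k := inf_le_left.trans (Finset.inf_le (Finset.mem_univ k))
  refine ⟨W, hW, ⟨?_, hx⟩, fun k ↦ mono k _ _ (hV k) (hWV k) (h k)⟩
  rw [TopologicalSpace.Opens.coe_finset_inf, Finset.inf_set_eq_iInter]
  simpa using hxV

/-- All arguments lie in the span of `e`, and the n-th exterior power of that span is generated by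
wedges of increasing n-tuples of the `e a`. -/
lemma alternatingMap_mem_span {R E F : Type} [CommRing R] [AddCommGroup E] [Module R E]
    [AddCommGroup F] [Module R F] [LinearOrder ι] {n : ℕ} (ω : E [⋀^Fin n]→ₗ[R] F) (e : ι → E)
    (m : Fin n → E) (hm : ∀ k, m k ∈ Submodule.span R (Set.range e)) :
    ω m ∈ Submodule.span R (Set.range fun a : Fin n ↪o ι ↦ ω fun k ↦ e (a k)) := by
  let S := Submodule.span R (Set.range e)
  let e' : ι → S := fun a ↦ ⟨e a, Submodule.subset_span ⟨a, rfl⟩⟩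
  have he' : Submodule.span R (Set.range e') = ⊤ := by
    have := Submodule.span_span_coe_preimage (R := R) (s := Set.range e)
    convert this using 2
    ext x
    constructor
    · rintro ⟨a, rfl⟩
      exact ⟨a, rfl⟩
    · rintro ⟨a, ha⟩
      exact ⟨a, Subtype.ext ha⟩
  have h1 := exteriorPower.ιMulti_family_span_of_span (n := n) R he'
  let T := exteriorPower.alternatingMapLinearEquiv (ω.compLinearMap S.subtype)
  have hT (v : Fin n → S) : T (exteriorPower.ιMulti R n v) = ω fun k ↦ v k :=
    exteriorPower.alternatingMapLinearEquiv_apply_ιMulti _ _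
  have h2 : ω m = T (exteriorPower.ιMulti R n fun k ↦ ⟨m k, hm k⟩) := (hT fun k ↦ ⟨m k, hm k⟩).symm
  have h3 : exteriorPower.ιMulti R n (fun k ↦ (⟨m k, hm k⟩ : S)) ∈
    Submodule.span R (Set.range (exteriorPower.ιMulti_family R n e')) := by
    rw [h1]; trivial
  rw [h2]
  have h4 := Submodule.mem_map_of_mem (f := T) h3
  rw [Submodule.map_span, ← Set.range_comp] at h4
  refine Submodule.span_mono ?_ h4
  rintro _ ⟨a, rfl⟩
  exact ⟨Set.powersetCard.ofFinEmbEquiv.symm a,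
    (hT fun k ↦ e' (Set.powersetCard.ofFinEmbEquiv.symm a k)).symm⟩

/-- The map from the exterior power of the module of sections to the sections of the exterior
power. -/
def omL (n : ℕ) (M : X.Modules) (U : X.Opens) :
    (⋀[Γ(X, U)]^n (Sec (pm M) U)) →ₗ[Γ(X, U)] Sec (pm ((extPower X n).obj M)) U :=
  (η (pExt n (pm M)) U).comp (extEquiv (pm M)).toLinearMap

@[simp] lemma omL_ιMulti {n : ℕ} (m : Fin n → Sec (pm M) U) :
    omL n M U (exteriorPower.ιMulti _ n m) = om n M U m := rfl

lemma omL_injective_locally {n : ℕ} (t : ⋀[Γ(X, U)]^n (Sec (pm M) U)) (ht : omL n M U t = 0) :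
    Locally U fun _ h ↦ res h (extEquiv (pm M) t) = 0 :=
  η_injective_locally _ ht

lemma omL_surjective_locally {n : ℕ} (s : Sec (pm ((extPower X n).obj M)) U) :
    Locally U fun V h ↦ ∃ t, omL n M V t = res h s := by
  intro x hx
  obtain ⟨W, hW, hxW, t, ht⟩ := η_surjective_locally (P := pExt n (pm M)) s x hx
  exact ⟨W, hW, hxW, (extEquiv (pm M)).symm t, ht⟩

/-- Dual functionals, rather than mere independence, are what passes to exterior powers: the wedges
of functionals pair with the wedges of the `e a` as a dual family. Spanning is only local because an
infinite frame need not span the sections over a given open set. -/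
lemma IsFrame.extPower [LinearOrder ι] {e : ι → Sec (pm M) U} (h1 : LocallySpans e)
    (h2 : HasDuals e) (n : ℕ) :
    IsFrame (fun a : Fin n ↪o ι ↦ om n M U fun k ↦ e (a k)) where
  indep V h := by
    rw [linearIndependent_iff']
    intro F g hg a ha
    simp only [res_om] at hg
    have hg' : omL n M V (∑ a ∈ F, g a •
        (exteriorPower.ιMulti _ n fun k ↦ res h (e (a k)))) = 0 := by
      simpa using hg
    refine rres_ext _ _ fun x hx ↦ ?_
    obtain ⟨W, hW, hxW, h0⟩ := omL_injective_locally _ hg' x hx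
    refine ⟨W, hW, hxW, ?_⟩
    obtain ⟨l, hl1, hl0⟩ := h2 W (hW.trans h)
    simp only [map_sum] at h0
    have h0' : ∑ a ∈ F, rres hW (g a) • exteriorPower.ιMulti Γ(X, W) n
        ((fun b ↦ res (hW.trans h) (e b)) ∘ a) = 0 := by
      apply (extEquiv (U := W) (n := n) (pm M)).injective
      rw [map_sum, map_zero, ← h0]
      refine Finset.sum_congr rfl fun a _ ↦ ?_
      rw [map_smul, map_smul, res_smul, res_extEquiv_ιMulti]
      simp only [res_res]
      rfl
    -- Pairing the relation with the wedge of the functionals indexed by `a` isolates the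
    -- coefficient of `a`.
    have h3 := congrArg (exteriorPower.pairingDual Γ(X, W) _ n
      (exteriorPower.ιMulti _ _ (l ∘ a))) h0'
    rw [map_sum, map_zero, Finset.sum_eq_single a] at h3
    · rw [map_smul, exteriorPower.pairingDual_apply_apply_eq_one _ _ hl1 hl0] at h3
      simpa using h3
    · intro b _ hb
      rw [map_smul, exteriorPower.pairingDual_apply_apply_eq_one_zero _ _ hl0 _ _ _ hb.symm,
        smul_zero]
    · exact fun h ↦ (h ha).elim
  spans V h s x hx := by
    obtain ⟨W, hW, hxW, t, ht⟩ := omL_surjective_locally s x hx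
    suffices Locally W fun W' h' ↦ res h' (res hW s) ∈ Submodule.span Γ(X, W')
        (Set.range fun a : Fin n ↪o ι ↦
          res (h'.trans (hW.trans h)) (om n M U fun k ↦ e (a k))) by
      obtain ⟨W', hW', hxW', h'⟩ := this x hxW
      rw [res_res] at h'
      exact ⟨W', hW'.trans hW, hxW', h'⟩
    rw [← ht]
    clear ht
    have hs : t ∈ Submodule.span Γ(X, W) (Set.range (exteriorPower.ιMulti Γ(X, W) n)) := by
      rw [ιMulti_span]
      trivial
    clear hxW
    induction hs using Submodule.span_induction with
    | mem t hs =>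
      obtain ⟨m, rfl⟩ := hs
      intro y hy
      -- A wedge has only n factors, so all of them lie in the span of the frame on one common
      -- neighbourhood.
      obtain ⟨W', hW', hyW', h'⟩ := Locally.forall_fin (fun k ↦ h1 W (hW.trans h) (m k))
        (fun k V' W' hV' hW' hm ↦ by
          have := span_res_mem hW' hm
          simpa only [res_res] using this) y hy
      refine ⟨W', hW', hyW', ?_⟩
      have := alternatingMap_mem_span (om n M W') (fun a ↦ res (hW'.trans (hW.trans h)) (e a))
        (fun k ↦ res hW' (m k)) h'
      simp only [omL_ιMulti, res_om]
      exact this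
    | zero =>
      intro y hy
      exact ⟨W, le_rfl, hy, by simp⟩
    | add s t _ _ hs ht =>
      intro y hy
      obtain ⟨W1, hW1, hy1, h1⟩ := hs y hy
      obtain ⟨W2, hW2, hy2, h2⟩ := ht y hy
      refine ⟨W1 ⊓ W2, inf_le_left.trans hW1, ⟨hy1, hy2⟩, ?_⟩
      simp only [map_add]
      refine add_mem ?_ ?_
      · have := span_res_mem (inf_le_left : W1 ⊓ W2 ≤ W1) h1
        simpa only [res_res] using this
      · have := span_res_mem (inf_le_right : W1 ⊓ W2 ≤ W2) h2
        simpa only [res_res] using this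
    | smul c s _ hs =>
      intro y hy
      obtain ⟨W1, hW1, hy1, h1⟩ := hs y hy
      refine ⟨W1, hW1, hy1, ?_⟩
      simp only [map_smul, res_smul]
      exact Submodule.smul_mem _ _ h1

end Frames

/-! ### The frames of a kernel bundle -/

section KernelBundle

variable {X : Scheme.{0}} (f : X ⟶ Spec (CommRingCat.of ℂ)) {L : X.Modules} {U V : X.Opens}
  {E : ModuleCat.{0} ℂ} (φ : E ⟶ (globalSections f).obj L) {ι : Type}

/-- The inclusion of the sections of a kernel bundle in those of the trivial bundle. -/
def kι (U : X.Opens) : Sec (pm (kernelBundle f φ)) U →ₗ[Γ(X, U)]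
    Sec (pm ((trivialBundle f).obj E)) U :=
  sap (kernel.ι (evalMap f φ)) U

lemma res_kι (h : V ≤ U) (s : Sec (pm (kernelBundle f φ)) U) :
    res h (kι f φ U s) = kι f φ V (res h s) :=
  (ap_res _ _ _).symm

lemma kι_injective : Function.Injective (kι f φ U) := sap_injective _

lemma sap_evalMap_kι (s : Sec (pm (kernelBundle f φ)) U) : sap (evalMap f φ) U (kι f φ U s) = 0 :=
  sap_kernel_condition _ s

variable {f φ} (b : Module.Basis ι ℂ E) {a₀ : ι} {c : ι → Γ(X, U)}
  {e : {a // a ≠ a₀} → Sec (pm (kernelBundle f φ)) U}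

/-- Where the basis section `b a₀` generates L, each other basis section is `c a` times it, and
these relations form the frame of the kernel bundle. -/
lemma exists_kernelBundle_family (hc : ∀ a, c a • gs f L U (φ (b a₀)) = gs f L U (φ (b a))) :
    ∃ e : {a // a ≠ a₀} → Sec (pm (kernelBundle f φ)) U,
      ∀ a, kι f φ U (e a) = cst f U (b a) - c a • cst f U (b a₀) := by
  have : ∀ a : {a // a ≠ a₀}, ∃ s : Sec (pm (kernelBundle f φ)) U,
      kι f φ U s = cst f U (b a) - c a • cst f U (b a₀) := fun a ↦
    exists_of_kernel _ _ (by rw [map_sub, map_smul, sap_evalMap, sap_evalMap, hc, sub_self])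
  choose e he using this
  exact ⟨e, he⟩

/-- The coordinates other than `a₀` are dual to the relations: `b a₀` contributes nothing to them.
-/
lemma kernelBundle_hasDuals
    (he : ∀ a, kι f φ U (e a) = cst f U (b a) - c a • cst f U (b a₀)) : HasDuals e := by
  classical
  intro V h
  refine ⟨fun a ↦ (trivFun f (b.coord a) V).comp (kι f φ V), fun a ↦ ?_, fun a a' haa' ↦ ?_⟩
  all_goals
    simp only [LinearMap.comp_apply]
    rw [← res_kι, he]
    simp only [map_sub, res_smul, res_cst, map_smul, trivFun_cst, Module.Basis.coord_apply,
      Module.Basis.repr_self, Finsupp.single_apply]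
  · simp [a.2.symm]
  · have : (a' : ι) ≠ a := fun h ↦ haa' (Subtype.ext h.symm)
    simp [a.2.symm, this]

/-- Locally a section of the kernel is a finite sum ∑ g_a b_a with ∑ g_a c_a = 0, because the
generator is free. Subtracting this zero multiple of `b a₀` rewrites the sum as ∑ g_a (b_a - c_a
b_{a₀}). -/
lemma kernelBundle_locallySpans (hg : IsGen (gs f L U (φ (b a₀))))
    (hc : ∀ a, c a • gs f L U (φ (b a₀)) = gs f L U (φ (b a)))
    (he : ∀ a, kι f φ U (e a) = cst f U (b a) - c a • cst f U (b a₀)) : LocallySpans e := by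
  classical
  intro V h s x hx
  obtain ⟨W, hW, hxW, hs⟩ := locally_mem_span_cst f b (kι f φ V s) x hx
  refine ⟨W, hW, hxW, ?_⟩
  beta_reduce
  rw [res_kι] at hs
  generalize res hW s = t at hs ⊢
  obtain ⟨g, hg'⟩ := Finsupp.mem_span_range_iff_exists_finsupp.1 hs
  have key : ∀ a, res (hW.trans h) (gs f L U (φ (b a))) = gs f L W (φ (b a)) := fun a ↦ res_gs f _ _
  have h0 : (g.sum fun a r ↦ r * rres (hW.trans h) (c a)) = 0 := by
    refine hg.eq_zero_of_le (hW.trans h) ?_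
    have := sap_evalMap_kι f φ t
    rw [← hg'] at this
    rw [← this, Finsupp.sum, Finsupp.sum, map_sum, Finset.sum_smul]
    refine Finset.sum_congr rfl fun a _ ↦ ?_
    rw [map_smul, sap_evalMap, mul_smul, ← res_smul, hc, key]
  have hsum : t = g.sum fun a r ↦ if ha : a ≠ a₀ then r • res (hW.trans h) (e ⟨a, ha⟩) else 0 := by
    apply kι_injective f φ
    have h1 : ∀ a, kι f φ W (if ha : a ≠ a₀ then g a • res (hW.trans h) (e ⟨a, ha⟩) else 0) =
        g a • (cst f W (b a) - rres (hW.trans h) (c a) • cst f W (b a₀)) := by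
      intro a
      by_cases ha : a ≠ a₀
      · rw [dif_pos ha, map_smul, ← res_kι, he]
        simp only [map_sub, res_smul, res_cst]
      · rw [dif_neg ha]
        obtain rfl : a = a₀ := by simpa using ha
        -- The index `a₀` is not in the frame, but its term vanishes because its coefficient
        -- relative to itself is 1.
        have hca : c a = 1 := by
          rw [← sub_eq_zero]
          refine hg.eq_zero ?_
          rw [sub_smul, one_smul, hc, sub_self]
        simp [hca]
    rw [Finsupp.sum, map_sum]
    simp only [h1, smul_sub, smul_smul]
    rw [Finset.sum_sub_distrib, ← Finset.sum_smul]
    rw [Finsupp.sum] at h0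
    rw [h0, zero_smul, sub_zero, ← hg', Finsupp.sum]
  rw [hsum]
  refine sum_mem fun a _ ↦ ?_
  beta_reduce
  split_ifs with ha
  · exact Submodule.smul_mem _ _ (Submodule.subset_span ⟨⟨a, ha⟩, rfl⟩)
  · exact zero_mem _

end KernelBundle

end
end SyzygyWeight

/-! ### Local equations of a divisor, and the exact sequences obtained by twisting. -/

namespace SyzygyWeight
noncomputable section

/-! ### Restriction to a closed subscheme with a local equation -/

section Cut

variable {X D : Scheme.{0}} {i : D ⟶ X} {M : X.Modules} {N : D.Modules} {U V : X.Opens}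

/-- Multiplication by `t` on `M|_U` is injective, and its cokernel is the direct image of `N`. -/
structure IsCut (r : M ⟶ (Scheme.Modules.pushforward i).obj N) (t : Γ(X, U)) : Prop where
  inj : ∀ V (h : V ≤ U) (z : Sec (pm M) V), rres h t • z = 0 → z = 0
  zero : ∀ V (h : V ≤ U) (z : Sec (pm M) V), apf r V (rres h t • z) = 0
  exact : ∀ V (h : V ≤ U) (z : Sec (pm M) V), apf r V z = 0 →
    Locally V fun _ h' ↦ ∃ z', rres (h'.trans h) t • z' = res h' z
  surj : ∀ V, V ≤ U → ∀ (s : Sec (pm N) (i ⁻¹ᵁ V)) (y : D), y ∈ i ⁻¹ᵁ V →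
    ∃ (W : X.Opens) (h' : W ≤ V), i y ∈ W ∧ ∃ z, apf r W z = res (preimage_le h') s

lemma res_ofR_one (h : V ≤ U) :
    res h (ofR (1 : Γ(X, U))) = (ofR (1 : Γ(X, V)) : Sec (pm (structureModule X)) V) :=
  congrArg ofR (map_one (rres h))

lemma apf_structureMap (a : Γ(X, U)) : apf (structureMap i) U (ofR a) = ofR (cm i U a) := rfl

lemma exists_preimage_le [IsClosedImmersion i] {W : D.Opens} {y : D} (hy : y ∈ W)
    (V : X.Opens) (hV : i y ∈ V) : ∃ V' ≤ V, i y ∈ V' ∧ i ⁻¹ᵁ V' ≤ W := by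
  obtain ⟨O, hO, hOW⟩ := (Scheme.Hom.isClosedEmbedding i).isInducing.isOpen_iff.1 W.isOpen
  refine ⟨⟨O, hO⟩ ⊓ V, inf_le_right, ⟨?_, hV⟩, fun z hz ↦ ?_⟩
  · have : y ∈ i ⁻¹' O := by rw [hOW]; exact hy
    exact this
  · have : z ∈ i ⁻¹' O := hz.1
    rw [hOW] at this
    exact this

lemma exists_cm_eq [IsClosedImmersion i] (V : X.Opens) (g : Γ(D, i ⁻¹ᵁ V)) (y : D)
    (hy : y ∈ i ⁻¹ᵁ V) :
    ∃ (W : X.Opens) (h' : W ≤ V), i y ∈ W ∧ ∃ a, cm i W a = rres (preimage_le h') g := by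
  obtain ⟨W, hW, hyW, hWV⟩ := TopologicalSpace.Opens.isBasis_iff_nbhd.1
    X.isBasis_affineOpens (show i y ∈ V from hy)
  exact ⟨W, hWV, hyW, Scheme.Hom.app_surjective i W hW (rres (preimage_le hWV) g)⟩

/-- In terms of a generator a of A, the defining section is t·a, and the exact sequence 0 → 𝒪 → A →
A|_D → 0 becomes 0 → 𝒪 → 𝒪 → 𝒪_D → 0 with first map t. -/
lemma isCut_structureMap [IsClosedImmersion i] {A : X.Modules} {s : structureModule X ⟶ A}
    {w : s ≫ restrictionMap i A = 0} (hs : (ShortComplex.mk s (restrictionMap i A) w).ShortExact)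
    {a : Sec (pm A) U} (ha : IsGen a) {t : Γ(X, U)} (ht : sap s U (ofR 1) = t • a) :
    IsCut (structureMap i) t := by
  have : Mono s := hs.mono_f
  have hst {V : X.Opens} (h : V ≤ U) (g : Γ(X, V)) :
      sap s V (ofR g) = (g * rres h t) • res h a := by
    rw [ofR_eq_smul, map_smul, mul_smul, ← res_smul, ← ht, ← ap_res, res_ofR_one]
  -- t·a restricts to zero on D, and the restriction of a is still a free generator.
  have hpt : cm i U t = 0 := by
    refine (ha.pu (i := i)).eq_zero ?_
    rw [← pu_smul, ← ht]
    have := congrArg (fun φ ↦ sap φ U (ofR 1)) w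
    exact this
  refine ⟨fun V h z hz ↦ ?_, fun V h z ↦ ?_, fun V h z hz x hx ↦ ⟨V, le_rfl, hx, ?_⟩,
    fun V h s y hy ↦ ?_⟩
  · obtain ⟨g, rfl⟩ := ofR.surjective z
    rw [← map_smul, map_eq_zero_iff _ ofR.injective, smul_eq_mul, mul_comm] at hz
    apply sap_injective s
    rw [hst h, hz, zero_smul, map_zero]
  · rw [apf_smul, cm_rres, hpt, map_zero, zero_smul]
  · obtain ⟨g, rfl⟩ := ofR.surjective z
    have hg : cm i V g = 0 := ofR.injective hz
    obtain ⟨g', hg'⟩ := exists_of_exact (ShortComplex.mk s (restrictionMap i A) w) hs.exact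
      (g • res h a) (by
        change pu i A V _ = 0
        rw [pu_smul, hg, zero_smul])
    obtain ⟨g', rfl⟩ := ofR.surjective g'
    refine ⟨ofR g', ?_⟩
    rw [← map_smul, res_self]
    congr 1
    refine (ha V h).1 ?_
    refine Eq.trans ?_ hg'
    change _ = sap s V (ofR g')
    rw [hst h, smul_eq_mul, mul_comm]
  · obtain ⟨W, hW, hyW, g, hg⟩ := exists_cm_eq V (ofR.symm s) y hy
    exact ⟨W, hW, hyW, ofR g, congrArg ofR hg⟩

lemma IsCut.restrict {r : M ⟶ (Scheme.Modules.pushforward i).obj N} {t : Γ(X, U)}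
    (h : IsCut r t) (hV : V ≤ U) : IsCut r (rres hV t) := by
  refine ⟨fun W h' z hz ↦ h.inj W (h'.trans hV) z (by rwa [rres_rres] at hz), fun W h' z ↦ ?_,
    fun W h' z hz x hx ↦ ?_, fun W h' ↦ h.surj W (h'.trans hV)⟩
  · rw [rres_rres]
    exact h.zero W _ z
  · obtain ⟨W', hW', hx', z', hz'⟩ := h.exact W (h'.trans hV) z hz x hx
    exact ⟨W', hW', hx', z', by rw [rres_rres]; exact hz'⟩

lemma IsCut.cm_eq_zero {t : Γ(X, U)} (h : IsCut (structureMap i) t) : cm i U t = 0 := by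
  have := h.zero U le_rfl (ofR 1)
  rw [← map_smul, rres_self, smul_eq_mul, mul_one] at this
  exact ofR.injective this

lemma IsCut.eq_zero {t : Γ(X, U)} (h : IsCut (structureMap i) t) (hV : V ≤ U) {g : Γ(X, V)}
    (hg : rres hV t * g = 0) : g = 0 :=
  ofR.injective (h.inj V hV (ofR g) (by rw [← map_smul, smul_eq_mul, hg, map_zero]))

/-- Local quotients by t glue, since division by a non-zero-divisor is unique. -/
lemma IsCut.exists_mul {t : Γ(X, U)} (h : IsCut (structureMap i) t) (hV : V ≤ U) {g : Γ(X, V)}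
    (hg : cm i V g = 0) : ∃ g', rres hV t * g' = g := by
  obtain ⟨z, hz⟩ := exists_of_locally (M := structureModule X) (N := structureModule X) (U := V)
    (fun W h' ↦ (LinearMap.lsmul _ _ (rres (h'.trans hV) t)).toAddMonoidHom)
    (fun {W W'} h' h'' z ↦ by
      change rres (h''.trans (h'.trans hV)) t • res h'' z = res h'' (rres (h'.trans hV) t • z)
      rw [res_smul, rres_rres])
    (fun W h' z hz ↦ h.inj W (h'.trans hV) z hz) (ofR g)
    (h.exact V hV (ofR g) (congrArg ofR hg))
  exact ⟨ofR.symm z, congrArg ofR.symm hz⟩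

/-- A frame of `M` mapping to a frame of `N`. -/
lemma isCut_of_frame [IsClosedImmersion i] {t : Γ(X, U)} (ht : IsCut (structureMap i) t)
    {r : M ⟶ (Scheme.Modules.pushforward i).obj N} {ι : Type} {e : ι → Sec (pm M) U}
    (he : IsFrame e) (he' : IsFrame fun a ↦ apf r U (e a)) : IsCut r t := by
  refine ⟨fun V h z hz ↦ sec_eq_zero z fun x hx ↦ ?_, fun V h z ↦ ?_, fun V h z hz x hx ↦ ?_,
    fun V h s y hy ↦ ?_⟩
  · obtain ⟨W, hW, hxW, hmem⟩ := he.spans V h z x hx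
    refine ⟨W, hW, hxW, ?_⟩
    obtain ⟨g, hg⟩ := Finsupp.mem_span_range_iff_exists_finsupp.1 hmem
    have h1 := congrArg (res hW) hz
    rw [res_smul, rres_rres, map_zero, ← hg, Finsupp.smul_sum] at h1
    simp only [smul_smul] at h1
    have h2 : ∀ a ∈ g.support, rres (hW.trans h) t * g a = 0 :=
      linearIndependent_iff'.1 (he.indep W (hW.trans h)) g.support
        (fun a ↦ rres (hW.trans h) t * g a) h1
    have h3 : g = 0 := by
      ext a
      by_cases ha : a ∈ g.support
      · exact ht.eq_zero _ (h2 a ha)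
      · simpa using ha
    rw [← hg, h3, Finsupp.sum_zero_index]
  · rw [apf_smul, cm_rres, ht.cm_eq_zero, map_zero, zero_smul]
  · obtain ⟨W, hW, hxW, hmem⟩ := he.spans V h z x hx
    refine ⟨W, hW, hxW, ?_⟩
    obtain ⟨g, hg⟩ := Finsupp.mem_span_range_iff_exists_finsupp.1 hmem
    have h1 := apf_res r hW z
    rw [hz, map_zero, ← hg, Finsupp.sum, map_sum] at h1
    simp only [apf_smul, apf_res] at h1
    have h2 : ∀ a ∈ g.support, cm i W (g a) = 0 :=
      linearIndependent_iff'.1 (he'.indep (i ⁻¹ᵁ W) (preimage_le (hW.trans h))) g.support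
        (fun a ↦ cm i W (g a)) h1
    -- The coefficients vanish on D by independence of the restricted frame, so t divides each of
    -- them.
    have h3 : ∀ a, ∃ g', rres (hW.trans h) t * g' = g a := by
      intro a
      by_cases ha : a ∈ g.support
      · exact ht.exists_mul _ (h2 a ha)
      · exact ⟨0, by rw [mul_zero]; simpa using (Finsupp.notMem_support_iff.1 ha).symm⟩
    choose g' hg' using h3
    refine ⟨∑ a ∈ g.support, g' a • res (hW.trans h) (e a), ?_⟩
    rw [← hg, Finsupp.sum, Finset.smul_sum]
    simp only [smul_smul, hg']
  · obtain ⟨W', hW', hyW', hmem⟩ := he'.spans (i ⁻¹ᵁ V) (preimage_le h) s y hy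
    obtain ⟨W, hW, hyW, hWW⟩ := exists_preimage_le hyW' V hy
    suffices ∃ (W₁ : X.Opens) (h₁ : W₁ ≤ W), i y ∈ W₁ ∧
        ∃ z, apf r W₁ z = res (preimage_le h₁) (res hWW (res hW' s)) by
      obtain ⟨W₁, h₁, hyW₁, z, hz⟩ := this
      exact ⟨W₁, h₁.trans hW, hyW₁, z, by rw [hz, res_res, res_res]⟩
    replace hmem := span_res_mem hWW hmem
    generalize res hWW (res hW' s) = s' at hmem
    induction hmem using Submodule.span_induction with
    | mem s hs =>
      obtain ⟨a, rfl⟩ := hs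
      exact ⟨W, le_rfl, hyW, res (hW.trans h) (e a), by rw [apf_res, res_res, res_res]⟩
    | zero => exact ⟨W, le_rfl, hyW, 0, by rw [map_zero, map_zero]⟩
    | add s t _ _ hs ht =>
      obtain ⟨W₁, h₁, hy₁, z₁, hz₁⟩ := hs
      obtain ⟨W₂, h₂, hy₂, z₂, hz₂⟩ := ht
      refine ⟨W₁ ⊓ W₂, inf_le_left.trans h₁, ⟨hy₁, hy₂⟩, res inf_le_left z₁ + res inf_le_right z₂, ?_⟩
      rw [map_add, apf_res, apf_res, hz₁, hz₂, res_res, res_res, map_add]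
    -- Coefficients are functions on D; they lift to functions on a neighbourhood in X because `i`
    -- is a closed immersion.
    | smul c s _ hs =>
      obtain ⟨W₁, h₁, hy₁, z₁, hz₁⟩ := hs
      obtain ⟨W₂, h₂, hy₂, c', hc'⟩ := exists_cm_eq W c y hyW
      refine ⟨W₁ ⊓ W₂, inf_le_left.trans h₁, ⟨hy₁, hy₂⟩,
        rres (inf_le_right : W₁ ⊓ W₂ ≤ W₂) c' • res inf_le_left z₁, ?_⟩
      rw [apf_smul, apf_res, hz₁, cm_rres, hc', res_res, rres_rres, res_smul]

end Cut

/-! ### The sequences obtained by twisting -/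

section Sequence

variable {X D : Scheme.{0}} {i : D ⟶ X} {M M₁ M₂ A B : X.Modules} {N : D.Modules}
  {U V : X.Opens}

/-- The sequence `0 ⟶ M₁ ⟶ M₂ ⟶ i_* N ⟶ 0` is exact. -/
structure IsSES (α : M₁ ⟶ M₂) (ρ : M₂ ⟶ (Scheme.Modules.pushforward i).obj N) : Prop where
  inj : ∀ V (z : Sec (pm M₁) V), sap α V z = 0 → z = 0
  comp : ∀ V (z : Sec (pm M₁) V), apf ρ V (sap α V z) = 0
  exact : ∀ V (z : Sec (pm M₂) V), apf ρ V z = 0 →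
    Locally V fun W h ↦ ∃ z', sap α W z' = res h z
  surj : ∀ V (s : Sec (pm N) (i ⁻¹ᵁ V)) (y : D), y ∈ i ⁻¹ᵁ V →
    ∃ (W : X.Opens) (h' : W ≤ V), i y ∈ W ∧ ∃ z, apf ρ W z = res (preimage_le h') s

/-- The map `B ⟶ B ⊗ A` given by a section of `A`. -/
def mulSection (B : X.Modules) (s : structureModule X ⟶ A) : B ⟶ (twist A).obj B :=
  mkSHom (fun U ↦ (tw B A U).flip (sap s U (ofR 1))) (fun h b ↦ by
    simp only [LinearMap.flip_apply]
    rw [res_tw, ← ap_res, res_ofR_one])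

lemma sap_mulSection (s : structureModule X ⟶ A) (b : Sec (pm B) U) :
    sap (mulSection B s) U b = tw B A U b (sap s U (ofR 1)) := rfl

variable (i A B) in
/-- The restriction map `B ⊗ A ⟶ i_* (i^* B ⊗ i^* A)`. -/
def restrictTwist : (twist A).obj B ⟶ (Scheme.Modules.pushforward i).obj
    ((twist ((Scheme.Modules.pullback i).obj A)).obj ((Scheme.Modules.pullback i).obj B)) :=
  twPush (restrictionMap i B) (restrictionMap i A)

lemma apf_restrictTwist (b : Sec (pm B) U) (a : Sec (pm A) U) :
    apf (restrictTwist i A B) U (tw B A U b a) = tw _ _ _ (pu i B U b) (pu i A U a) :=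
  apf_twPush _ _ _ _

/-- Local generators b of B and a of A identify M ⊗ B and M ⊗ (B ⊗ A) with M. The map given by s =
t·a becomes multiplication by t, and restriction becomes `r`, so `IsCut` is the local form of the
claim. -/
lemma isSES_twist (hA : IsInvertible A) (hB : IsInvertible B) (s : structureModule X ⟶ A)
    (r : M ⟶ (Scheme.Modules.pushforward i).obj N)
    (hr : ∀ x : X, ∃ U : X.Opens, x ∈ U ∧ ∀ (V : X.Opens) (_ : V ≤ U) (a : Sec (pm A) V) (t : Γ(X, V)),
      IsGen a → sap s V (ofR 1) = t • a → IsCut r t) :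
    IsSES (twistMap M (mulSection B s)) (twPush r (restrictTwist i A B)) := by
  have key : ∀ x : X, ∃ (U : X.Opens) (_ : x ∈ U) (b : Sec (pm B) U) (a : Sec (pm A) U)
      (t : Γ(X, U)), IsGen b ∧ IsGen a ∧ IsCut r t ∧ sap s U (ofR 1) = t • a := by
    intro x
    obtain ⟨U₁, hx₁, h₁⟩ := hr x
    obtain ⟨U₂, hx₂, b, hb⟩ := exists_isGen hB x
    obtain ⟨U₃, hx₃, a, ha⟩ := exists_isGen hA x
    let U := U₁ ⊓ (U₂ ⊓ U₃)
    have h1 : U ≤ U₁ := inf_le_left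
    have h2 : U ≤ U₂ := inf_le_right.trans inf_le_left
    have h3 : U ≤ U₃ := inf_le_right.trans inf_le_right
    obtain ⟨t, ht⟩ := (ha.res h3).exists_smul le_rfl (sap s U (ofR 1))
    rw [res_self] at ht
    exact ⟨U, ⟨hx₁, hx₂, hx₃⟩, res h2 b, res h3 a, t, hb.res h2, ha.res h3,
      h₁ U h1 _ t (ha.res h3) ht.symm, ht.symm⟩
  have hα {U V : X.Opens} {b : Sec (pm B) U} {a : Sec (pm A) U} {t : Γ(X, U)}
      (ht : sap s U (ofR 1) = t • a) (h : V ≤ U) (m : Sec (pm M) V) :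
      sap (twistMap M (mulSection B s)) V (tw M B V m (res h b)) =
        tw M _ V (rres h t • m) (res h (tw B A U b a)) := by
    rw [sap_twistMap, sap_mulSection]
    have : sap s V (ofR 1) = rres h t • res h a := by
      rw [← res_smul, ← ht, ← ap_res, res_ofR_one]
    rw [this, map_smul, map_smul, res_tw, map_smul, LinearMap.smul_apply]
  have hρ {U V : X.Opens} {b : Sec (pm B) U} {a : Sec (pm A) U} (h : V ≤ U) (m : Sec (pm M) V) :
      apf (twPush r (restrictTwist i A B)) V (tw M _ V m (res h (tw B A U b a))) =
        tw N _ _ (apf r V m) (res (preimage_le h) (tw _ _ _ (pu i B U b) (pu i A U a))) := by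
    rw [apf_twPush, apf_res, apf_restrictTwist]
  refine ⟨fun V z hz ↦ sec_eq_zero z fun x hx ↦ ?_, fun V z ↦ sec_eq_zero _ fun y hy ↦ ?_,
    fun V z hz x hx ↦ ?_, fun V σ y hy ↦ ?_⟩
  · obtain ⟨U, hxU, b, a, t, hb, ha, ht, hst⟩ := key x
    refine ⟨V ⊓ U, inf_le_left, ⟨hx, hxU⟩, ?_⟩
    obtain ⟨m, hm⟩ := tw_gen_surjective hb inf_le_right (res (inf_le_left : V ⊓ U ≤ V) z)
    have h1 := congrArg (res (inf_le_left : V ⊓ U ≤ V)) hz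
    rw [map_zero, ← ap_res, ← hm, hα hst] at h1
    rw [← hm, ht.inj _ _ _ (tw_gen_injective (hb.tw ha) _ h1), map_zero, LinearMap.zero_apply]
  · obtain ⟨U, hxU, b, a, t, hb, ha, ht, hst⟩ := key (i y)
    have h1 : V ⊓ U ≤ V := inf_le_left
    refine ⟨i ⁻¹ᵁ (V ⊓ U), preimage_le h1, ⟨hy, hxU⟩, ?_⟩
    obtain ⟨m, hm⟩ := tw_gen_surjective hb inf_le_right (res h1 z)
    rw [← apf_res _ h1, ← ap_res, ← hm, hα hst, hρ, ht.zero, map_zero, LinearMap.zero_apply]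
  · obtain ⟨U, hxU, b, a, t, hb, ha, ht, hst⟩ := key x
    have h1 : V ⊓ U ≤ V := inf_le_left
    obtain ⟨m, hm⟩ := tw_gen_surjective (hb.tw ha) inf_le_right (res h1 z)
    have h2 := congrArg (res (preimage_le h1)) hz
    rw [map_zero, ← apf_res _ h1, ← hm, hρ] at h2
    have h3 := tw_gen_injective (hb.pu.tw ha.pu) _ h2
    obtain ⟨W, hW, hxW, m', hm'⟩ := ht.exact _ inf_le_right m h3 x ⟨hx, hxU⟩
    refine ⟨W, hW.trans h1, hxW, tw M B W m' (res (hW.trans (inf_le_right : V ⊓ U ≤ U)) b), ?_⟩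
    rw [hα hst (hW.trans inf_le_right), hm', ← res_res h1 hW, ← hm]
    simp only [res_tw, res_res]
  · obtain ⟨U, hxU, b, a, t, hb, ha, ht, hst⟩ := key (i y)
    have h1 : V ⊓ U ≤ V := inf_le_left
    obtain ⟨m, hm⟩ := tw_gen_surjective (hb.pu.tw ha.pu) (preimage_le inf_le_right)
      (res (preimage_le h1) σ)
    obtain ⟨W, hW, hyW, z, hz⟩ := ht.surj (V ⊓ U) inf_le_right m y ⟨hy, hxU⟩
    refine ⟨W, hW.trans h1, hyW, tw M _ W z (res (hW.trans (inf_le_right : V ⊓ U ≤ U)) (tw B A U b a)), ?_⟩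
    rw [hρ (hW.trans inf_le_right), hz, ← res_res (preimage_le h1) (preimage_le hW), ← hm]
    simp only [res_tw, res_res]

end Sequence

end
end SyzygyWeight

/-! ### The restriction of a kernel bundle to the divisor. -/

namespace SyzygyWeight
noncomputable section

/-! ### Local generators of a globally generated invertible sheaf -/

section Generator

variable {X : Scheme.{0}} {M L : X.Modules} {U V : X.Opens}

lemma IsGen.of_smul_isUnit {b b' : Sec (pm M) U} (hb : IsGen b) {c : Γ(X, U)} (hc : IsUnit c)
    (h : c • b = b') : IsGen b' := by
  subst h
  intro V h
  have hc' : IsUnit (rres h c) := hc.map _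
  have : (fun a : Γ(X, V) ↦ a • SyzygyWeight.res h (c • b)) =
      (fun a ↦ a • SyzygyWeight.res h b) ∘ fun a ↦ a * rres h c := by
    funext a
    rw [res_smul, smul_smul]
    rfl
  rw [this]
  exact (hb V h).comp ⟨hc'.mul_left_injective, fun a ↦ by
    obtain ⟨u, hu⟩ := hc'
    exact ⟨a * ↑u⁻¹, by simp [← hu, mul_assoc]⟩⟩

/-- In the local ring at x, a sum of non-units is a non-unit. -/
lemma exists_isUnit_rres {ι : Type} (F : Finset ι) (g : ι → Γ(X, U)) (hg : ∑ a ∈ F, g a = 1)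
    (x : X) (hx : x ∈ U) : ∃ a, ∃ (V : X.Opens) (h : V ≤ U), x ∈ V ∧ IsUnit (rres h (g a)) := by
  have h1 : ∃ a ∈ F, IsUnit (X.presheaf.germ U x hx (g a)) := by
    by_contra! h
    have h2 : X.presheaf.germ U x hx (∑ a ∈ F, g a) ∈
        IsLocalRing.maximalIdeal (X.presheaf.stalk x) := by
      rw [map_sum]
      exact sum_mem fun a ha ↦ (IsLocalRing.mem_maximalIdeal _).2 (h a ha)
    rw [hg, map_one] at h2
    exact (IsLocalRing.mem_maximalIdeal _).1 h2 isUnit_one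
  obtain ⟨a, -, ha⟩ := h1
  exact ⟨a, X.basicOpen (g a), X.basicOpen_le _, (X.mem_basicOpen _ _ hx).2 ha,
    RingedSpace.isUnit_res_basicOpen _ _⟩

variable (f : X ⟶ Spec (CommRingCat.of ℂ)) {E : ModuleCat.{0} ℂ}
  (φ : E ⟶ (globalSections f).obj L) {ι : Type}

/-- A local generator of L is a combination of basis sections, each of which is a multiple of the
generator. The resulting identity ∑ g_a c_a = 1 makes some c_a invertible near x, and that basis
section then generates. -/
lemma exists_isGen_gs (hL : IsInvertible L) [Epi (evalMap f φ)] (b : Module.Basis ι ℂ E) (x : X) :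
    ∃ (U : X.Opens) (_ : x ∈ U) (a₀ : ι), IsGen (gs f L U (φ (b a₀))) := by
  obtain ⟨U, hx, l, hl⟩ := exists_isGen hL x
  obtain ⟨V, hV, hxV, s, hs⟩ := locally_surjective_of_epi (evalMap f φ) l x hx
  obtain ⟨W, hW, hxW, hmem⟩ := locally_mem_span_cst f b s x hxV
  obtain ⟨g, hg⟩ := Finsupp.mem_span_range_iff_exists_finsupp.1 hmem
  have hWU := hW.trans hV
  choose c hc using fun a ↦ (hl.exists_smul hWU (gs f L W (φ (b a))))
  have h1 : ∑ a ∈ g.support, g a * c a = 1 := by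
    apply (hl W hWU).1
    beta_reduce
    have := congrArg (sap (evalMap f φ) W) hg
    rw [ap_res, hs, res_res, Finsupp.sum, map_sum] at this
    rw [one_smul, Finset.sum_smul]
    refine Eq.trans (Finset.sum_congr rfl fun a _ ↦ ?_) this
    rw [map_smul, sap_evalMap, mul_smul, hc]
  obtain ⟨a, W', hW', hxW', hu⟩ := exists_isUnit_rres _ _ h1 x hxW
  refine ⟨W', hxW', a, (hl.res (hW'.trans hWU)).of_smul_isUnit (c := rres hW' (c a)) ?_ ?_⟩
  · rw [map_mul] at hu
    exact isUnit_of_mul_isUnit_right hu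
  · rw [← res_gs f hW' (φ (b a)), ← hc, res_smul, res_res]

end Generator

/-! ### Restriction of kernels to a closed subscheme -/

section KernelPush

variable {X D : Scheme.{0}} {i : D ⟶ X} {M : X.Modules} {N P : D.Modules} {U : X.Opens}

/-- A morphism to a direct image factors through the direct image of a kernel. -/
def kernelPush (r : M ⟶ (Scheme.Modules.pushforward i).obj N) (ψ : N ⟶ P)
    (h : ∀ U (s : Sec (pm M) U), sap ψ _ (apf r U s) = 0) :
    M ⟶ (Scheme.Modules.pushforward i).obj (kernel ψ) :=
  restrictionMap i M ≫ (Scheme.Modules.pushforward i).map (kernel.lift ψ (pbDesc r)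
    (pullback_hom_ext fun U s ↦ by
      rw [sap_comp, sap_pbDesc, h]
      rfl))

lemma sap_ι_apf_kernelPush (r : M ⟶ (Scheme.Modules.pushforward i).obj N) (ψ : N ⟶ P)
    (h : ∀ U (s : Sec (pm M) U), sap ψ _ (apf r U s) = 0) (s : Sec (pm M) U) :
    sap (kernel.ι ψ) _ (apf (kernelPush r ψ h) U s) = apf r U s := by
  have : sap (kernel.ι ψ) _ (apf (kernelPush r ψ h) U s) =
    sap (kernel.lift ψ (pbDesc r) (pullback_hom_ext fun U s ↦ by
      rw [sap_comp, sap_pbDesc, h]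
      rfl) ≫ kernel.ι ψ) _ (pu i M U s) := rfl
  rw [this, kernel.lift_ι, sap_pbDesc]

end KernelPush

section RestrictBundle

variable {X D : Scheme.{0}} (f : X ⟶ Spec (CommRingCat.of ℂ)) (i : D ⟶ X) {L : X.Modules}
  {E : ModuleCat.{0} ℂ} (φ : E ⟶ (globalSections f).obj L) {U V : X.Opens}

/-- Global sections of a direct image. -/
def pfSections (N : D.Modules) : (globalSections (i ≫ f)).obj N ⟶
    (globalSections f).obj ((Scheme.Modules.pushforward i).obj N) :=
  (moduleSpecΓFunctor (R := CommRingCat.of ℂ)).map ((Scheme.Modules.pushforwardComp i f).inv.app N)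

lemma pf_gs {N : D.Modules} (s : (globalSections (i ≫ f)).obj N) :
    pf i U (gs f _ U (pfSections f i N s)) = gs (i ≫ f) N (i ⁻¹ᵁ U) s := rfl

lemma gs_pushforwardComp {N : D.Modules}
    (s : (globalSections f).obj ((Scheme.Modules.pushforward i).obj N)) :
    gs (i ≫ f) N (i ⁻¹ᵁ U) ((moduleSpecΓFunctor (R := CommRingCat.of ℂ)).map
      ((Scheme.Modules.pushforwardComp i f).hom.app N) s) = pf i U (gs f _ U s) := rfl

lemma gs_restrictSections (s : (globalSections f).obj L) :
    gs (i ≫ f) _ (i ⁻¹ᵁ U) (restrictSections f i L s) = pu i L U (gs f L U s) := by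
  refine (gs_pushforwardComp f i ((globalSections f).map (restrictionMap i L) s)).trans ?_
  rw [← sap_gs]
  rfl

lemma cm_cstR (c : ℂ) : cm i U (cstR f U c) = cstR (i ≫ f) (i ⁻¹ᵁ U) c :=
  cm_rres i (le_preimage_top f U) _

/-- The constant sections of a trivial bundle. -/
def cstSections (E : ModuleCat.{0} ℂ) : E ⟶ (globalSections f).obj ((trivialBundle f).obj E) :=
  (trivialBundleAdjunction f).unit.app E

/-- The restriction map between trivial bundles. -/
def trivRestrict (E : ModuleCat.{0} ℂ) : (trivialBundle f).obj E ⟶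
    (Scheme.Modules.pushforward i).obj ((trivialBundle (i ≫ f)).obj E) :=
  evalMap f (cstSections (i ≫ f) E ≫ pfSections f i _)

@[simp] lemma apf_trivRestrict (v : E) :
    apf (trivRestrict f i E) U (cst f U v) = cst (i ≫ f) (i ⁻¹ᵁ U) v := by
  have h : apf (trivRestrict f i E) U (cst f U v) =
    pf i U (sap (trivRestrict f i E) U (cst f U v)) := rfl
  rw [h, trivRestrict, sap_evalMap, ConcreteCategory.comp_apply, pf_gs]
  rfl

/-- Semilinear maps of sections of trivial bundles agree if they agree on constant sections. -/
lemma trivialBundle_apf_ext {N : D.Modules}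
    {r r' : (trivialBundle f).obj E ⟶ (Scheme.Modules.pushforward i).obj N}
    (h : ∀ v, apf r ⊤ (cst f ⊤ v) = apf r' ⊤ (cst f ⊤ v)) : r = r' :=
  trivialBundle_hom_ext f fun v ↦ (pf i ⊤).injective (h v)

lemma apf_trivRestrict_evalMap (s : Sec (pm ((trivialBundle f).obj E)) U) :
    sap (evalMap (i ≫ f) (φ ≫ restrictSections f i L)) _ (apf (trivRestrict f i E) U s) =
      pu i L U (sap (evalMap f φ) U s) := by
  have : trivRestrict f i E ≫ (Scheme.Modules.pushforward i).map
      (evalMap (i ≫ f) (φ ≫ restrictSections f i L)) = evalMap f φ ≫ restrictionMap i L := by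
    refine trivialBundle_apf_ext f i fun v ↦ ?_
    rw [apf_comp, comp_apf, apf_trivRestrict, sap_evalMap, sap_evalMap]
    exact gs_restrictSections f i (φ v)
  exact congrArg (fun g ↦ apf g U s) this

lemma trivFun_apf_trivRestrict (l : E →ₗ[ℂ] ℂ) (s : Sec (pm ((trivialBundle f).obj E)) U) :
    trivFun (i ≫ f) l _ (apf (trivRestrict f i E) U s) = cm i U (trivFun f l U s) := by
  have : trivRestrict f i E ≫ (Scheme.Modules.pushforward i).map
      (evalMap (i ≫ f) (funSections (i ≫ f) l)) =
      evalMap f (funSections f l) ≫ structureMap i := by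
    refine trivialBundle_apf_ext f i fun v ↦ ?_
    rw [apf_comp, comp_apf, apf_trivRestrict, sap_evalMap, sap_evalMap, gs_funSections,
      gs_funSections, apf_structureMap, cm_cstR]
  exact congrArg (fun g ↦ ofR.symm (apf g U s)) this

/-- The restriction map between kernel bundles. -/
def kernelRestrict : kernelBundle f φ ⟶ (Scheme.Modules.pushforward i).obj
    (kernelBundle (i ≫ f) (φ ≫ restrictSections f i L)) :=
  kernelPush (kernel.ι (evalMap f φ) ≫ trivRestrict f i E)
    (evalMap (i ≫ f) (φ ≫ restrictSections f i L)) (fun U s ↦ by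
      rw [comp_apf, apf_trivRestrict_evalMap, sap_kernel_condition, map_zero])

lemma kι_apf_kernelRestrict (s : Sec (pm (kernelBundle f φ)) U) :
    kι (i ≫ f) _ _ (apf (kernelRestrict f i φ) U s) = apf (trivRestrict f i E) U (kι f φ U s) :=
  sap_ι_apf_kernelPush _ _ _ _

/-- The relations b_a - c_a b_{a₀} restrict to the relations of the same shape on D, hence frames go
to frames; the same vector space E is used on D, with its sections restricted. -/
lemma exists_isCut_extPush [IsClosedImmersion i] (hL : IsInvertible L) [Epi (evalMap f φ)]
    {A : X.Modules} {s : structureModule X ⟶ A} {w : s ≫ restrictionMap i A = 0}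
    (hs : (ShortComplex.mk s (restrictionMap i A) w).ShortExact) (n : ℕ) (x : X) :
    ∃ U : X.Opens, x ∈ U ∧ ∀ (V : X.Opens) (_ : V ≤ U) (a : Sec (pm A) V) (t : Γ(X, V)),
      IsGen a → sap s V (ofR 1) = t • a → IsCut (extPush n (kernelRestrict f i φ)) t := by
  let b := Module.Basis.ofVectorSpace ℂ E
  obtain ⟨U, hxU, a₀, hU⟩ := exists_isGen_gs f φ hL b x
  refine ⟨U, hxU, fun V hV a t ha ht ↦ ?_⟩
  have hg : IsGen (gs f L V (φ (b a₀))) := by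
    have := hU.res hV
    rwa [res_gs] at this
  have hgD : IsGen (gs (i ≫ f) _ (i ⁻¹ᵁ V) ((φ ≫ restrictSections f i L) (b a₀))) := by
    have := hg.pu (i := i)
    rwa [← gs_restrictSections] at this
  choose c hc using fun a ↦ hg.exists_smul le_rfl (gs f L V (φ (b a)))
  simp only [res_self] at hc
  have hcD : ∀ a, cm i V (c a) • gs (i ≫ f) _ (i ⁻¹ᵁ V) ((φ ≫ restrictSections f i L) (b a₀)) =
      gs (i ≫ f) _ (i ⁻¹ᵁ V) ((φ ≫ restrictSections f i L) (b a)) := by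
    intro a
    refine (congrArg (cm i V (c a) • ·) (gs_restrictSections f i (φ (b a₀)))).trans ?_
    rw [← pu_smul, hc]
    exact (gs_restrictSections f i (φ (b a))).symm
  obtain ⟨e, he⟩ := exists_kernelBundle_family b hc
  have heD : ∀ a, kι (i ≫ f) _ _ (apf (kernelRestrict f i φ) V (e a)) =
      cst (i ≫ f) _ (b a) - cm i V (c a) • cst (i ≫ f) _ (b a₀) := by
    intro a
    rw [kι_apf_kernelRestrict, he, map_sub, apf_smul, apf_trivRestrict, apf_trivRestrict]
  classical
  -- An arbitrary order, needed to index the frame of the exterior power by increasing n-tuples.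
  let : LinearOrder {a // a ≠ a₀} := linearOrderOfSTO WellOrderingRel
  refine isCut_of_frame (isCut_structureMap hs ha ht)
    (IsFrame.extPower (kernelBundle_locallySpans b hg hc he) (kernelBundle_hasDuals b he) n) ?_
  have := IsFrame.extPower (kernelBundle_locallySpans b (c := fun a ↦ cm i V (c a)) hgD hcD heD) (kernelBundle_hasDuals b (c := fun a ↦ cm i V (c a)) heD) n
  simpa only [apf_extPush] using this

end RestrictBundle

end
end SyzygyWeight

/-! ### The determinant map and its factorization through the ideal sheaf. -/

namespace SyzygyWeight
noncomputable section

/-! ### The determinant of a trivial bundle -/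

section Determinant

variable {X : Scheme.{0}} (f : X ⟶ Spec (CommRingCat.of ℂ)) {U V : X.Opens}
  {W : ModuleCat.{0} ℂ} {n : ℕ} (b : Module.Basis (Fin n) ℂ W)

lemma cstBasis_det_apply (m : Fin n → Sec (pm ((trivialBundle f).obj W)) U) :
    (cstBasis f b U).det m = (Matrix.of fun k l ↦ trivFun f (b.coord k) U (m l)).det := rfl

lemma det_natural (h : V ≤ U) (m : Fin n → Sec (pm ((trivialBundle f).obj W)) U) :
    (ofR (X := X) (U := V)).toLinearMap.compAlternatingMap (cstBasis f b V).det
        (fun k ↦ res h (m k)) =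
      res h ((ofR (X := X) (U := U)).toLinearMap.compAlternatingMap (cstBasis f b U).det m) := by
  simp only [LinearMap.compAlternatingMap_apply, LinearEquiv.coe_coe]
  rw [res_ofR, cstBasis_det_apply, cstBasis_det_apply, RingHom.map_det]
  congr 2
  ext k l
  exact (rres_trivFun f _ h (m l)).symm

/-- The determinant `⋀ⁿ (W ⊗ 𝒪) ⟶ 𝒪`. -/
def detHom : (extPower X n).obj ((trivialBundle f).obj W) ⟶ structureModule X :=
  extDesc (fun U ↦ (ofR (X := X) (U := U)).toLinearMap.compAlternatingMap (cstBasis f b U).det)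
    (det_natural f b)

lemma sap_detHom (m : Fin n → Sec (pm ((trivialBundle f).obj W)) U) :
    sap (detHom f b) U (om n _ U m) =
      ofR (Matrix.of fun k l ↦ trivFun f (b.coord k) U (m l)).det :=
  sap_extDesc _ (det_natural f b) _

/-- The inverse of the determinant. -/
def detInv : structureModule X ⟶ (extPower X n).obj ((trivialBundle f).obj W) :=
  mkSHom (fun U ↦ (LinearMap.toSpanSingleton Γ(X, U) _ (om n _ U fun k ↦ cst f U (b k))).comp
      ofR.symm.toLinearMap)
    (fun {U V} h a ↦ by
      simp only [LinearMap.comp_apply, LinearMap.toSpanSingleton_apply, LinearEquiv.coe_coe]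
      rw [res_smul, res_om, ofR_symm_res]
      simp only [res_cst])

lemma sap_detInv (a : Γ(X, U)) :
    sap (detInv f b) U (ofR a) = a • om n _ U fun k ↦ cst f U (b k) := rfl

/-- The isomorphism `⋀ⁿ (W ⊗ 𝒪) ≅ 𝒪` given by a basis of `W`. -/
def detIso : (extPower X n).obj ((trivialBundle f).obj W) ≅ structureModule X where
  hom := detHom f b
  inv := detInv f b
  hom_inv_id := by
    refine extPower_hom_ext fun U m ↦ ?_
    rw [sap_comp, sap_detHom, sap_detInv, ← cstBasis_det_apply, sap_id]
    have : (LinearMap.toSpanSingleton Γ(X, U) _ (om n _ U fun k ↦ cst f U (b k))).compAlternatingMap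
        (cstBasis f b U).det = om n _ U := by
      refine Module.Basis.ext_alternating (cstBasis f b U) fun v hv ↦ ?_
      let σ : Equiv.Perm (Fin n) := Equiv.ofBijective v
        ((Finite.injective_iff_bijective).1 hv)
      have hσ (ω : Sec (pm ((trivialBundle f).obj W)) U [⋀^Fin n]→ₗ[Γ(X, U)]
          Sec (pm ((extPower X n).obj ((trivialBundle f).obj W))) U) :
          (ω fun k ↦ cstBasis f b U (v k)) = Equiv.Perm.sign σ • ω (cstBasis f b U) :=
        ω.map_perm _ σ
      rw [hσ, hσ]
      congr 1
      rw [LinearMap.compAlternatingMap_apply, Module.Basis.det_self,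
        LinearMap.toSpanSingleton_apply, one_smul]
      congr 1
      ext k
      exact (cstBasis_apply f b k).symm
    exact congrArg (fun ω ↦ ω m) this
  inv_hom_id := by
    refine shom_ext fun U a ↦ ?_
    obtain ⟨a, rfl⟩ := ofR.surjective a
    have h : (Matrix.of fun k l ↦ trivFun f (b.coord k) U (cst f U (b l))).det = 1 := by
      rw [← cstBasis_det_apply, ← (cstBasis f b U).det_self]
      congr 1
      ext k
      exact (cstBasis_apply f b k).symm
    rw [sap_comp, sap_detInv, map_smul, sap_detHom, h, sap_id, ← ofR_eq_smul]

variable {L : X.Modules} {E : ModuleCat.{0} ℂ} (φ : E ⟶ (globalSections f).obj L) (π : E ⟶ W)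

/-- The composite `⋀ⁿ M_E ⟶ ⋀ⁿ (W ⊗ 𝒪) ≅ 𝒪`. -/
def kernelDet : (extPower X n).obj (kernelBundle f φ) ⟶ structureModule X :=
  (extPower X n).map (kernelBundleMap f φ π) ≫ (detIso f b).hom

/-- The matrix of the images in `W ⊗ 𝒪` of sections of a kernel bundle. -/
def kernelMatrix {ι κ : Type} (b : Module.Basis ι ℂ W) (m : κ → Sec (pm (kernelBundle f φ)) U) :
    Matrix ι κ Γ(X, U) :=
  .of fun k l ↦ trivFun f (b.coord k ∘ₗ π.hom) U (kι f φ U (m l))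

lemma sap_kernelDet (m : Fin n → Sec (pm (kernelBundle f φ)) U) :
    sap (kernelDet f b φ π) U (om n _ U m) = ofR (kernelMatrix f φ π b m).det := by
  rw [kernelDet, sap_comp, sap_extPower_map]
  refine (sap_detHom f b _).trans ?_
  congr 2
  ext k l
  exact trivFun_map f π _ _

lemma map_kernelMatrix_res {ι κ : Type} (b : Module.Basis ι ℂ W)
    (m : κ → Sec (pm (kernelBundle f φ)) U) (h : V ≤ U) :
    (kernelMatrix f φ π b m).map (rres h) = kernelMatrix f φ π b fun l ↦ res h (m l) := by
  ext k l
  refine (rres_trivFun f _ h _).trans ?_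
  rw [res_kι]
  rfl

lemma map_kernelMatrix_cm {D : Scheme.{0}} (i : D ⟶ X) {ι κ : Type} (b : Module.Basis ι ℂ W)
    (m : κ → Sec (pm (kernelBundle f φ)) U) :
    (kernelMatrix f φ π b m).map (cm i U) = kernelMatrix (i ≫ f) (φ ≫ restrictSections f i L) π b
      fun l ↦ apf (kernelRestrict f i φ) U (m l) := by
  ext k l
  refine (trivFun_apf_trivRestrict f i _ _).symm.trans ?_
  rw [← kι_apf_kernelRestrict]
  rfl

end Determinant

/-! ### Existence of the map to the ideal sheaf -/

section Factorization

variable {X Z : Scheme.{0}} (f : X ⟶ Spec (CommRingCat.of ℂ)) (j : Z ⟶ X) {U V : X.Opens}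
  {W E : ModuleCat.{0} ℂ} {n : ℕ} (b : Module.Basis (Fin n) ℂ W)
  {L : X.Modules} (φ : E ⟶ (globalSections f).obj L) (π : E ⟶ W)

/-- Cramer's rule: multiply the relations by the adjugate matrix. -/
lemma det_smul_eq_zero {R M : Type} [CommRing R] [AddCommGroup M] [Module R M]
    (N : Matrix (Fin n) (Fin n) R) (y : Fin n → M) (h : ∀ l, ∑ k, N k l • y k = 0) (k : Fin n) :
    N.det • y k = 0 := by
  have h1 : ∑ l, N.adjugate l k • ∑ k', N k' l • y k' = 0 := by simp [h]
  have h2 : ∑ k', (N * N.adjugate) k' k • y k' = 0 := by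
    rw [← h1]
    simp only [Finset.smul_sum, smul_smul, Matrix.mul_apply, Finset.sum_smul]
    rw [Finset.sum_comm]
    simp only [mul_comm]
  rw [Matrix.mul_adjugate] at h2
  simpa [Matrix.smul_apply, Matrix.one_apply, ite_smul] using h2

/-- The images in W ⊗ 𝒪 of sections of M_V go to zero in L|_Z. The determinant of n such vectors
therefore kills the image of every basis vector of W, hence of all of W. Some section coming from W
generates L|_Z freely near a given point, so the determinant is zero on Z. -/
lemma kernelDet_vanishes (ψ : W ⟶ (globalSections f).obj (restrictTo j L))
    (hψ : π ≫ ψ = φ ≫ (globalSections f).map (restrictionMap j L))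
    (hgen : ∀ x : X, ∃ (U : X.Opens) (_ : x ∈ U) (v : E), IsGen (gs f L U (φ v))) :
    kernelDet f b φ π ≫ structureMap j = 0 := by
  refine extPower_hom_ext fun U m ↦ ?_
  rw [sap_comp, sap_kernelDet, sap_zero]
  refine (rres_ext (X := Z) (cm j U (kernelMatrix f φ π b m).det) 0 fun z hz ↦ ?_ : _)
  obtain ⟨U', hzU', v, hv⟩ := hgen (j z)
  have h1 : U ⊓ U' ≤ U := inf_le_left
  refine ⟨j ⁻¹ᵁ (U ⊓ U'), preimage_le h1, ⟨hz, hzU'⟩, ?_⟩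
  beta_reduce
  rw [map_zero, ← cm_rres j h1, RingHom.map_det]
  have h2 : (rres h1).mapMatrix (kernelMatrix f φ π b m) = _ := map_kernelMatrix_res f φ π b m h1
  rw [h2]
  generalize (fun l ↦ res h1 (m l)) = m'
  have hψv (v : E) : pf j (U ⊓ U') (gs f _ _ (ψ (π v))) = pu j L _ (gs f L _ (φ v)) := by
    have := congrArg (fun g ↦ pf j (U ⊓ U') (gs f _ (U ⊓ U') (g v))) hψ
    refine this.trans ?_
    refine (congrArg (pf j (U ⊓ U')) (sap_gs f (restrictionMap j L) (φ v)).symm)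
  have h3 : evalMap f φ ≫ restrictionMap j L = (trivialBundle f).map π ≫ evalMap f ψ := by
    refine trivialBundle_hom_ext f fun v ↦ ?_
    rw [sap_comp, sap_comp, sap_evalMap, sap_trivialBundle_map, sap_evalMap, sap_gs]
    exact congrArg (fun g ↦ gs f _ _ (g v)) hψ.symm
  -- Each column gives a relation among the sections `ψ (b k)` of L|_Z, since evaluating `m' l` in L
  -- already gives zero.
  have h4 : ∀ l, ∑ k, kernelMatrix f φ π b m' k l • gs f _ (U ⊓ U') (ψ (b k)) = 0 := by
    intro l
    have h5 := congrArg (fun g ↦ sap g _ (kι f φ _ (m' l))) h3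
    simp only [sap_comp] at h5
    rw [sap_evalMap_kι, map_zero,
      ← sum_trivFun_smul_cst f b (sap ((trivialBundle f).map π) _ _)] at h5
    rw [map_sum] at h5
    rw [h5]
    refine Finset.sum_congr rfl fun k _ ↦ ?_
    rw [map_smul, sap_evalMap, trivFun_map]
    rfl
  have h6 : ∀ w : W, (kernelMatrix f φ π b m').det • gs f _ (U ⊓ U') (ψ w) = 0 := by
    intro w
    have hw : w ∈ Submodule.span ℂ (Set.range b) := by rw [b.span_eq]; trivial
    induction hw using Submodule.span_induction with
    | mem s hs =>
      obtain ⟨k, rfl⟩ := hs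
      exact det_smul_eq_zero _ _ h4 k
    | zero => rw [map_zero, map_zero, smul_zero]
    | add s t _ _ hs ht => rw [map_add, map_add, smul_add, hs, ht, add_zero]
    | smul c s _ hs => rw [map_smul, gs_smul, smul_comm, hs, smul_zero]
  refine (IsGen.pu (i := j) (hv.res (inf_le_right : U ⊓ U' ≤ U'))).eq_zero ?_
  rw [res_gs, ← hψv]
  exact congrArg (pf j (U ⊓ U')) (h6 (π v))

lemma exists_factorization (ψ : W ⟶ (globalSections f).obj (restrictTo j L))
    (hψ : π ≫ ψ = φ ≫ (globalSections f).map (restrictionMap j L))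
    (hgen : ∀ x : X, ∃ (U : X.Opens) (_ : x ∈ U) (v : E), IsGen (gs f L U (φ v))) :
    ∃ σ : (extPower X n).obj (kernelBundle f φ) ⟶ idealModule j,
      σ ≫ idealModuleι j = kernelDet f b φ π :=
  ⟨kernel.lift _ _ (kernelDet_vanishes f j b φ π ψ hψ hgen), kernel.lift_ι _ _ _⟩

lemma exists_factor_linear {N : ModuleCat.{0} ℂ} [Epi π] (g : E ⟶ N) (h : ∀ v, π v = 0 → g v = 0) :
    ∃ ψ : W ⟶ N, π ≫ ψ = g := by
  have : Module.Projective ℂ W := Module.Projective.of_free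
  -- Any linear section of π will do: s(π v) - v lies in ker π, which `g` kills.
  obtain ⟨s, hs⟩ := LinearMap.exists_rightInverse_of_surjective π.hom
    (LinearMap.range_eq_top.2 ((ModuleCat.epi_iff_surjective π).1 inferInstance))
  refine ⟨ModuleCat.ofHom (g.hom ∘ₗ s), ?_⟩
  ext v
  change g.hom (s (π.hom v)) = g.hom v
  rw [← sub_eq_zero, ← map_sub]
  refine h _ ?_
  change π.hom (s (π.hom v) - v) = 0
  rw [map_sub, sub_eq_zero]
  exact LinearMap.congr_fun hs (π.hom v)

end Factorization

end
end SyzygyWeight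

/-! ### Change of trivialization, and wedging with lifts of a basis of W'. -/

namespace SyzygyWeight
noncomputable section

/-! ### Automorphisms of the structure sheaf and ideals -/

section IdealAut

variable {Y Z : Scheme.{0}} {j : Z ⟶ Y} {U : Y.Opens}

lemma cm_idealModuleι (s : Sec (pm (idealModule j)) U) :
    cm j U (ofR.symm (sap (idealModuleι j) U s)) = 0 :=
  congrArg ofR.symm (sap_kernel_condition (structureMap j) s)

/-- An endomorphism of 𝒪 is multiplication by a function, so it preserves every ideal. This absorbs
the choice of trivialization in `CarriesWeight`. -/
lemma idealModule_comp_vanishes (u : structureModule Y ⟶ structureModule Y) :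
    (idealModuleι j ≫ u) ≫ structureMap j = 0 := by
  refine shom_ext fun U s ↦ ?_
  rw [sap_comp, sap_comp, sap_zero]
  have h := cm_idealModuleι s
  obtain ⟨a, ha⟩ := ofR.surjective (sap (idealModuleι j) U s)
  rw [← ha, LinearEquiv.symm_apply_apply] at h
  rw [← ha, ofR_eq_smul, map_smul]
  refine (apf_smul (structureMap j) a _).trans ?_
  rw [h, zero_smul]
  rfl

/-- The restriction of an endomorphism of the structure sheaf to an ideal sheaf. -/
def idealMap (j : Z ⟶ Y) (u : structureModule Y ⟶ structureModule Y) :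
    idealModule j ⟶ idealModule j :=
  kernel.lift _ _ (idealModule_comp_vanishes u)

lemma idealMap_comp_ι (u : structureModule Y ⟶ structureModule Y) :
    idealMap j u ≫ idealModuleι j = idealModuleι j ≫ u :=
  kernel.lift_ι _ _ _

instance : Mono (idealModuleι j) := inferInstanceAs (Mono (kernel.ι _))

/-- The restriction of an automorphism of the structure sheaf to an ideal sheaf. -/
def idealIso (j : Z ⟶ Y) (u : structureModule Y ≅ structureModule Y) :
    idealModule j ≅ idealModule j where
  hom := idealMap j u.hom
  inv := idealMap j u.inv
  hom_inv_id := by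
    rw [← cancel_mono (idealModuleι j), Category.assoc, idealMap_comp_ι, ← Category.assoc,
      idealMap_comp_ι, Category.assoc, u.hom_inv_id, Category.comp_id, Category.id_comp]
  inv_hom_id := by
    rw [← cancel_mono (idealModuleι j), Category.assoc, idealMap_comp_ι, ← Category.assoc,
      idealMap_comp_ι, Category.assoc, u.inv_hom_id, Category.comp_id, Category.id_comp]

end IdealAut

/-! ### Passage from `⋀ M_{V̄}` to `⋀ M_V` on the divisor -/

section Wedge

variable {Y : Scheme.{0}} (g : Y ⟶ Spec (CommRingCat.of ℂ)) {N : Y.Modules}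
  {E F : ModuleCat.{0} ℂ} {φ : E ⟶ (globalSections g).obj N} {ψ : F ⟶ (globalSections g).obj N}
  {U V : Y.Opens} {k l n : ℕ}

/-- The map of kernel bundles induced by a linear map compatible with the evaluation maps. -/
def kernelBundleLift (s : F ⟶ E) (hs : s ≫ φ = ψ) : kernelBundle g ψ ⟶ kernelBundle g φ :=
  kernel.lift _ (kernel.ι (evalMap g ψ) ≫ (trivialBundle g).map s) (by
    have : (trivialBundle g).map s ≫ evalMap g φ = evalMap g ψ := by
      refine trivialBundle_hom_ext g fun v ↦ ?_
      rw [sap_comp, sap_trivialBundle_map, sap_evalMap, sap_evalMap, ← hs]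
      rfl
    exact (Category.assoc _ _ _).trans ((congrArg _ this).trans (kernel.condition _)))

lemma kι_kernelBundleLift (s : F ⟶ E) (hs : s ≫ φ = ψ) (m : Sec (pm (kernelBundle g ψ)) U) :
    kι g φ U (sap (kernelBundleLift g s hs) U m) = sap ((trivialBundle g).map s) U (kι g ψ U m) := by
  have : kernelBundleLift g s hs ≫ kernel.ι (evalMap g φ) = _ := kernel.lift_ι _ _ _
  exact congrArg (fun h ↦ sap h U m) this

variable (φ) in
/-- The wedge product with a fixed family of sections of a kernel bundle given by
linear relations. -/
lemma exists_cst_kernelBundle (v : E) (hv : φ v = 0) :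
    ∃ s : ∀ U, Sec (pm (kernelBundle g φ)) U, ∀ U, kι g φ U (s U) = cst g U v := by
  have (U : Y.Opens) : ∃ s : Sec (pm (kernelBundle g φ)) U, kι g φ U s = cst g U v :=
    exists_of_kernel _ _ (by rw [sap_evalMap, hv, map_zero])
  choose s hs using this
  exact ⟨s, hs⟩

/-- The alternating map `m ↦ v ∧ m`. -/
def wedgeAlt (M : Y.Modules) {P : Y.Modules} (r : P ⟶ M) (e : Fin k ⊕ Fin l ≃ Fin n)
    (v : ∀ U, Fin k → Sec (pm M) U) (U : Y.Opens) :
    (Sec (pm P) U) [⋀^Fin l]→ₗ[Γ(Y, U)] Sec (pm ((extPower Y n).obj M)) U where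
  toFun m := om n M U (Sum.elim (v U) (fun a ↦ sap r U (m a)) ∘ e.symm)
  map_update_add' := by
    intro _ m a x y
    have h (z : Sec (pm P) U) : (Sum.elim (v U) (fun c ↦ sap r U (Function.update m a z c)) ∘ e.symm)
        = Function.update (Sum.elim (v U) (fun c ↦ sap r U (m c)) ∘ e.symm) (e (.inr a))
          (sap r U z) := by
      ext c
      obtain ⟨c, rfl⟩ := e.surjective c
      rcases c with c | c
      · simp [Function.update_apply]
      · by_cases hc : c = a
        · subst hc; simp
        · simp [Function.update_apply, hc]
    rw [h, h, h, map_add, AlternatingMap.map_update_add]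
  map_update_smul' := by
    intro _ m a t x
    have h (z : Sec (pm P) U) : (Sum.elim (v U) (fun c ↦ sap r U (Function.update m a z c)) ∘ e.symm)
        = Function.update (Sum.elim (v U) (fun c ↦ sap r U (m c)) ∘ e.symm) (e (.inr a))
          (sap r U z) := by
      ext c
      obtain ⟨c, rfl⟩ := e.surjective c
      rcases c with c | c
      · simp [Function.update_apply]
      · by_cases hc : c = a
        · subst hc; simp
        · simp [Function.update_apply, hc]
    rw [h, h, map_smul, AlternatingMap.map_update_smul]
  map_eq_zero_of_eq' := by
    intro m a c h hac
    refine AlternatingMap.map_eq_zero_of_eq (om n M U) _ (i := e (.inr a)) (j := e (.inr c)) ?_ ?_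
    · simp [h]
    · simpa using hac

lemma wedgeAlt_apply (M : Y.Modules) {P : Y.Modules} (r : P ⟶ M) (e : Fin k ⊕ Fin l ≃ Fin n)
    (v : ∀ U, Fin k → Sec (pm M) U) (U : Y.Opens) (m : Fin l → Sec (pm P) U) :
    wedgeAlt M r e v U m = om n M U (Sum.elim (v U) (fun a ↦ sap r U (m a)) ∘ e.symm) :=
  rfl

lemma wedgeAlt_natural (M : Y.Modules) {P : Y.Modules} (r : P ⟶ M) (e : Fin k ⊕ Fin l ≃ Fin n)
    (v : ∀ U, Fin k → Sec (pm M) U) (hv : ∀ {U V} (h : V ≤ U) a, res h (v U a) = v V a)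
    (h : V ≤ U) (m : Fin l → Sec (pm P) U) :
    wedgeAlt M r e v V (fun a ↦ res h (m a)) = res h (wedgeAlt M r e v U m) := by
  rw [wedgeAlt_apply, wedgeAlt_apply, res_om]
  congr 1
  ext c
  obtain ⟨c, rfl⟩ := e.surjective c
  rcases c with c | c
  · simp [hv]
  · simp [ap_res]

/-- The map `m ↦ v ∧ m`. -/
def wedge (M : Y.Modules) {P : Y.Modules} (r : P ⟶ M) (e : Fin k ⊕ Fin l ≃ Fin n)
    (v : ∀ U, Fin k → Sec (pm M) U) (hv : ∀ {U V} (h : V ≤ U) a, res h (v U a) = v V a) :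
    (extPower Y l).obj P ⟶ (extPower Y n).obj M :=
  extDesc (wedgeAlt M r e v) (wedgeAlt_natural M r e v hv)

lemma sap_wedge (M : Y.Modules) {P : Y.Modules} (r : P ⟶ M) (e : Fin k ⊕ Fin l ≃ Fin n)
    (v : ∀ U, Fin k → Sec (pm M) U) (hv : ∀ {U V} (h : V ≤ U) a, res h (v U a) = v V a)
    (m : Fin l → Sec (pm P) U) :
    sap (wedge M r e v hv) U (om l P U m) =
      om n M U (Sum.elim (v U) (fun a ↦ sap r U (m a)) ∘ e.symm) :=
  sap_extDesc _ (wedgeAlt_natural M r e v hv) m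

/-- Wedging with sections of `M_V` that give a basis of `W' ⊆ W` turns the determinant
of `W` into that of `W / W'`. -/
lemma exists_wedge {W : ModuleCat.{0} ℂ} (W' : Submodule ℂ W) (π : E ⟶ W)
    (p : F ⟶ ModuleCat.of ℂ (W ⧸ W')) (s : F ⟶ E) (hs : s ≫ φ = ψ)
    (hp : ∀ x, p x = W'.mkQ (π (s x)))
    (hW' : ∀ w ∈ W', ∃ v, φ v = 0 ∧ π v = w)
    (b' : Module.Basis (Fin k) ℂ W') (c : Module.Basis (Fin l) ℂ (ModuleCat.of ℂ (W ⧸ W')))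
    (e : Fin k ⊕ Fin l ≃ Fin n) :
    ∃ ω : (extPower Y l).obj (kernelBundle g ψ) ⟶ (extPower Y n).obj (kernelBundle g φ),
      ω ≫ kernelDet g ((b'.sumQuot c).reindex e) φ π = kernelDet g c ψ p := by
  -- The lifts `v a` have zero image under φ, so their constant sections lie in the kernel bundle;
  -- these are the vectors to wedge with.
  choose v hv0 hv1 using fun a ↦ hW' (b' a) (b' a).2
  choose t ht using fun a ↦ exists_cst_kernelBundle g φ (v a) (hv0 a)
  refine ⟨wedge _ (kernelBundleLift g s hs) e (fun U a ↦ t a U) (fun {U V} h a ↦ ?_), ?_⟩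
  · apply kι_injective g φ
    rw [← res_kι, ht, ht, res_cst]
  · refine extPower_hom_ext fun U m ↦ ?_
    rw [sap_comp, sap_wedge, sap_kernelDet, sap_kernelDet]
    congr 1
    rw [← Matrix.det_submatrix_equiv_self e]
    -- In a basis of W adapted to W', the matrix is block upper triangular. The lifts give the
    -- columns (1, 0), and the lower right block is the matrix for W / W', so the two determinants
    -- agree.
    have : (kernelMatrix g φ π ((b'.sumQuot c).reindex e) (Sum.elim (fun a ↦ t a U)
        (fun a ↦ sap (kernelBundleLift g s hs) U (m a)) ∘ e.symm)).submatrix e e =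
        Matrix.fromBlocks 1 (.of fun a a' ↦ trivFun g ((b'.sumQuot c).coord (.inl a) ∘ₗ π.hom) U
            (kι g φ U (sap (kernelBundleLift g s hs) U (m a'))))
          0 (kernelMatrix g ψ p c m) := by
      ext a a'
      have hcoord (a) : ((b'.sumQuot c).reindex e).coord (e a) = (b'.sumQuot c).coord a := by
        ext w
        simp
      simp only [Matrix.submatrix_apply, kernelMatrix, Matrix.of_apply, hcoord,
        Function.comp_apply, Equiv.symm_apply_apply]
      have hv1' (a : Fin k) : π.hom (v a) = b' a := hv1 a
      rcases a with a | a <;> rcases a' with a' | a'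
      · simp only [Sum.elim_inl, ht, trivFun_cst, Matrix.fromBlocks_apply₁₁, LinearMap.comp_apply,
          hv1', Module.Basis.coord_apply, Module.Basis.sumQuot_repr_left, Matrix.one_apply,
          Finsupp.single_apply, Sum.inl.injEq, apply_ite (cstR g U), map_one, map_zero,
          eq_comm (a := a')]
      · simp
      · simp [ht, hv1']
      · simp only [Sum.elim_inr, Matrix.fromBlocks_apply₂₂, Matrix.of_apply, kι_kernelBundleLift,
          trivFun_map]
        congr 2
        ext x
        refine ((b'.sumQuot_repr_inr c (π.hom (s.hom x)) a)).trans ?_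
        exact congrArg (fun y ↦ c.repr y a) (hp x).symm
    rw [this, Matrix.det_fromBlocks_zero₂₁, Matrix.det_one, one_mul]

end Wedge

end
end SyzygyWeight

/-! ### Compatibility of the determinant maps on X and on the divisor. -/

namespace SyzygyWeight
noncomputable section

/-! ### Commutative squares of schemes -/

section Square

variable {X Z D P : Scheme.{0}} {j : Z ⟶ X} {i : D ⟶ X} {p : P ⟶ Z} {q : P ⟶ D}
  {M : X.Modules} {U : X.Opens}

lemma rres_cm_eq {f g : P ⟶ X} (h : f = g) (a : Γ(X, U)) :
    rres (by rw [h]) (cm g U a) = cm f U a := by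
  subst h
  exact rres_self _ _

lemma preimage_eq_of_comm (hsq : p ≫ j = q ≫ i) (U : X.Opens) :
    p ⁻¹ᵁ j ⁻¹ᵁ U = q ⁻¹ᵁ i ⁻¹ᵁ U :=
  congrArg (fun f : P ⟶ X ↦ f ⁻¹ᵁ U) hsq

lemma rres_cm_comm (hsq : p ≫ j = q ≫ i) (a : Γ(X, U)) :
    rres (preimage_eq_of_comm hsq U).le (cm q _ (cm i U a)) = cm p _ (cm j U a) :=
  rres_cm_eq hsq a

lemma cm_eq_zero_of_comm (hsq : p ≫ j = q ≫ i) {a : Γ(X, U)} (h : cm j U a = 0) :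
    cm q _ (cm i U a) = 0 := by
  have := rres_cm_comm hsq.symm (i := j) (q := p) a
  rw [← this, h, map_zero, map_zero]

lemma pu_eq_zero_of_comm (hsq : p ≫ j = q ≫ i) {s : Sec (pm M) U} (h : pu j M U s = 0) :
    pu q _ _ (pu i M U s) = 0 := by
  -- Restriction to P by way of D, regarded as a map to j_* of a sheaf on Z. By adjunction it
  -- factors through restriction to Z.
  let r : M ⟶ (Scheme.Modules.pushforward j).obj ((Scheme.Modules.pushforward p).obj
      ((Scheme.Modules.pullback q).obj ((Scheme.Modules.pullback i).obj M))) :=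
    mkPf j (fun U ↦ (pf p _).symm.toAddMonoidHom.comp
        ((res (preimage_eq_of_comm hsq U).le).comp ((pu q _ _).comp (pu i M U))))
      (fun U a s ↦ by
        apply (pf p _).injective
        rw [pf_smul]
        change res _ (pu q _ _ (pu i M U (a • s))) = cm p _ (cm j U a) • res _ (pu q _ _ (pu i M U s))
        rw [pu_smul, pu_smul, res_smul, rres_cm_comm hsq])
      (fun {U V} h s ↦ by
        apply (pf p _).injective
        rw [pf_res]
        change res _ (pu q _ _ (pu i M V (res h s))) = res _ (res _ (pu q _ _ (pu i M U s)))
        rw [pu_res, pu_res, res_res, res_res])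
  have h1 : (pf p _) (apf r U s) = 0 := by rw [← sap_pbDesc, h, map_zero, map_zero]
  have h2 : res (preimage_eq_of_comm hsq U).le (pu q _ _ (pu i M U s)) = 0 := h1
  have h3 := congrArg (res (preimage_eq_of_comm hsq U).ge) h2
  rwa [res_res, res_self, map_zero] at h3

end Square

/-! ### The determinant on the divisor -/

section DivisorDet

variable {X Z D P : Scheme.{0}} (f : X ⟶ Spec (CommRingCat.of ℂ)) {j : Z ⟶ X} {i : D ⟶ X}
  {p : P ⟶ Z} {q : P ⟶ D} {L : X.Modules} {E W : ModuleCat.{0} ℂ}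
  (φ : E ⟶ (globalSections f).obj L) (π : E ⟶ W) {n : ℕ} (b : Module.Basis (Fin n) ℂ W)

/-- Sections in ker π vanish on Z, hence on P, so restriction to P descends to W. This provides the
input of `exists_factorization` on D, with the undivided space W. -/
lemma exists_divisor_sections [Epi π] (hsq : p ≫ j = q ≫ i)
    (ψ : W ⟶ (globalSections f).obj (restrictTo j L))
    (hψ : π ≫ ψ = φ ≫ (globalSections f).map (restrictionMap j L)) :
    ∃ ψ' : W ⟶ (globalSections (i ≫ f)).obj (restrictTo q ((Scheme.Modules.pullback i).obj L)),
      π ≫ ψ' = (φ ≫ restrictSections f i L) ≫ (globalSections (i ≫ f)).map (restrictionMap q _) := by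
  refine exists_factor_linear π _ fun v hv ↦ ?_
  have h1 : (globalSections f).map (restrictionMap j L) (φ v) = 0 := by
    have := congrArg (fun g ↦ g v) hψ
    refine this.symm.trans ?_
    change ψ (π v) = 0
    rw [hv, map_zero]
  have h2 : pu j L ⊤ (gs f L ⊤ (φ v)) = 0 := by
    have : sap (restrictionMap j L) ⊤ (gs f L ⊤ (φ v)) = 0 := by rw [sap_gs, h1, map_zero]
    exact this
  have h3 := pu_eq_zero_of_comm hsq h2
  apply gs_injective (i ≫ f)
  rw [map_zero]
  change gs (i ≫ f) _ ⊤ ((globalSections (i ≫ f)).map (restrictionMap q _)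
    (restrictSections f i L (φ v))) = 0
  rw [← sap_gs]
  have h4 := gs_restrictSections f i (U := ⊤) (φ v)
  rw [← h4] at h3
  exact h3

lemma exists_isGen_restrict (hgen : ∀ x : X, ∃ (U : X.Opens) (_ : x ∈ U) (v : E),
    IsGen (gs f L U (φ v))) (y : D) : ∃ (U : D.Opens) (_ : y ∈ U) (v : E),
      IsGen (gs (i ≫ f) _ U ((φ ≫ restrictSections f i L) v)) := by
  obtain ⟨U, hU, v, hv⟩ := hgen (i y)
  refine ⟨i ⁻¹ᵁ U, hU, v, ?_⟩
  have := gs_restrictSections f i (U := U) (φ v)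
  change IsGen (gs (i ≫ f) _ (i ⁻¹ᵁ U) (restrictSections f i L (φ v)))
  rw [this]
  exact hv.pu

/-- The restriction map `I_Z ⟶ i_* I_P` of a commutative square. -/
def idealRestrict (hsq : p ≫ j = q ≫ i) :
    idealModule j ⟶ (Scheme.Modules.pushforward i).obj (idealModule q) :=
  kernelPush (idealModuleι j ≫ structureMap i) (structureMap q) fun _ s ↦
    congrArg ofR (cm_eq_zero_of_comm hsq (cm_idealModuleι s))

lemma sap_ι_apf_idealRestrict (hsq : p ≫ j = q ≫ i) {U : X.Opens} (s : Sec (pm (idealModule j)) U) :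
    sap (idealModuleι q) _ (apf (idealRestrict hsq) U s) =
      ofR (cm i U (ofR.symm (sap (idealModuleι j) U s))) :=
  sap_ι_apf_kernelPush _ _ _ _

/-- On a wedge product, both sides are the restriction to D of the same determinant; the shared
basis `b` makes the trivializations on X and D compatible. -/
lemma comp_idealRestrict (hsq : p ≫ j = q ≫ i)
    (σ : (extPower X n).obj (kernelBundle f φ) ⟶ idealModule j)
    (hσ : σ ≫ idealModuleι j = kernelDet f b φ π)
    (σ' : (extPower D n).obj (kernelBundle (i ≫ f) (φ ≫ restrictSections f i L)) ⟶ idealModule q)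
    (hσ' : σ' ≫ idealModuleι q = kernelDet (i ≫ f) b (φ ≫ restrictSections f i L) π) :
    σ ≫ idealRestrict hsq =
      extPush n (kernelRestrict f i φ) ≫ (Scheme.Modules.pushforward i).map σ' := by
  refine extPower_hom_ext fun U m ↦ (pf i U).injective (sap_injective (idealModuleι q) ?_)
  have h1 := sap_ι_apf_idealRestrict hsq (sap σ U (om n _ U m))
  rw [← sap_comp, hσ, sap_kernelDet, LinearEquiv.symm_apply_apply, RingHom.map_det,
    RingHom.mapMatrix_apply, map_kernelMatrix_cm] at h1
  refine h1.trans ?_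
  rw [← sap_kernelDet, ← hσ', sap_comp, ← apf_extPush]
  rfl

end DivisorDet

end
end SyzygyWeight

/-! ### Sections that vanish on a divisor, and functions that vanish on an intersection. -/

namespace SyzygyWeight
noncomputable section

/-! ### Kernels of restriction maps to a closed subscheme -/

section Algebra

/-- T is the base change M / (ker φ)M. Applied to stalks, it supplies the values of a skyscraper
sheaf on D. -/
lemma exists_module_along_surjective {R A : Type} [CommRing R] [CommRing A] (φ : R →+* A)
    (hφ : Function.Surjective φ) (M : Type) [AddCommGroup M] [Module R M] :
    ∃ (T : Type) (_ : AddCommGroup T) (_ : Module A T) (θ : M →+ T),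
      (∀ r m, θ (r • m) = φ r • θ m) ∧
        ∀ m, θ m = 0 → m ∈ RingHom.ker φ • (⊤ : Submodule R M) := by
  let e := RingHom.quotientKerEquivOfSurjective hφ
  let T := M ⧸ (RingHom.ker φ • (⊤ : Submodule R M))
  let inst : Module A T := Module.compHom T e.symm.toRingHom
  refine ⟨T, inferInstance, inst, (Submodule.mkQ _).toAddMonoidHom, fun r m ↦ ?_, fun m hm ↦ ?_⟩
  · change Submodule.Quotient.mk (r • m) = e.symm (φ r) • (Submodule.Quotient.mk m : T)
    have : e.symm (φ r) = Ideal.Quotient.mk _ r := by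
      rw [RingEquiv.symm_apply_eq]
      rfl
    rw [this]
    rfl
  · exact (Submodule.Quotient.mk_eq_zero _).1 hm

end Algebra

section Skyscraper

variable {Y : Scheme.{0}} (y : Y) (T : Type) [AddCommGroup T] [Module (Y.presheaf.stalk y) T]

/-- The sections of the skyscraper presheaf. -/
def SkySec (U : Y.Opens) : Type := PLift (y ∈ U) → T

instance (U : Y.Opens) : AddCommGroup (SkySec y T U) := inferInstanceAs (AddCommGroup (PLift (y ∈ U) → T))

instance (U : Y.Opens) : Module Γ(Y, U) (SkySec y T U) where
  smul a s := fun h ↦ Y.presheaf.germ U y h.down a • s h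
  one_smul s := funext fun h ↦ by
    change Y.presheaf.germ U y h.down 1 • s h = s h
    rw [map_one, one_smul]
  mul_smul a b s := funext fun h ↦ by
    change Y.presheaf.germ U y h.down (a * b) • s h = Y.presheaf.germ U y h.down a • Y.presheaf.germ U y h.down b • s h
    rw [map_mul, mul_smul]
  smul_zero a := funext fun h ↦ smul_zero (Y.presheaf.germ U y h.down a)
  smul_add a s t := funext fun h ↦ smul_add (Y.presheaf.germ U y h.down a) (s h) (t h)
  add_smul a b s := funext fun h ↦ by
    change Y.presheaf.germ U y h.down (a + b) • s h = Y.presheaf.germ U y h.down a • s h + Y.presheaf.germ U y h.down b • s h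
    rw [map_add, add_smul]
  zero_smul s := funext fun h ↦ by
    change Y.presheaf.germ U y h.down 0 • s h = 0
    rw [map_zero, zero_smul]

lemma germ_rres {U V : Y.Opens} (h : V ≤ U) (hy : y ∈ V) (a : Γ(Y, U)) :
    Y.presheaf.germ V y hy (rres h a) = Y.presheaf.germ U y (h hy) a :=
  TopCat.Presheaf.germ_res_apply _ _ _ _ _

/-- The skyscraper presheaf. -/
def skyPre : Y.PresheafOfModules :=
  mkPre (SkySec y T) (fun {U V} h ↦ AddMonoidHom.mk' (fun (s : SkySec y T U) (h' : PLift (y ∈ V)) ↦ s ⟨h h'.down⟩)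
      (fun _ _ ↦ rfl))
    (fun _ ↦ rfl) (fun _ _ _ ↦ rfl) (fun {U V} h a s ↦ funext fun h' ↦ by
      change Y.presheaf.germ U y _ a • s _ = Y.presheaf.germ V y h'.down (rres h a) • s _
      rw [germ_rres])

/-- The sections of the skyscraper presheaf. -/
def skyE (U : Y.Opens) : SkySec y T U ≃ₗ[Γ(Y, U)] Sec (skyPre y T) U where
  toFun s := s
  invFun s := s
  map_add' _ _ := rfl
  map_smul' _ _ := rfl
  left_inv _ := rfl
  right_inv _ := rfl

end Skyscraper

section Stalk

variable {X D : Scheme.{0}} {i : D ⟶ X} {M : X.Modules} {U V : X.Opens}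

/-- The stalk of a sheaf of modules. -/
def Stk (M : X.Modules) (x : X) : Type := TopCat.Presheaf.stalk (C := Ab) (pm M).presheaf x

instance (x : X) : AddCommGroup (Stk M x) :=
  inferInstanceAs (AddCommGroup (TopCat.Presheaf.stalk (C := Ab) (pm M).presheaf x))

instance (x : X) : Module (X.presheaf.stalk x) (Stk M x) :=
  PresheafOfModules.instModuleCarrierStalkCommRingCatCarrierAbPresheafOpensCarrier
    (R := X.presheaf) (pm M) x

/-- The germ of a section. -/
def sgerm (x : X) (hx : x ∈ U) : Sec (pm M) U →+ Stk M x :=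
  (TopCat.Presheaf.germ (pm M).presheaf U x hx).hom

lemma sgerm_smul (x : X) (hx : x ∈ U) (a : Γ(X, U)) (s : Sec (pm M) U) :
    sgerm x hx (a • s) = X.presheaf.germ U x hx a • sgerm x hx s :=
  PresheafOfModules.germ_smul (R := X.presheaf) (pm M) x U hx a s

lemma sgerm_res (x : X) (h : V ≤ U) (hx : x ∈ V) (s : Sec (pm M) U) :
    sgerm x hx (res h s) = sgerm x (h hx) s :=
  TopCat.Presheaf.germ_res_apply (pm M).presheaf (homOfLE h) x hx s

lemma exists_sgerm (x : X) (m : Stk M x) : ∃ (U : X.Opens) (hx : x ∈ U) (s : Sec (pm M) U),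
    sgerm x hx s = m :=
  TopCat.Presheaf.exists_germ_eq (pm M).presheaf m

lemma exists_res_eq_of_sgerm_eq (x : X) (hx : x ∈ U) (s t : Sec (pm M) U)
    (h : sgerm x hx s = sgerm x hx t) :
    ∃ (V : X.Opens) (hV : V ≤ U), x ∈ V ∧ res hV s = res hV t := by
  obtain ⟨W, hW, h1, h2, h3⟩ := TopCat.Presheaf.germ_eq (pm M).presheaf x hx hx s t h
  exact ⟨W, h1.le, hW, h3⟩

lemma exists_rres_eq_of_germ_eq (x : X) (hx : x ∈ U) (s t : Γ(X, U))
    (h : X.presheaf.germ U x hx s = X.presheaf.germ U x hx t) :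
    ∃ (V : X.Opens) (hV : V ≤ U), x ∈ V ∧ rres hV s = rres hV t := by
  obtain ⟨W, hW, h1, h2, h3⟩ := TopCat.Presheaf.germ_eq X.presheaf x hx hx s t h
  exact ⟨W, h1.le, hW, h3⟩

variable [IsClosedImmersion i]

lemma IsCut.exists_germ_mul {t : Γ(X, U)} (ht : IsCut (structureMap i) t) (y : D) (hy : i y ∈ U)
    (k : X.presheaf.stalk (i y)) (hk : i.stalkMap y k = 0) :
    ∃ k', X.presheaf.germ U (i y) hy t * k' = k := by
  obtain ⟨W, hW, g, rfl⟩ := X.presheaf.exists_germ_eq k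
  rw [Scheme.Hom.germ_stalkMap_apply] at hk
  obtain ⟨D', hD', hyD', h0⟩ := exists_rres_eq_of_germ_eq (U := i ⁻¹ᵁ W) y hW (cm i W g) 0
    (by rw [map_zero]; exact hk)
  obtain ⟨V, hV, hyV, hVD⟩ := exists_preimage_le hyD' (U ⊓ W) ⟨hy, hW⟩
  have hVW : V ≤ W := hV.trans inf_le_right
  have hVU : V ≤ U := hV.trans inf_le_left
  have h1 : cm i V (rres hVW g) = 0 := by
    rw [cm_rres i hVW g, ← rres_rres hD' hVD, h0, map_zero, map_zero]
  obtain ⟨g', hg'⟩ := ht.exists_mul hVU h1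
  refine ⟨X.presheaf.germ V (i y) hyV g', ?_⟩
  rw [← germ_rres (i y) hVU hyV, ← map_mul, hg', germ_rres]

/-- The kernel of M → i_*i^*M is tM, for an arbitrary sheaf of modules. At a point y of D, the map
from M to the skyscraper with fibre M_y / (I_D)_y M_y factors through i^*M, so the germ of `s` lies
in (I_D)_y M_y = t M_y. -/
lemma IsCut.exists_smul_of_pu_eq_zero {t : Γ(X, U)} (ht : IsCut (structureMap i) t)
    (s : Sec (pm M) U) (hs : pu i M U s = 0) :
    Locally U fun _ h ↦ ∃ s', rres h t • s' = res h s := by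
  intro x hx
  by_cases hxD : x ∈ Set.range i
  · obtain ⟨y, rfl⟩ := hxD
    obtain ⟨T, _, _, θ, hθ, hθ0⟩ := exists_module_along_surjective (i.stalkMap y).hom
      (i.stalkMap_surjective y) (Stk M (i y))
    obtain ⟨D', hD', hy, h0⟩ := locally_eq_zero_of_pu_eq_zero (i := i) (M := M) (P := skyPre y T)
      (fun V ↦ (skyE y T _).toAddMonoidHom.comp
        (AddMonoidHom.mk' (fun (s : Sec (pm M) V) (h : PLift (y ∈ i ⁻¹ᵁ V)) ↦ θ (sgerm (i y) h.down s))
          (fun s s' ↦ funext fun h ↦ by rw [map_add, map_add]; rfl)))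
      (fun V a s ↦ by
        refine Eq.trans (congrArg (skyE y T _) (funext fun h ↦ ?_)) (map_smul (skyE y T _) _ _)
        change θ (sgerm (i y) h.down (a • s)) =
          D.presheaf.germ (i ⁻¹ᵁ V) y h.down (cm i V a) • θ (sgerm (i y) h.down s)
        exact (congrArg θ (sgerm_smul (i y) h.down a s)).trans ((hθ _ _).trans
          (congrArg (· • _) (Scheme.Hom.germ_stalkMap_apply i V y h.down a))))
      (fun {U V} h s ↦ by
        refine congrArg (skyE y T _) (funext fun h' ↦ ?_)
        exact congrArg θ (sgerm_res (i y) h h'.down s))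
      s hs y hx
    have h1 : θ (sgerm (i y) hx s) = 0 := congrFun h0 ⟨hy⟩
    have key : ∀ m ∈ RingHom.ker (i.stalkMap y).hom • (⊤ : Submodule (X.presheaf.stalk (i y)) (Stk M (i y))),
        ∃ m', X.presheaf.germ U (i y) hx t • m' = m := by
      intro m hm
      refine Submodule.smul_induction_on hm (fun k hk n _ ↦ ?_) (fun m n hm hn ↦ ?_)
      · obtain ⟨k', rfl⟩ := ht.exists_germ_mul y hx k hk
        exact ⟨k' • n, (mul_smul _ _ _).symm⟩
      · obtain ⟨m', rfl⟩ := hm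
        obtain ⟨n', rfl⟩ := hn
        exact ⟨m' + n', smul_add _ _ _⟩
    obtain ⟨m, hm⟩ := key _ (hθ0 _ h1)
    obtain ⟨W, hW, s', rfl⟩ := exists_sgerm (i y) m
    have hUW : i y ∈ U ⊓ W := ⟨hx, hW⟩
    obtain ⟨V, hV, hyV, h2⟩ := exists_res_eq_of_sgerm_eq (U := U ⊓ W) (i y) hUW
      (rres inf_le_left t • res inf_le_right s') (res inf_le_left s) (by
        rw [sgerm_smul, sgerm_res, sgerm_res, germ_rres, hm])
    refine ⟨V, hV.trans inf_le_left, hyV, res (hV.trans inf_le_right) s', ?_⟩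
    rwa [res_smul, rres_rres, res_res, res_res] at h2
  -- Away from D even the function 1 restricts to zero on D, so t divides 1 and is invertible.
  · let V : X.Opens := ⟨(Set.range i)ᶜ, (Scheme.Hom.isClosedEmbedding i).isClosed_range.isOpen_compl⟩
    have h0 : cm i (U ⊓ V) 1 = 0 := rres_ext _ _ fun y hy ↦ (hy.2 ⟨y, rfl⟩).elim
    obtain ⟨g, hg⟩ := ht.exists_mul inf_le_left h0
    refine ⟨U ⊓ V, inf_le_left, ⟨hx, hxD⟩, g • res inf_le_left s, ?_⟩
    rw [smul_smul, hg, one_smul]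

end Stalk

/-! ### Functions vanishing on an intersection of closed subschemes -/

section Intersection

variable {X Z D : Scheme.{0}} (j : Z ⟶ X) (i : D ⟶ X) [IsClosedImmersion j] [IsClosedImmersion i]

lemma exists_ringHom_of_surjective {R A S : Type} [CommRing R] [CommRing A] [CommRing S]
    (φ : R →+* A) (hφ : Function.Surjective φ) (g : R →+* S) (h : RingHom.ker φ ≤ RingHom.ker g) :
    ∃ β : A →+* S, β.comp φ = g :=
  ⟨φ.liftOfSurjective hφ ⟨g, h⟩, φ.liftOfRightInverse_comp _ (Function.rightInverse_surjInv hφ) ⟨g, h⟩⟩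

/-- Pulling a function back along Spec S → W → X is the ring map `g`, up to the canonical
identification of global functions on Spec S with S. -/
lemma eq_zero_of_cm_fromSpec {S : CommRingCat.{0}} {W : X.Opens} (hW : IsAffineOpen W)
    (g : Γ(X, W) ⟶ S) (a : Γ(X, W)) (h : cm (Spec.map g ≫ hW.fromSpec) W a = 0) : g a = 0 := by
  have h3 : cm (Spec.map g) _ (cm hW.fromSpec W a) = 0 := h
  have h4 : cm hW.fromSpec W a = rres le_top ((Scheme.ΓSpecIso Γ(X, W)).inv.hom a) :=
    congrArg (fun k ↦ k.hom a) hW.fromSpec_app_self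
  have h5 : cm (Spec.map g) ⊤ ((Scheme.ΓSpecIso Γ(X, W)).inv.hom a) =
      (Scheme.ΓSpecIso S).inv.hom (g a) :=
    (congrArg (fun k ↦ k.hom a) (Scheme.ΓSpecIso_inv_naturality g)).symm
  rw [h4, cm_rres, h5] at h3
  have h6 := congrArg (rres (U := Spec.map g ⁻¹ᵁ hW.fromSpec ⁻¹ᵁ W) (V := ⊤)
    (by rw [hW.fromSpec_preimage_self]; exact le_rfl)) h3
  have h7 : (Scheme.ΓSpecIso S).inv.hom (g a) = 0 := by
    exact (rres_self le_rfl _).symm.trans ((rres_rres _ _ _).symm.trans (h6.trans (map_zero _)))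
  have h8 := congrArg (Scheme.ΓSpecIso S).hom.hom h7
  rw [map_zero] at h8
  exact (congrArg (fun k ↦ k.hom (g a)) (Scheme.ΓSpecIso S).inv_hom_id).symm.trans h8

lemma specMap_fromSpec_comp {Y : Scheme.{0}} (k : Y ⟶ X) [IsAffineHom k] {S : CommRingCat.{0}}
    {W : X.Opens} (hW : IsAffineOpen W) (g : Γ(X, W) ⟶ S) (β : Γ(Y, k ⁻¹ᵁ W) ⟶ S)
    (h : k.app W ≫ β = g) :
    Spec.map β ≫ (hW.preimage k).fromSpec ≫ k = Spec.map g ≫ hW.fromSpec := by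
  rw [← hW.SpecMap_appLE_fromSpec k (hW.preimage k) le_rfl, ← Category.assoc, ← Spec.map_comp,
    ← h, Scheme.Hom.appLE_eq_app]

/-- With S = Γ(W)/(I_Z + I_D), the map Spec S → X factors through both Z and D, hence through the
fibre product. A function vanishing there becomes zero in S. -/
lemma exists_add_of_cm_pullback_eq_zero {W : X.Opens} (hW : IsAffineOpen W) (a : Γ(X, W))
    (ha : cm (pullback.snd j i) _ (cm i W a) = 0) :
    ∃ c d : Γ(X, W), c + d = a ∧ cm j W c = 0 ∧ cm i W d = 0 := by
  obtain ⟨S, _, g, hg⟩ : ∃ (S : Type) (_ : CommRing S) (g : Γ(X, W) →+* S),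
      ∀ x, g x = 0 ↔ x ∈ RingHom.ker (cm j W) ⊔ RingHom.ker (cm i W) :=
    ⟨_, _, Ideal.Quotient.mk _, fun _ ↦ Ideal.Quotient.eq_zero_iff_mem⟩
  suffices h : g a = 0 by
    obtain ⟨c, hc, d, hd, h⟩ := Submodule.mem_sup.1 ((hg a).1 h)
    exact ⟨c, d, h, hc, hd⟩
  obtain ⟨α, hα⟩ := exists_ringHom_of_surjective (cm j W) (Scheme.Hom.app_surjective j W hW) g
    (fun x hx ↦ (hg x).2 (Submodule.mem_sup_left hx))
  obtain ⟨β, hβ⟩ := exists_ringHom_of_surjective (cm i W) (Scheme.Hom.app_surjective i W hW) g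
    (fun x hx ↦ (hg x).2 (Submodule.mem_sup_right hx))
  have hα' := specMap_fromSpec_comp j hW (S := .of S) (CommRingCat.ofHom g) (CommRingCat.ofHom α)
    (CommRingCat.hom_ext hα)
  have hβ' := specMap_fromSpec_comp i hW (S := .of S) (CommRingCat.ofHom g) (CommRingCat.ofHom β)
    (CommRingCat.hom_ext hβ)
  obtain ⟨l, hl⟩ : ∃ l : Spec (.of S) ⟶ pullback j i, l ≫ pullback.snd j i =
      Spec.map (CommRingCat.ofHom β) ≫ (hW.preimage i).fromSpec :=
    ⟨pullback.lift (Spec.map (CommRingCat.ofHom α) ≫ (hW.preimage j).fromSpec) _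
      (by rw [Category.assoc, Category.assoc, hα', hβ']), pullback.lift_snd _ _ _⟩
  have hl' : (l ≫ pullback.snd j i) ≫ i = Spec.map (CommRingCat.ofHom g) ≫ hW.fromSpec := by
    rw [hl, Category.assoc, hβ']
  have h1 : cm ((l ≫ pullback.snd j i) ≫ i) W a = 0 := by
    change cm l _ (cm (pullback.snd j i) _ (cm i W a)) = 0
    rw [ha, map_zero]
  refine eq_zero_of_cm_fromSpec hW (CommRingCat.ofHom g) a ?_
  rw [← rres_cm_eq hl'.symm, h1, map_zero]

end Intersection

end
end SyzygyWeight

/-! ### The restriction sequence of the ideal sheaf of Z. -/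

namespace SyzygyWeight
noncomputable section

/-! ### Restriction of ideal sheaves to a divisor -/

section IdealCut

variable {X Z D : Scheme.{0}} (f : X ⟶ Spec (CommRingCat.of ℂ)) {j : Z ⟶ X} {i : D ⟶ X}
  {L : X.Modules} {W : ModuleCat.{0} ℂ}
  [Module.Finite ℂ W] {U V : X.Opens}

lemma smul_injective_trivialBundle {t : Γ(X, U)} (ht : IsCut (structureMap i) t) (hV : V ≤ U)
    {s : Sec (pm ((trivialBundle f).obj W)) V} (h : rres hV t • s = 0) : s = 0 := by
  let b := Module.finBasis ℂ W
  apply (cstBasis f b V).repr.injective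
  ext a
  refine (ht.eq_zero hV ?_).trans (by simp)
  have := congrArg (fun s ↦ (cstBasis f b V).repr s a) h
  simpa using this

/-- If `0 ⟶ Σ ⟶ W ⊗ 𝒪 ⟶ L|_Z` stays exact on the divisor, the equation of the divisor is a
non-zero-divisor on `Z`. -/
lemma locally_cm_eq_zero_of_mul [IsClosedImmersion i] (ψ : W ⟶ (globalSections f).obj (restrictTo j L))
    [Mono ((Scheme.Modules.pullback i).map (kernel.ι (evalMap f ψ)))]
    {t : Γ(X, U)} (ht : IsCut (structureMap i) t) {w : W} {l : Sec (pm L) U} (hl : IsGen l)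
    (hw : gs f _ U (ψ w) = (pf j U).symm (pu j L U l)) (hV : V ≤ U) (c : Γ(X, V))
    (hc : cm j V (rres hV t * c) = 0) : Locally V fun V' h ↦ cm j V' (rres h c) = 0 := by
  have hwV {V : X.Opens} (hV : V ≤ U) (g : Γ(X, V)) :
      pf j V (sap (evalMap f ψ) V (g • cst f V w)) = cm j V g • pu j L V (res hV l) := by
    rw [map_smul, sap_evalMap, pf_smul, pu_res, gs_apply, ← res_res (le_preimage_top f U) hV,
      ← gs_apply, hw]
    rfl
  -- The section t·c·w of W ⊗ 𝒪 lies in Σ_W and restricts to zero in W ⊗ 𝒪_D. Injectivity of Σ_W|_D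
  -- → W ⊗ 𝒪_D then makes it t times a section τ' of Σ_W. Cancelling t puts c·w itself in Σ_W, so c
  -- vanishes on Z.
  obtain ⟨τ, hτ⟩ := exists_of_kernel (evalMap f ψ) ((rres hV t * c) • cst f V w)
    ((pf j V).injective (by rw [hwV hV, hc, zero_smul, map_zero]))
  have h1 : pu i _ V τ = 0 := by
    apply sap_injective ((Scheme.Modules.pullback i).map (kernel.ι (evalMap f ψ)))
    rw [sap_pullback_map, hτ, map_zero, mul_smul, pu_smul, cm_rres, ht.cm_eq_zero, map_zero,
      zero_smul]
  intro x hx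
  obtain ⟨V', hV', hxV', τ', hτ'⟩ := (ht.restrict hV).exists_smul_of_pu_eq_zero τ h1 x hx
  refine ⟨V', hV', hxV', ?_⟩
  have h2 : sap (kernel.ι (evalMap f ψ)) V' τ' = rres hV' c • cst f V' w := by
    rw [← sub_eq_zero]
    refine smul_injective_trivialBundle f ht (hV'.trans hV) ?_
    have h3 := congrArg (sap (kernel.ι (evalMap f ψ)) V') hτ'
    rw [map_smul, ap_res, hτ, res_smul, map_mul, res_cst, rres_rres, mul_smul] at h3
    rw [smul_sub, h3, sub_self]
  have h3 := hwV (hV'.trans hV) (rres hV' c)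
  rw [← h2, sap_kernel_condition, map_zero] at h3
  have h4 : IsGen (pu j L V' (res (hV'.trans hV) l)) := (hl.res _).pu
  exact h4.eq_zero h3.symm

/-- A function in I_Z that vanishes on D is t·g, and g lies in I_Z because t is a non-zero-divisor
on Z. A function on D that vanishes on Z ∩ D lifts to a sum of functions in I_Z and I_D, whose I_Z
part is the required lift. -/
lemma isCut_idealRestrict [IsClosedImmersion j] [IsClosedImmersion i] (ψ : W ⟶ (globalSections f).obj (restrictTo j L))
    [Mono ((Scheme.Modules.pullback i).map (kernel.ι (evalMap f ψ)))]
    {t : Γ(X, U)} (ht : IsCut (structureMap i) t) {w : W} {l : Sec (pm L) U} (hl : IsGen l)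
    (hw : gs f _ U (ψ w) = (pf j U).symm (pu j L U l)) :
    IsCut (idealRestrict (pullback.condition (f := j) (g := i))) t := by
  have hι (V : X.Opens) : Function.Injective (sap (idealModuleι j) V) := sap_injective _
  have lift {V : X.Opens} (c : Γ(X, V)) (hc : cm j V c = 0) :
      ∃ z, sap (idealModuleι j) V z = ofR c :=
    exists_of_kernel (structureMap j) (ofR c) (congrArg ofR hc)
  refine ⟨fun V h z hz ↦ ?_, fun V h z ↦ ?_, fun V h z hz ↦ ?_, fun V h s y hy ↦ ?_⟩
  · apply hι
    rw [map_zero]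
    refine ht.inj V h _ ?_
    rw [← map_smul, hz, map_zero]
  · rw [apf_smul, cm_rres, ht.cm_eq_zero, map_zero, zero_smul]
  · have h1 := sap_ι_apf_idealRestrict (pullback.condition (f := j) (g := i)) z
    rw [hz, map_zero] at h1
    obtain ⟨g, hg⟩ := ht.exists_mul h (ofR.injective (h1.symm.trans (map_zero _).symm))
    intro x hx
    obtain ⟨V', hV', hxV', hcm⟩ := locally_cm_eq_zero_of_mul f ψ ht hl hw h g
      (by rw [hg]; exact cm_idealModuleι z) x hx
    obtain ⟨z', hz'⟩ := lift _ hcm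
    refine ⟨V', hV', hxV', z', hι _ ?_⟩
    rw [map_smul, hz', ← map_smul, ap_res, smul_eq_mul, ← rres_rres h hV', ← map_mul, hg,
      ← res_ofR, LinearEquiv.apply_symm_apply]
  · obtain ⟨W₁, hW₁, hy₁, a, ha⟩ := exists_cm_eq (i := i) V
      (ofR.symm (sap (idealModuleι (pullback.snd j i)) _ s)) y hy
    obtain ⟨W₂, hW₂, hy₂, hW₂₁⟩ := TopologicalSpace.Opens.isBasis_iff_nbhd.1
      X.isBasis_affineOpens hy₁
    have h1 : cm (pullback.snd j i) _ (cm i W₂ (rres hW₂₁ a)) = 0 := by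
      rw [cm_rres i hW₂₁, ha, rres_rres, cm_rres, cm_idealModuleι, map_zero]
    obtain ⟨c, d, hcd, hc, hd⟩ := exists_add_of_cm_pullback_eq_zero j i hW₂ _ h1
    obtain ⟨z, hz⟩ := lift c hc
    refine ⟨W₂, hW₂₁.trans hW₁, hy₂, z, sap_injective (idealModuleι (pullback.snd j i)) ?_⟩
    rw [sap_ι_apf_idealRestrict, hz, LinearEquiv.symm_apply_apply, ap_res]
    have h2 : cm i W₂ c = cm i W₂ (rres hW₂₁ a) := by rw [← hcd, map_add, hd, add_zero]
    rw [h2, cm_rres i hW₂₁, ha, rres_rres, ← res_ofR, LinearEquiv.apply_symm_apply]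

lemma exists_isCut_idealRestrict [IsClosedImmersion j] [IsClosedImmersion i] {E : ModuleCat.{0} ℂ} (φ : E ⟶ (globalSections f).obj L)
    (π : E ⟶ W) (ψ : W ⟶ (globalSections f).obj (restrictTo j L))
    (hψ : π ≫ ψ = φ ≫ (globalSections f).map (restrictionMap j L))
    [Mono ((Scheme.Modules.pullback i).map (kernel.ι (evalMap f ψ)))]
    (hgen : ∀ x : X, ∃ (U : X.Opens) (_ : x ∈ U) (v : E), IsGen (gs f L U (φ v)))
    {A : X.Modules} {s : structureModule X ⟶ A} {w : s ≫ restrictionMap i A = 0}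
    (hs : (ShortComplex.mk s (restrictionMap i A) w).ShortExact) (x : X) :
    ∃ U : X.Opens, x ∈ U ∧ ∀ (V : X.Opens) (_ : V ≤ U) (a : Sec (pm A) V) (t : Γ(X, V)),
      IsGen a → sap s V (ofR 1) = t • a →
        IsCut (idealRestrict (pullback.condition (f := j) (g := i))) t := by
  obtain ⟨U, hxU, v, hv⟩ := hgen x
  refine ⟨U, hxU, fun V hV a t ha ht ↦ ?_⟩
  refine isCut_idealRestrict f ψ (isCut_structureMap hs ha ht) (w := π v)
    (l := gs f L V (φ v)) ?_ ?_
  · have := hv.res hV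
    rwa [res_gs] at this
  · have h1 : ψ (π v) = (globalSections f).map (restrictionMap j L) (φ v) :=
      congrArg (fun g ↦ g v) hψ
    rw [h1, ← sap_gs]
    rfl

end IdealCut

end
end SyzygyWeight

/-! ### Cohomology of abelian sheaves and direct images under closed immersions. -/

namespace SyzygyWeight
noncomputable section

/-! ### Abelian sheaves -/

/-- Abelian sheaves. -/
abbrev AbSh (X : Scheme.{0}) := Sheaf (Opens.grothendieckTopology X) AddCommGrpCat.{0}

section AbSheaves
variable {X : Scheme.{0}} {F G : AbSh X} {U V : X.Opens}

/-- The sections of an abelian sheaf. -/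
def asec (F : AbSh X) (U : X.Opens) : Type := F.obj.obj (.op U)

instance : AddCommGroup (asec F U) := inferInstanceAs (AddCommGroup (F.obj.obj (.op U)))

/-- Restriction of sections. -/
def ares (h : V ≤ U) : asec F U →+ asec F V := (F.obj.map (homOfLE h).op).hom

/-- The action of a morphism on sections. -/
def aap (φ : F ⟶ G) (U : X.Opens) : asec F U →+ asec G U := (φ.hom.app (.op U)).hom

lemma aap_res (φ : F ⟶ G) (h : V ≤ U) (s : asec F U) : aap φ V (ares h s) = ares h (aap φ U s) :=
  congrArg (fun k ↦ k.hom s) (φ.hom.naturality (homOfLE h).op)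

lemma epi_of_locally (φ : F ⟶ G) (h : ∀ U (s : asec G U), Locally U fun V hV ↦ ∃ t, aap φ V t = ares hV s) :
    Epi φ := by
  rw [← Sheaf.isLocallySurjective_iff_epi']
  refine ⟨fun {U} s x hx ↦ ?_⟩
  obtain ⟨V, hV, hxV, t, ht⟩ := h _ s x hx
  exact ⟨V, homOfLE hV, ⟨t, ht⟩, hxV⟩

lemma locally_of_epi (φ : F ⟶ G) [h : Epi φ] (s : asec G U) :
    Locally U fun V hV ↦ ∃ t, aap φ V t = ares hV s := by
  rw [← Sheaf.isLocallySurjective_iff_epi'] at h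
  intro x hx
  obtain ⟨V, f, ⟨t, ht⟩, hxV⟩ := Presheaf.imageSieve_mem (Opens.grothendieckTopology X) φ.hom (U := .op U) s x hx
  exact ⟨V, f.le, hxV, t, ht⟩

lemma aap_injective (φ : F ⟶ G) [Mono φ] : Function.Injective (aap φ U) := 
  (AddCommGrpCat.mono_iff_injective ((sheafToPresheaf _ _ ⋙ (evaluation _ _).obj (.op U)).map φ)).1 inferInstance

lemma mono_of_aap (φ : F ⟶ G) (h : ∀ U (s : asec F U), aap φ U s = 0 → s = 0) : Mono φ := by
  have (U : (TopologicalSpace.Opens X)ᵒᵖ) : Mono (φ.hom.app U) :=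
    (AddCommGrpCat.mono_iff_injective _).2 ((injective_iff_map_eq_zero (aap φ U.unop)).2 (h _))
  have : Mono ((sheafToPresheaf _ _).map φ) := NatTrans.mono_of_mono_app φ.hom
  exact (sheafToPresheaf _ _).mono_of_mono_map this

lemma asec_eq_of_forall_notMem (h : ∀ x, x ∉ U) (s t : asec F U) : s = t :=
  TopCat.Sheaf.eq_of_locally_eq' (F : TopCat.Sheaf Ab X) (fun x : Empty ↦ nomatch x) U
    (fun x ↦ nomatch x) (fun x hx ↦ (h x hx).elim) s t (fun x ↦ nomatch x)

lemma exists_aap_eq {S : ShortComplex (AbSh X)} (hS : S.ShortExact) (s : asec S.X₂ U)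
    (h : aap S.g U s = 0) : ∃ t, aap S.f U t = s :=
  have := hS.mono_f
  have : PreservesFiniteLimits ((evaluation (TopologicalSpace.Opens X)ᵒᵖ Ab).obj (.op U)) :=
    ⟨fun _ _ _ ↦ inferInstance⟩
  have := comp_preservesFiniteLimits (sheafToPresheaf (Opens.grothendieckTopology X) Ab)
    ((evaluation _ Ab).obj (.op U))
  (ShortComplex.ab_exact_iff _).1 (hS.exact.map_of_mono_of_preservesKernel
    (sheafToPresheaf _ _ ⋙ (evaluation _ _).obj (.op U)) inferInstance inferInstance) s h

lemma shortExact_of_locally (S : ShortComplex (AbSh X))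
    (inj : ∀ U (s : asec S.X₁ U), aap S.f U s = 0 → s = 0)
    (ex : ∀ U (s : asec S.X₂ U), aap S.g U s = 0 → Locally U fun V hV ↦ ∃ t, aap S.f V t = ares hV s)
    (surj : ∀ U (s : asec S.X₃ U), Locally U fun V hV ↦ ∃ t, aap S.g V t = ares hV s) : S.ShortExact := by
  have := mono_of_aap _ inj
  have := epi_of_locally _ surj
  refine { exact := ?_ }
  rw [S.exact_iff_epi_kernel_lift]
  refine epi_of_locally _ fun U s x hx ↦ ?_
  have hι : kernel.lift S.g S.f S.zero ≫ kernel.ι S.g = S.f := kernel.lift_ι _ _ _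
  have h0 : aap S.g U (aap (kernel.ι S.g) U s) = 0 := by
    have : aap (kernel.ι S.g ≫ S.g) U s = 0 := by rw [kernel.condition]; rfl
    exact this
  obtain ⟨V, hV, hxV, t, ht⟩ := ex U _ h0 x hx
  refine ⟨V, hV, hxV, t, aap_injective (kernel.ι S.g) ?_⟩
  rw [aap_res, ← ht]
  exact congrArg (fun k ↦ aap k V t) hι

end AbSheaves

/-! ### Direct images of abelian sheaves under closed immersions -/

section Push

variable {X D : Scheme.{0}} (i : D ⟶ X) {F G : AbSh D}

/-- The direct image of abelian sheaves. -/
def pushSh : AbSh D ⥤ AbSh X := TopCat.Sheaf.pushforward AddCommGrpCat.{0} i.base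

/-- The inverse image of abelian sheaves. -/
def pullSh : AbSh X ⥤ AbSh D := TopCat.Sheaf.pullback AddCommGrpCat.{0} i.base

/-- The adjunction between inverse and direct images. -/
def pullPushSh : pullSh i ⊣ pushSh i := TopCat.Sheaf.pullbackPushforwardAdjunction _ _

instance : (pushSh i).Additive where
  map_add := rfl

lemma preservesFiniteLimits_pullback {X Y : TopCat.{0}} (f : X ⟶ Y) :
    PreservesFiniteLimits (TopCat.Sheaf.pullback AddCommGrpCat.{0} f) :=
  have : RepresentablyFlat (TopologicalSpace.Opens.map f) := inferInstance
  Functor.SmallCategories.instPreservesFiniteLimitsSheafSheafPullbackOfRepresentablyFlat _ _ _ _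

instance : PreservesFiniteLimits (pullSh i) := preservesFiniteLimits_pullback _

/-- For local surjectivity, neighbourhoods in D of a point of D come from neighbourhoods in X, and
off D all sections of a direct image are zero. -/
lemma pushSh_shortExact [IsClosedImmersion i] (S : ShortComplex (AbSh D)) (hS : S.ShortExact) :
    (S.map (pushSh i)).ShortExact := by
  have := hS.mono_f
  have := hS.epi_g
  refine shortExact_of_locally _ (fun U s h ↦ ?_) (fun U s h x hx ↦ ?_) (fun U s x hx ↦ ?_)
  · exact (injective_iff_map_eq_zero (aap S.f (i ⁻¹ᵁ U))).1 (aap_injective S.f) s h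
  · obtain ⟨t, ht⟩ := exists_aap_eq hS (U := i ⁻¹ᵁ U) s h
    refine ⟨U, le_rfl, hx, t, ht.trans ?_⟩
    exact (congrArg (fun k ↦ k.hom s) (S.X₂.obj.map_id (.op (i ⁻¹ᵁ U)))).symm
  · by_cases hxD : x ∈ Set.range i
    · obtain ⟨y, rfl⟩ := hxD
      obtain ⟨D', hD', hy, t, ht⟩ := locally_of_epi S.g (U := i ⁻¹ᵁ U) s y hx
      obtain ⟨V, hV, hyV, hVD⟩ := exists_preimage_le hy U hx
      refine ⟨V, hV, hyV, ares hVD t, ?_⟩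
      refine (aap_res S.g hVD t).trans ((congrArg (ares hVD) ht).trans ?_)
      exact (congrArg (fun k ↦ k.hom s) (S.X₃.obj.map_comp (homOfLE hD').op (homOfLE hVD).op)).symm
    · let V : X.Opens := ⟨(Set.range i)ᶜ, (Scheme.Hom.isClosedEmbedding i).isClosed_range.isOpen_compl⟩
      refine ⟨U ⊓ V, inf_le_left, ⟨hx, hxD⟩, 0, ?_⟩
      exact asec_eq_of_forall_notMem (F := S.X₃) (U := i ⁻¹ᵁ (U ⊓ V)) (fun y hy ↦ hy.2 ⟨y, rfl⟩) _ _

lemma pushSh_preserves [IsClosedImmersion i] :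
    PreservesFiniteLimits (pushSh i) ∧ PreservesFiniteColimits (pushSh i) :=
  ((pushSh i).exact_tfae.out 0 3 rfl rfl).1 (pushSh_shortExact i)

instance [IsClosedImmersion i] : PreservesFiniteLimits (pushSh i) :=
  (pushSh_preserves i).1

instance [IsClosedImmersion i] : PreservesFiniteColimits (pushSh i) :=
  (pushSh_preserves i).2

/-- The constant sheaf `ℤ`. -/
abbrev constZ (X : Scheme.{0}) : AbSh X :=
  (constantSheaf _ AddCommGrpCat.{0}).obj (AddCommGrpCat.of (ULift ℤ))

/-- Cohomology in degree zero is the group of global sections. -/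
abbrev hZero (F : AbSh X) : F.H 0 ≃+ asec F ⊤ := Sheaf.H.equiv₀ F isTerminalTop

open Abelian

/-- `u` corresponds to the unit section of ℤ on D. Composing with it after applying i_* is the
comparison from H^p(D, F) to H^p(X, i_*F), and in degree 0 this is onto since both groups are the
global sections of F. -/
lemma exists_constZ_map : ∃ u : constZ X ⟶ (pushSh i).obj (constZ D),
    ∀ (F : AbSh D) (y : ((pushSh i).obj F).H 0), ∃ e : constZ D ⟶ F,
      y = Ext.mk₀ (u ≫ (pushSh i).map e) := by
  obtain ⟨u, hu⟩ := (Ext.mk₀_bijective (constZ X) ((pushSh i).obj (constZ D))).2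
    ((hZero ((pushSh i).obj (constZ D))).symm (hZero (constZ D) (Ext.mk₀ (𝟙 _))))
  refine ⟨u, fun F y ↦ ?_⟩
  obtain ⟨e, he⟩ := (Ext.mk₀_bijective (constZ D) F).2 ((hZero F).symm (hZero ((pushSh i).obj F) y))
  refine ⟨e, (hZero _).injective ?_⟩
  have h1 : Ext.mk₀ (u ≫ (pushSh i).map e) = Sheaf.H.map ((pushSh i).map e) 0 (Ext.mk₀ u) := by
    rw [Sheaf.H.map_apply, Ext.mk₀_comp_mk₀]
  have h2 : Ext.mk₀ e = Sheaf.H.map e 0 (Ext.mk₀ (𝟙 (constZ D))) := by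
    rw [Sheaf.H.map_apply, Ext.mk₀_comp_mk₀, Category.id_comp]
  have h3 : hZero F (Ext.mk₀ e) = hZero ((pushSh i).obj F) y :=
    (congrArg (hZero F) he).trans ((hZero F).apply_symm_apply _)
  have h4 : hZero ((pushSh i).obj (constZ D)) (Ext.mk₀ u) = hZero (constZ D) (Ext.mk₀ (𝟙 _)) :=
    (congrArg (hZero _) hu).trans ((hZero _).apply_symm_apply _)
  rw [h1]
  refine Eq.trans ?_ (Sheaf.H.equiv₀_naturality _ _ _)
  refine Eq.trans ?_ (congrArg (aap ((pushSh i).map e) ⊤) h4).symm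
  refine h3.symm.trans ?_
  rw [h2]
  exact (Sheaf.H.equiv₀_naturality _ _ _).symm

/-- Surjectivity on cohomology is preserved by direct images under closed immersions. -/
lemma pushSh_surjective [IsClosedImmersion i] {F G : AbSh D} (φ : F ⟶ G) (p : ℕ)
    (h : Function.Surjective (Sheaf.H.map φ p)) :
    Function.Surjective (Sheaf.H.map ((pushSh i).map φ) p) := by
  obtain ⟨u, hu⟩ := exists_constZ_map i
  -- The comparison map is onto in every degree, by dimension shifting along an embedding of G in an
  -- injective sheaf.
  have key (p : ℕ) : ∀ (G : AbSh D) (y : ((pushSh i).obj G).H p), ∃ z : G.H p,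
      (Ext.mk₀ u).comp (z.mapExactFunctor (pushSh i)) (zero_add p) = y := by
    induction p with
    | zero =>
      intro G y
      obtain ⟨e, rfl⟩ := hu G y
      exact ⟨Ext.mk₀ e, by rw [Ext.mapExactFunctor_mk₀, Ext.mk₀_comp_mk₀]⟩
    | succ p ih =>
      intro G y
      have hS : (ShortComplex.mk (Injective.ι G) _ (cokernel.condition _)).ShortExact :=
        { exact := ShortComplex.exact_cokernel _ }
      -- i_* is right adjoint to the inverse image, which preserves monomorphisms.
      have hI : Injective ((pushSh i).obj (Injective.under G)) :=
        Injective.injective_of_adjoint (pullPushSh i) _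
      obtain ⟨y', hy'⟩ := Ext.covariant_sequence_exact₁ _ (hS.map_of_exact (pushSh i)) y
        (Ext.eq_zero_of_injective (I := (pushSh i).obj (Injective.under G)) _) rfl
      obtain ⟨z, rfl⟩ := ih _ y'
      refine ⟨z.comp hS.extClass rfl, ?_⟩
      rw [← hy', Ext.mapExactFunctor_comp, Ext.mapExactFunctor_extClass]
      exact (Ext.comp_assoc _ _ _ _ _ (by omega)).symm
  intro y
  obtain ⟨z, rfl⟩ := key p _ y
  obtain ⟨x, rfl⟩ := h z
  refine ⟨(Ext.mk₀ u).comp (x.mapExactFunctor (pushSh i)) (zero_add p), ?_⟩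
  rw [Sheaf.H.map_apply, Sheaf.H.map_apply, Ext.mapExactFunctor_comp, Ext.mapExactFunctor_mk₀]
  exact Ext.comp_assoc _ _ _ _ _ (by omega)

end Push

section Chase

open Abelian

/-- As the middle Ext group of T vanishes, y is a connecting image; lift its source along `f.τ₃` and
use naturality of the extension class. -/
lemma ext_surjective_of_shortExact {C : Type*} [Category C] [Abelian C] [HasExt C]
    {S T : ShortComplex C} (hS : S.ShortExact) (hT : T.ShortExact) (f : S ⟶ T) (P : C) (p : ℕ)
    (h0 : Subsingleton (Ext P T.X₂ (p + 1)))
    (h : ∀ y : Ext P T.X₃ p, ∃ x : Ext P S.X₃ p, x.comp (Ext.mk₀ f.τ₃) (add_zero p) = y)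
    (y : Ext P T.X₁ (p + 1)) :
    ∃ x : Ext P S.X₁ (p + 1), x.comp (Ext.mk₀ f.τ₁) (add_zero _) = y := by
  obtain ⟨y', rfl⟩ := Ext.covariant_sequence_exact₁ P hT y (Subsingleton.elim _ _) rfl
  obtain ⟨x, rfl⟩ := h y'
  refine ⟨x.comp hS.extClass rfl, ?_⟩
  rw [Ext.comp_assoc _ _ _ _ (add_zero 1) (by omega), ShortComplex.ShortExact.extClass_naturality hS hT f,
    Ext.comp_assoc _ _ _ _ _ (by omega)]

end Chase

end
end SyzygyWeight

/-! ### Assembly: the map of long exact sequences, and the hypothesis on the divisor. -/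

namespace SyzygyWeight
noncomputable section

/-! ### Restriction sequences in cohomology -/

/-- The abelian sheaf underlying a sheaf of modules. -/
abbrev abSh (X : Scheme.{0}) : X.Modules ⥤ AbSh X := SheafOfModules.toSheaf X.ringCatSheaf

section Sequences

variable {X D : Scheme.{0}} {i : D ⟶ X} {M M' M₁ M₂ A B C : X.Modules} {N N' C' : D.Modules}

lemma IsSES.zero {α : M₁ ⟶ M₂} {ρ : M₂ ⟶ (Scheme.Modules.pushforward i).obj N} (h : IsSES α ρ) :
    (abSh X).map α ≫ (abSh X).map ρ = 0 := by
  rw [← Functor.map_comp, show α ≫ ρ = 0 from apf_ext h.comp]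
  rfl

lemma IsSES.shortExact [IsClosedImmersion i] {α : M₁ ⟶ M₂}
    {ρ : M₂ ⟶ (Scheme.Modules.pushforward i).obj N} (h : IsSES α ρ) :
    (ShortComplex.mk _ _ h.zero).ShortExact := by
  refine shortExact_of_locally _ h.inj h.exact (fun U s x hx ↦ ?_)
  by_cases hxD : x ∈ Set.range i
  · obtain ⟨y, rfl⟩ := hxD
    obtain ⟨V, hV, hy, z, hz⟩ := h.surj U s y hx
    exact ⟨V, hV, hy, z, hz⟩
  · let V : X.Opens := ⟨(Set.range i)ᶜ, (Scheme.Hom.isClosedEmbedding i).isClosed_range.isOpen_compl⟩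
    exact ⟨U ⊓ V, inf_le_left, ⟨hx, hxD⟩, 0, asec_eq_of_forall_notMem (F := (abSh D).obj N)
      (U := i ⁻¹ᵁ (U ⊓ V)) (fun y hy ↦ hy.2 ⟨y, rfl⟩) _ _⟩

lemma twist_map_twistMap (σ : M ⟶ M') (β : B ⟶ C) :
    (twist B).map σ ≫ twistMap M' β = twistMap M β ≫ (twist C).map σ := by
  refine twist_hom_ext fun U m b ↦ ?_
  rw [sap_comp, sap_comp, sap_twist_map, sap_twistMap, sap_twistMap, sap_twist_map]

lemma twist_map_twPush (σ : M ⟶ M') (σ' : N ⟶ N') (r : M ⟶ (Scheme.Modules.pushforward i).obj N)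
    (r' : M' ⟶ (Scheme.Modules.pushforward i).obj N')
    (ρ : B ⟶ (Scheme.Modules.pushforward i).obj C')
    (h : σ ≫ r' = r ≫ (Scheme.Modules.pushforward i).map σ') :
    (twist B).map σ ≫ twPush r' ρ =
      twPush r ρ ≫ (Scheme.Modules.pushforward i).map ((twist C').map σ') := by
  refine twist_hom_ext fun U m b ↦ (pf i U).injective ?_
  change apf ((twist B).map σ ≫ twPush r' ρ) U _ =
    apf (twPush r ρ ≫ (Scheme.Modules.pushforward i).map ((twist C').map σ')) U _
  rw [comp_apf, apf_comp, sap_twist_map, apf_twPush, apf_twPush, sap_twist_map, ← comp_apf, h,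
    apf_comp]

/-- Lifting surjectivity in cohomology from a divisor. -/
lemma cohomology_surjective_of_divisor [IsClosedImmersion i] (hA : IsInvertible A)
    (hB : IsInvertible B) (s : structureModule X ⟶ A) (σ : M ⟶ M') (σ' : N ⟶ N')
    (r : M ⟶ (Scheme.Modules.pushforward i).obj N)
    (r' : M' ⟶ (Scheme.Modules.pushforward i).obj N')
    (h : σ ≫ r' = r ≫ (Scheme.Modules.pushforward i).map σ')
    (hr : ∀ x : X, ∃ U : X.Opens, x ∈ U ∧ ∀ (V : X.Opens) (_ : V ≤ U) (a : Sec (pm A) V)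
      (t : Γ(X, V)), IsGen a → sap s V (ofR 1) = t • a → IsCut r t)
    (hr' : ∀ x : X, ∃ U : X.Opens, x ∈ U ∧ ∀ (V : X.Opens) (_ : V ≤ U) (a : Sec (pm A) V)
      (t : Γ(X, V)), IsGen a → sap s V (ofR 1) = t • a → IsCut r' t)
    (p : ℕ) (h0 : Subsingleton ((cohomology X (p + 1)).obj ((twist ((twist A).obj B)).obj M')))
    (hσ' : Function.Surjective ((cohomology D p).map ((twist ((twist
      ((Scheme.Modules.pullback i).obj A)).obj ((Scheme.Modules.pullback i).obj B))).map σ'))) :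
    Function.Surjective ((cohomology X (p + 1)).map ((twist B).map σ)) := by
  have hS := isSES_twist hA hB s r hr
  have hT := isSES_twist hA hB s r' hr'
  -- The ladder of restriction sequences, with `σ` twisted by B and by B + A, and the direct image
  -- of the twisted `σ'` in the third column.
  let g : ShortComplex.mk _ _ hS.zero ⟶ ShortComplex.mk _ _ hT.zero :=
    { τ₁ := (abSh X).map ((twist B).map σ)
      τ₂ := (abSh X).map ((twist ((twist A).obj B)).map σ)
      τ₃ := (pushSh i).map ((abSh D).map ((twist _).map σ'))
      comm₁₂ := by
        dsimp only
        rw [← Functor.map_comp, ← Functor.map_comp, twist_map_twistMap]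
      comm₂₃ := by
        dsimp only
        rw [← Functor.map_comp, twist_map_twPush σ σ' r r' _ h]
        rfl }
  exact ext_surjective_of_shortExact hS.shortExact hT.shortExact g (constZ X) p h0
    (pushSh_surjective i _ p hσ')

end Sequences

/-! ### Comparison with the syzygies carried on the divisor -/

section Bar

variable {X D P : Scheme.{0}} (f : X ⟶ Spec (CommRingCat.of ℂ)) {i : D ⟶ X} {q : P ⟶ D}
  {L : X.Modules} {E W : ModuleCat.{0} ℂ} [Module.Finite ℂ W]
  (φ : E ⟶ (globalSections f).obj L) (π : E ⟶ W) {n : ℕ}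

/-- Wedging with lifts of a basis of W' and then applying σ gives the map carried by W̄, up to an
automorphism of the ideal sheaf. That composite is onto in cohomology, so its second factor is too.
The basis of W is adapted to W' and is the one to be used on X as well. -/
lemma cohomology_surjective_of_carriesWeight (C : D.Modules) (p : ℕ)
    (hbar : CarriesWeight (i ≫ f) (barφ f φ i) (barπ f φ π i) q C p) (hn : Module.finrank ℂ W = n) :
    ∃ b : Module.Basis (Fin n) ℂ W,
      ∀ σ : (extPower D n).obj (kernelBundle (i ≫ f) (φ ≫ restrictSections f i L)) ⟶ idealModule q,
        σ ≫ idealModuleι q = kernelDet (i ≫ f) b (φ ≫ restrictSections f i L) π →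
        Function.Surjective ((cohomology D p).map ((twist C).map σ)) := by
  obtain ⟨t, σ', hσ', hsurj⟩ := hbar
  let b' := Module.finBasis ℂ (subQuotient f φ π i)
  let c : Module.Basis (Fin (Module.finrank ℂ (barW f φ π i))) ℂ (barW f φ π i) :=
    Module.finBasis ℂ _
  let e : Fin (Module.finrank ℂ (subQuotient f φ π i)) ⊕ Fin (Module.finrank ℂ (barW f φ π i)) ≃
      Fin n := finSumFinEquiv.trans (finCongr (by
    rw [← hn, add_comm]
    exact Submodule.finrank_quotient_add_finrank _))
  refine ⟨(b'.sumQuot c).reindex e, fun σ hσ ↦ ?_⟩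
  -- A splitting of V → V̄ embeds M_V̄ in the kernel bundle of V on D; it respects evaluation
  -- because V' consists of the sections that vanish on D.
  obtain ⟨s, hs⟩ := LinearMap.exists_rightInverse_of_surjective (subSections f φ i).mkQ
    (Submodule.range_mkQ _)
  have hs' (x : barV f φ i) : (subSections f φ i).mkQ (s x) = x := LinearMap.congr_fun hs x
  obtain ⟨ω, hω⟩ := exists_wedge (i ≫ f) (φ := φ ≫ restrictSections f i L) (ψ := barφ f φ i)
    (subQuotient f φ π i) π (barπ f φ π i) (ModuleCat.ofHom s)
    (by
      ext v
      have h : v - s ((subSections f φ i).mkQ v) ∈ subSections f φ i := by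
        refine (Submodule.Quotient.mk_eq_zero _).1 ?_
        change (subSections f φ i).mkQ _ = 0
        rw [map_sub, hs', sub_self]
      have h' : (φ ≫ restrictSections f i L).hom (v - s ((subSections f φ i).mkQ v)) = 0 := h
      rw [map_sub, sub_eq_zero] at h'
      exact h'.symm)
    (fun x ↦ by
      conv_lhs => rw [← hs' x]
      rfl)
    (fun w ⟨v, hv, hw⟩ ↦ ⟨v, hv, hw⟩) b' c e
  -- The unit comparing the trivialization `t` given by the hypothesis with the one attached to the
  -- basis `c`.
  let u : structureModule D ≅ structureModule D := t.symm ≪≫ detIso (i ≫ f) c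
  have h1 : ω ≫ σ = σ' ≫ (idealIso q u).hom := by
    rw [← cancel_mono (idealModuleι q), Category.assoc, Category.assoc, hσ, hω]
    refine Eq.symm ((congrArg (σ' ≫ ·) (idealMap_comp_ι u.hom)).trans ?_)
    rw [← Category.assoc, hσ', Category.assoc]
    change _ ≫ t.hom ≫ t.inv ≫ (detIso (i ≫ f) c).hom = _
    rw [Iso.hom_inv_id_assoc]
    rfl
  have h2 : Function.Surjective ((cohomology D p).map ((twist C).map (ω ≫ σ))) := by
    rw [h1, Functor.map_comp, Functor.map_comp]
    have h3 : Function.Surjective ((cohomology D p).map ((twist C).map (idealIso q u).hom)) :=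
      (AddCommGrpCat.epi_iff_surjective _).1 inferInstance
    exact h3.comp hsurj
  rw [Functor.map_comp, Functor.map_comp] at h2
  exact Function.Surjective.of_comp h2

end Bar

end
end SyzygyWeight

open SyzygyWeight in
theorem lemma1p4 {X Z D : Scheme.{0}} (f : X ⟶ Spec (CommRingCat.of ℂ))
    [IsIntegral X] [Smooth f] [IsProper f]
    (L A B : X.Modules) (hL : IsInvertible L) (hA : IsInvertible A) (hB : IsInvertible B)
    (hgen : IsGloballyGenerated f L)
    (W : ModuleCat.{0} ℂ) [Module.Finite ℂ W]
    (π : (globalSections f).obj L ⟶ W) [Epi π]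
    (j : Z ⟶ X) [IsClosedImmersion j]
    (hZ : IsLinearSection f (𝟙 ((globalSections f).obj L)) π j)
    (i : D ⟶ X) [IsClosedImmersion i] (hD : IsDivisorOf i A)
    (hexact : ((sigmaSequence hZ).map (Scheme.Modules.pullback i)).ShortExact)
    (q : ℕ) (hq : 1 ≤ q)
    (hbar : CarriesWeight (i ≫ f) (barφ f (𝟙 ((globalSections f).obj L)) i)
      (barπ f (𝟙 ((globalSections f).obj L)) π i) (pullback.snd j i)
      ((twist ((Scheme.Modules.pullback i).obj A)).obj ((Scheme.Modules.pullback i).obj B))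
      (q - 1))
    (hvanish : Subsingleton ((cohomology X q).obj ((twist ((twist A).obj B)).obj (idealModule j)))) :
    CarriesWeight f (𝟙 ((globalSections f).obj L)) π j B q := by
  obtain ⟨s, w, hs⟩ := hD
  obtain ⟨p, rfl⟩ : ∃ p, q = p + 1 := ⟨q - 1, by omega⟩
  have : Epi (evalMap f (𝟙 ((globalSections f).obj L))) := hgen
  -- Exactness of (∗) on the divisor enters here, as injectivity of Σ_W|_D → W ⊗ 𝒪_D.
  have : Mono ((Scheme.Modules.pullback i).map (kernel.ι (evalMap f (quotientSections hZ)))) :=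
    hexact.mono_f
  obtain ⟨b, hb⟩ := cohomology_surjective_of_carriesWeight f _ π _ p hbar rfl
  have hψ := comp_quotientSections hZ
  have hgen' (x : X) : ∃ (U : X.Opens) (_ : x ∈ U) (v : (globalSections f).obj L),
      IsGen (gs f L U (𝟙 ((globalSections f).obj L) v)) := by
    obtain ⟨U, hU, a, ha⟩ := exists_isGen_gs f (𝟙 _) hL (Module.Basis.ofVectorSpace ℂ _) x
    exact ⟨U, hU, _, ha⟩
  -- The basis `b` chosen from the divisor also fixes the trivialization on X, so that σ and σ' are
  -- compatible.
  obtain ⟨σ, hσ⟩ := exists_factorization f j b _ π _ hψ hgen'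
  obtain ⟨ψ', hψ'⟩ := exists_divisor_sections f _ π (pullback.condition (f := j) (g := i)) _ hψ
  obtain ⟨σ', hσ'⟩ := exists_factorization (i ≫ f) (pullback.snd j i) b _ π ψ' hψ'
    (exists_isGen_restrict f _ hgen')
  refine ⟨detIso f b, σ, hσ, cohomology_surjective_of_divisor hA hB s σ σ' _ _
    (comp_idealRestrict f _ π b pullback.condition σ hσ σ' hσ')
    (exists_isCut_extPush f i _ hL hs _)
    (exists_isCut_idealRestrict f _ π _ hψ hgen' hs) p hvanish (hb σ' hσ')⟩
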